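/- **Conventions.** An *involutory set* $(K,K_0,\sigma)$ consists of a skew-field $K$, an involution (anti-automorphism of order at most $2$) $\sigma$ of $K$ and an additive subgroup $K_0$ of $K$ with $1\in K_0$, $\{x+x^\sigma\mid x\in K\}\subseteq K_0\subseteq \mathrm{Fix}(\sigma)$ and $x^\sigma K_0x\subseteq K_0$ for all $x\in K$. It is *quadratic of type (iii)* if $K$ is commutative and $K/K_0$ is a separable quadratic extension with Galois group $\langle\sigma\rangle$, and *quadratic of type (iv)* if $K$ is a quaternion division algebra over its centre, $K_0=Z(K)$ and $\sigma$ is the standard involution. A *pseudo-quadratic space* $\Xi=(K,K_0,\sigma,L_0,q)$ consists of an involutory set, a right $K$-vector space $L_0$ and a map $q:L_0\to K$ for which there is a skew-hermitian form $f$ on $L_0$ (so $f(as,bt)=s^\sigma f(a,b)t$ and $f(a,b)^\sigma=-f(b,a)$) with $$q(a+b)\equiv q(a)+q(b)+f(a,b),\qquad q(at)\equiv t^\sigma q(a)t,\qquad q(a)\equiv 0\iff a=0\qquad(\mathrm{mod}\ K_0).$$ It is *proper* if $\sigma\ne\mathrm{id}$, $L_0\neq 0$ and $f$ is non-degenerate.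 An isomorphism $\Xi\to\tilde\Xi$ is a pair $\Phi=(\varphi,\phi)$ of a skew-field isomorphism $\phi:K\to\tilde K$ with $\phi(K_0)=\tilde K_0$ and $\phi\sigma=\tilde\sigma\phi$, and a $\phi$-semilinear bijection $\varphi:L_0\to\tilde L_0$ with $\phi\circ q\equiv\tilde q\circ\varphi$ mod $\tilde K_0$; it induces the map $(a,t)\mapsto(\varphi(a),\phi(t))$. Let $T=\{(a,t)\in L_0\times K\mid q(a)-t\in K_0\}$ be the group with $(a,t)(b,v)=(a+b,\,t+v+f(b,a))$, with Hua maps $h_{(a,t)}(b,v)=(bt^\sigma-at^{-1}f(a,b)t^\sigma,\ tvt^\sigma)$ for $(a,t)\ne(0,0)$. A map $\gamma:T\to\tilde T$ is a *Jordan isomorphism* if it is an isomorphism of groups with $\gamma(0,1)=(0,1)$ and $\gamma\circ h_{x}=\tilde h_{\gamma(x)}\circ\gamma$ for all $x\neq(0,0)$ in $T$. In types (iii) and (iv), for $0\ne a\in L_0$, let $E_a=K_0(q(a))$ be the subfield of $K$ generated by $K_0$ and $q(a)$, let $N(x)=x^\sigma x$, and let $E_a^\perp=\{y\in K\mid x^\sigma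 y+y^\sigma x=0\ \forall x\in E_a\}$. *Reparametrizations.* Let $\Xi$ be of type (iv), $F=Z(K)$, $\dim_KL_0=2$. A *frame* $(a,b,e)$ of $\Xi$ consists of $a,b\in L_0$ with $f(a,a)\ne0$, $b\neq 0$, $f(a,b)=0$ and $q(b)\equiv\mu q(a)$ mod $F$ for some $\mu\in F$, and of $0\neq e\in E_a^\perp$. Put $b_2=b$, $\mu_2=\mu$, $b_3=be$, $\mu_3=-\mu N(e)$. For $i\in\{2,3\}$ let $A_i=E_a\oplus E_aj$ be the quaternion algebra with $j^2=-\mu_i$ and $js=s^\sigma j$ ($s\in E_a$), and let $\Xi_i$ be given by $A_i$, $F$, the standard involution of $A_i$ (again denoted $\sigma$), the right vector space $A_i\times A_i$ and $q_i(x,y)=x^\sigma q(a)x+N(e)\,y^\sigma q(a)y$. The map $(\mathrm{id}_T^i)^{-1}:T(\Xi_i)\to T(\Xi)$ sends $\big((s_1+w_1j,\ s_2+w_2j),\ q_i(s_1+w_1j,s_2+w_2j)+u\big)$ to $$\big(aX+b_iY,\ X^\sigma q(a)X+\mu_iY^\sigma q(a)Y+u\big),\qquad X=s_1+s_2e,\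 Y=w_1+w_2e$$ ($s_k,w_k\in E_a$, $u\in F$). **Theorem.** Let $\Xi$ and $\tilde\Xi$ be proper pseudo-quadratic spaces. A map $\gamma:T\to\tilde T$ is a Jordan isomorphism if and only if one of the following holds: (i) There is an isomorphism $\Phi:\Xi\to\tilde\Xi$ of pseudo-quadratic spaces that induces $\gamma$. (ii) $(K,K_0,\sigma)$ and $(\tilde K,\tilde K_0,\tilde\sigma)$ are both quadratic of type (iv), $\dim_KL_0=2=\dim_{\tilde K}\tilde L_0$, no isomorphism $K\to\tilde K$ of skew-fields extends the map $K_0\to\tilde K_0$ obtained by restricting $\gamma$ to $\{(0,u)\mid u\in K_0\}$, and there are a frame of $\tilde\Xi$, an $i\in\{2,3\}$ and an isomorphism $\Phi:\Xi\to\tilde\Xi_i$ such that $\gamma$ is induced by $(\mathrm{id}^i_{\tilde T})^{-1}\circ\Phi$. (iii) $\gamma$ satisfies the following condition, or $\gamma$ is bijective and $\gamma^{-1}$ satisfies it with $\Xi$ and $\tilde\Xi$ interchanged: $(K,K_0,\sigma)$ is quadratic of type (iv), $(\tilde K,\tilde K_0,\tilde\sigma)$ is quadratic of type (iii), $\dim_KL_0=1$,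 $\dim_{\tilde K}\tilde L_0=2$, and there are $0\ne a\in L_0$, $0\neq e\in E_a^\perp$, an isomorphism of fields $\phi:E_a\to\tilde K$ and $\tilde a,\tilde b\in\tilde L_0$ with $\tilde f(\tilde a,\tilde b)=0$ such that for all $s,t\in E_a$, $u\in K_0$ and $x=s+et$ $$\gamma(ax,\ x^\sigma q(a)x+u)=\big(\tilde a\,\phi(s)+\tilde b\,\phi(t)^{\tilde\sigma},\ \phi(N(x)q(a)+u)\big).$$ (iv) $K\cong\mathbb F_4\cong\tilde K$, $\dim_KL_0=1$, and $\gamma=\tilde\gamma\circ\gamma_0$, where $\gamma_0$ is induced by an isomorphism $\Xi\to\tilde\Xi$ of pseudo-quadratic spaces and $\tilde\gamma$ is a non-trivial inner automorphism of $\tilde T$. Moreover, in case (ii) every frame of $\tilde\Xi$ can be used (for a suitable $i$), and if $\gamma$ itself satisfies the condition in (iii), then $0\neq a\in L_0$ and $0\ne e\in E_a^\perp$ can be chosen arbitrarily. -/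

import Mathlib

open scoped RightActions Quaternion

/-- An (anisotropic, right) pseudo-quadratic space `(K, K₀, σ, L, q)`. The involution `σ` of the
skew-field `K` is `star`, and `L` is a right vector space over `K`: the product `a t` of a vector
and a scalar is `a <• t`. The skew-hermitian form `f` is recorded with `q`; it is determined
by `q` through `q_add`. -/
structure PseudoQuadraticSpace (K L : Type*) [DivisionRing K] [StarRing K]
    [AddCommGroup L] [Module Kᵐᵒᵖ L] where
  /-- The additive subgroup `K₀`, so that `(K, K₀, σ)` is an involutory set. -/
  K₀ : AddSubgroup K
  one_mem : (1 : K) ∈ K₀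
  trace_mem : ∀ x : K, x + star x ∈ K₀
  star_eq : ∀ x ∈ K₀, star x = x
  conj_mem : ∀ x : K, ∀ u ∈ K₀, star x * u * x ∈ K₀
  /-- The pseudo-quadratic form. -/
  q : L → K
  /-- The associated skew-hermitian form. -/
  f : L → L → K
  f_add_left : ∀ a b c, f (a + b) c = f a c + f b c
  f_add_right : ∀ a b c, f a (b + c) = f a b + f a c
  f_smul_left : ∀ a b t, f (a <• t) b = star t * f a b
  f_smul_right : ∀ a b t, f a (b <• t) = f a b * t
  f_skew : ∀ a b, star (f a b) = -f b a
  q_add : ∀ a b, q (a + b) - (q a + q b + f a b) ∈ K₀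
  q_smul : ∀ a t, q (a <• t) - star t * q a * t ∈ K₀
  q_aniso : ∀ a, q a ∈ K₀ ↔ a = 0

/-- An isomorphism `(φ₁, φ) : (K, K₀, σ, L, q) → (K', K₀', σ', L', q')` of pseudo-quadratic
spaces. (The notion only needs the underlying data of the two spaces.) -/
structure PseudoQuadraticIso {K L K' L' : Type*}
    [Ring K] [StarRing K] [AddCommGroup L] [Module Kᵐᵒᵖ L]
    [Ring K'] [StarRing K'] [AddCommGroup L'] [Module K'ᵐᵒᵖ L']
    (K₀ : AddSubgroup K) (q : L → K) (K₀' : AddSubgroup K') (q' : L' → K') where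
  /-- The isomorphism of skew-fields. -/
  φ : K ≃+* K'
  /-- The semilinear bijection of the vector spaces. -/
  φ₁ : L ≃+ L'
  map_smul : ∀ a t, φ₁ (a <• t) = φ₁ a <• φ t
  map_star : ∀ x, φ (star x) = star (φ x)
  map_mem : ∀ x, φ x ∈ K₀' ↔ x ∈ K₀
  map_q : ∀ a, φ (q a) - q' (φ₁ a) ∈ K₀'

namespace PseudoQuadraticSpace

section Basic

variable {K L : Type*} [DivisionRing K] [StarRing K] [AddCommGroup L] [Module Kᵐᵒᵖ L]
variable (Ξ : PseudoQuadraticSpace K L)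

/-- `Ξ` is proper: `σ ≠ id`, `L ≠ 0`, and `f` is non-degenerate. -/
def IsProper : Prop :=
  (∃ x : K, star x ≠ x) ∧ (∃ a : L, a ≠ 0) ∧ ∀ a : L, (∀ b, Ξ.f a b = 0) → a = 0

/-- The set `T = {(a, t) ∈ L × K ∣ q(a) - t ∈ K₀}`. -/
def T : Type _ := {p : L × K // Ξ.q p.1 - p.2 ∈ Ξ.K₀}

variable {Ξ}

/-- The first component of an element of `T`. -/
def T.vec (p : Ξ.T) : L := p.1.1

/-- The second component of an element of `T`. -/
def T.scal (p : Ξ.T) : K := p.1.2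

theorem T.ext' {p r : Ξ.T} (h₁ : p.vec = r.vec) (h₂ : p.scal = r.scal) : p = r :=
  Subtype.ext (Prod.ext h₁ h₂)

theorem T.mem (p : Ξ.T) : Ξ.q p.vec - p.scal ∈ Ξ.K₀ := p.2

theorem f_zero_left (b : L) : Ξ.f 0 b = 0 := by
  have h := Ξ.f_add_left 0 0 b
  rw [add_zero] at h
  exact left_eq_add.mp h

theorem f_zero_right (b : L) : Ξ.f b 0 = 0 := by
  have h := Ξ.f_add_right b 0 0
  rw [add_zero] at h
  exact left_eq_add.mp h

theorem f_neg_left (a b : L) : Ξ.f (-a) b = -Ξ.f a b := by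
  have h := Ξ.f_add_left a (-a) b
  rw [add_neg_cancel, f_zero_left] at h
  exact eq_neg_of_add_eq_zero_right h.symm

theorem f_neg_right (a b : L) : Ξ.f a (-b) = -Ξ.f a b := by
  have h := Ξ.f_add_right a b (-b)
  rw [add_neg_cancel, f_zero_right] at h
  exact eq_neg_of_add_eq_zero_right h.symm

theorem q_zero_mem : Ξ.q 0 ∈ Ξ.K₀ := (Ξ.q_aniso 0).2 rfl

theorem mul_mem' (p r : Ξ.T) :
    Ξ.q (p.vec + r.vec) - (p.scal + r.scal + Ξ.f r.vec p.vec) ∈ Ξ.K₀ := by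
  have h₁ := Ξ.q_add p.vec r.vec
  have h₂ := Ξ.trace_mem (Ξ.f p.vec r.vec)
  rw [Ξ.f_skew] at h₂
  have h := add_mem (add_mem (add_mem h₁ p.mem) r.mem) h₂
  convert h using 1
  abel

theorem inv_mem' (p : Ξ.T) :
    Ξ.q (-p.vec) - (-p.scal + Ξ.f p.vec p.vec) ∈ Ξ.K₀ := by
  have h₁ := Ξ.q_add p.vec (-p.vec)
  rw [add_neg_cancel, f_neg_right] at h₁
  have h := sub_mem (sub_mem q_zero_mem h₁) p.mem
  convert h using 1
  abel

/-- The group structure `(a, t) · (b, v) = (a + b, t + v + f(b, a))` on `T`. -/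
instance : Group Ξ.T :=
  letI : Mul Ξ.T := ⟨fun p r => ⟨(p.vec + r.vec, p.scal + r.scal + Ξ.f r.vec p.vec),
    mul_mem' p r⟩⟩
  letI : One Ξ.T := ⟨⟨(0, 0), by simpa using q_zero_mem⟩⟩
  letI : Inv Ξ.T := ⟨fun p => ⟨(-p.vec, -p.scal + Ξ.f p.vec p.vec), inv_mem' p⟩⟩
  Group.ofLeftAxioms
    (fun p r s => T.ext'
      (show p.vec + r.vec + s.vec = p.vec + (r.vec + s.vec) from add_assoc _ _ _)
      (show p.scal + r.scal + Ξ.f r.vec p.vec + s.scal + Ξ.f s.vec (p.vec + r.vec)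
          = p.scal + (r.scal + s.scal + Ξ.f s.vec r.vec) + Ξ.f (r.vec + s.vec) p.vec by
        rw [Ξ.f_add_right, Ξ.f_add_left]; abel))
    (fun p => T.ext'
      (show 0 + p.vec = p.vec from zero_add _)
      (show 0 + p.scal + Ξ.f p.vec 0 = p.scal by rw [f_zero_right, zero_add, add_zero]))
    (fun p => T.ext'
      (show -p.vec + p.vec = 0 from neg_add_cancel _)
      (show -p.scal + Ξ.f p.vec p.vec + p.scal + Ξ.f p.vec (-p.vec) = 0 by
        rw [f_neg_right]; abel))

theorem T.vec_mul (p r : Ξ.T) : (p * r).vec = p.vec + r.vec := rfl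

theorem T.scal_mul (p r : Ξ.T) : (p * r).scal = p.scal + r.scal + Ξ.f r.vec p.vec := rfl

theorem hua_mem (p r : Ξ.T) :
    Ξ.q (r.vec <• star p.scal
        - p.vec <• (p.scal⁻¹ * Ξ.f p.vec r.vec * star p.scal))
      - p.scal * r.scal * star p.scal ∈ Ξ.K₀ := by
  obtain ⟨⟨a, t⟩, hp⟩ := p
  obtain ⟨⟨b, v⟩, hr⟩ := r
  change Ξ.q (b <• star t - a <• (t⁻¹ * Ξ.f a b * star t)) - t * v * star t ∈ Ξ.K₀
  change Ξ.q a - t ∈ Ξ.K₀ at hp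
  change Ξ.q b - v ∈ Ξ.K₀ at hr
  rcases eq_or_ne t 0 with rfl | ht
  · simpa using q_zero_mem
  set g := Ξ.f a b with hg
  have hst : star t ≠ 0 := star_ne_zero.2 ht
  set c : K := -(t⁻¹ * g * star t) with hc
  have e₁ : b <• star t - a <• (t⁻¹ * g * star t) = b <• star t + a <• c := by
    rw [hc, MulOpposite.op_neg, neg_smul, sub_eq_add_neg]
  rw [e₁]
  have h₁ := Ξ.q_add (b <• star t) (a <• c)
  have h₂ := Ξ.q_smul b (star t)
  have h₃ := Ξ.q_smul a c
  have h₄ := Ξ.conj_mem (star t) _ hr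
  have h₅ := Ξ.conj_mem c _ hp
  have h₆ := Ξ.conj_mem (g * star t) _ (Ξ.trace_mem t⁻¹)
  rw [Ξ.f_smul_left, Ξ.f_smul_right] at h₁
  have hba : Ξ.f b a = -star g := by rw [hg, Ξ.f_skew, neg_neg]
  rw [hba] at h₁
  have h := add_mem (add_mem (add_mem (add_mem (add_mem h₁ h₂) h₃) h₄) h₅) h₆
  convert h using 1
  have k₁ : star c * t * c = t * star g * star t⁻¹ * g * star t := by
    rw [hc]
    simp only [star_neg, star_mul, star_star, neg_mul, mul_neg, neg_neg, mul_assoc]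
    rw [mul_inv_cancel_left₀ ht]
  have k₂ : t * (-star g * c) = t * star g * t⁻¹ * g * star t := by
    rw [hc]
    simp only [neg_mul, mul_neg, neg_neg, mul_assoc]
  simp only [star_star, star_mul, mul_sub, sub_mul, mul_add, add_mul]
  simp only [mul_assoc] at k₁ k₂ ⊢
  rw [k₁, k₂]
  abel

/-- The Hua map `h_{(a,t)} : (b, v) ↦ (b t^σ - a t⁻¹ f(a,b) t^σ, t v t^σ)`. (For the neutral
element `(a, t) = (0, 0)` this is the constant map with value the neutral element.) -/
def hua (p r : Ξ.T) : Ξ.T :=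
  ⟨(r.vec <• star p.scal - p.vec <• (p.scal⁻¹ * Ξ.f p.vec r.vec * star p.scal),
    p.scal * r.scal * star p.scal), hua_mem p r⟩

variable (Ξ)

/-- The element `(0, 1)` of `T`. -/
def unit : Ξ.T := ⟨(0, 1), sub_mem q_zero_mem Ξ.one_mem⟩

/-- `(K, K₀, σ)` is quadratic of type (iii): `K` is commutative and a separable quadratic
extension of `K₀` with Galois group generated by `σ`, that is, `σ` is a non-trivial automorphism
(of order two) with fixed field `K₀`. -/
def IsTypeIII : Prop :=
  (∀ x y : K, x * y = y * x) ∧ (∃ x : K, star x ≠ x) ∧ ∀ x : K, x ∈ Ξ.K₀ ↔ star x = x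

/-- `(K, K₀, σ)` is quadratic of type (iv): `K₀` is the centre of `K`, `K` is a quaternion
(division) algebra over its centre, and `σ` is its standard involution. Here
`ℍ[F, c₁, c₂, c₃]` has the basis `1, i, j, ij` with `i² = c₁ + c₂ i`, `j² = c₃` and
`ji = (c₂ - i)j`; it is `(E/F, c₃)` with `E = F(i)`, and `star` is its standard involution. -/
def IsTypeIV : Prop :=
  (∀ x : K, x ∈ Ξ.K₀ ↔ x ∈ Subring.center K) ∧
  ∃ (c₁ c₂ c₃ : Subring.center K) (g : K ≃+* ℍ[Subring.center K, c₁, c₂, c₃]),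
    (∀ c : Subring.center K, g c = algebraMap _ _ c) ∧ ∀ x, g (star x) = star (g x)

/-- The field `E_a`, generated by `K₀` and `q(a)` (for spaces of type (iii) or (iv)). -/
def E (a : L) : Subring K := Subring.closure (insert (Ξ.q a) (Ξ.K₀ : Set K))

/-- `e` is a non-zero element of `E_a^⊥`, the orthogonal complement of `E_a` in `K` with respect
to the bilinear form `(x, y) ↦ x^σ y + y^σ x` of the norm. -/
def IsPerp (a : L) (e : K) : Prop :=
  e ≠ 0 ∧ ∀ x ∈ Ξ.E a, star x * e + star e * x = 0

end Basic

section Frame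

variable {K L : Type*} [DivisionRing K] [StarRing K] [AddCommGroup L] [Module Kᵐᵒᵖ L]

/-- For a 2-dimensional space of type (iv) with centre `F = K₀`: an orthogonal basis `a, b` with
`q(b) ≡ μ q(a)` modulo `F` for some `μ ∈ F`, together with an element `e ≠ 0` of `E_a^⊥`. With
`α = q(a)`, the elements `τ, n, ν` of `F` are the trace of `α`, the norm of `α` and the
norm of `e`. -/
structure Frame (Ξ : PseudoQuadraticSpace K L) where
  a : L
  b : L
  e : K
  τ : Subring.center K
  n : Subring.center K
  ν : Subring.center K
  μ : Subring.center K
  f_self : Ξ.f a a ≠ 0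
  f_orth : Ξ.f a b = 0
  b_ne : b ≠ 0
  perp : Ξ.IsPerp a e
  trace_eq : Ξ.q a + star (Ξ.q a) = τ
  norm_eq : star (Ξ.q a) * Ξ.q a = n
  norm_e : star e * e = ν
  q_b : Ξ.q b - μ * Ξ.q a ∈ Ξ.K₀

namespace Frame

variable {Ξ : PseudoQuadraticSpace K L} (fr : Frame Ξ)

/-- The second basis vector that is used for the parametrization `Ξ_i`: it is `b` for
`i = 2` (`third = false`) and `b e` for `i = 3` (`third = true`). -/
def vec (third : Bool) : L := if third then fr.b <• fr.e else fr.b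

/-- The coefficient `μ_i` with `q(b_i) ≡ μ_i q(a)` modulo `F`, where `b_i = fr.vec i`. -/
def coeff (third : Bool) : Subring.center K := if third then -(fr.μ * fr.ν) else fr.μ

/-- The quaternion algebra `A_i = (E_a/F, -μ_i) = E_a ⊕ E_a j` of the parametrization `Ξ_i`, with
`i = q(a)` and `j² = -μ_i`. -/
abbrev Alg (third : Bool) : Type _ :=
  ℍ[Subring.center K, -fr.n, fr.τ, -fr.coeff third]

/-- The subgroup `F` of `A_i`. -/
def center₀ (third : Bool) : AddSubgroup (fr.Alg third) :=
  (algebraMap (Subring.center K) (fr.Alg third)).toAddMonoidHom.range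

/-- The pseudo-quadratic form `q_i(x, y) = x^σ α x + ν y^σ α y` of the parametrization `Ξ_i` on
the right vector space `A_i × A_i`, where `α = q(a) ∈ E_a ⊆ A_i`. -/
def form (third : Bool) (v : fr.Alg third × fr.Alg third) : fr.Alg third :=
  star v.1 * (⟨0, 1, 0, 0⟩ : fr.Alg third) * v.1
    + fr.ν • (star v.2 * (⟨0, 1, 0, 0⟩ : fr.Alg third) * v.2)

/-- The element `r + s α` of `E_a ⊆ K`. -/
def emb (r s : Subring.center K) : K := r + s * Ξ.q fr.a

/-- The first coordinate `s₁ + s₂ e` of the vector of `L` that corresponds to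
`(s₁ + w₁ j, s₂ + w₂ j) ∈ A_i × A_i`, where `s₁, s₂, w₁, w₂ ∈ E_a`. -/
def coordA (third : Bool) (v : fr.Alg third × fr.Alg third) : K :=
  fr.emb v.1.re v.1.imI + fr.emb v.2.re v.2.imI * fr.e

/-- The second coordinate `w₁ + w₂ e` of the vector of `L` that corresponds to
`(s₁ + w₁ j, s₂ + w₂ j) ∈ A_i × A_i`, where `s₁, s₂, w₁, w₂ ∈ E_a`. -/
def coordB (third : Bool) (v : fr.Alg third × fr.Alg third) : K :=
  fr.emb v.1.imJ v.1.imK + fr.emb v.2.imJ v.2.imK * fr.e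

/-- The map `(id_T^i)⁻¹` from `T(Ξ_i)` to `T(Ξ)` that changes the parametrization:
`(s₁ + w₁ j, s₂ + w₂ j)` is sent to `a (s₁ + s₂ e) + b_i (w₁ + w₂ e)`, and the second components
are matched by `q_i(x, y) + u ↦ X^σ q(a) X + μ_i Y^σ q(a) Y + u` for `u ∈ F`, where `(X, Y)` are
the coordinates of the image of `(x, y)` with respect to `a, b_i`. -/
def switch (third : Bool) (p : (fr.Alg third × fr.Alg third) × fr.Alg third) : L × K :=
  let X := fr.coordA third p.1
  let Y := fr.coordB third p.1
  let u : Subring.center K := (p.2 - fr.form third p.1).re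
  (fr.a <• X + fr.vec third <• Y,
    star X * Ξ.q fr.a * X + fr.coeff third * (star Y * Ξ.q fr.a * Y) + u)

end Frame

end Frame

section Maps

variable {K L K' L' : Type*} [DivisionRing K] [StarRing K] [AddCommGroup L] [Module Kᵐᵒᵖ L]
  [DivisionRing K'] [StarRing K'] [AddCommGroup L'] [Module K'ᵐᵒᵖ L']
  {Ξ : PseudoQuadraticSpace K L} {Ξ' : PseudoQuadraticSpace K' L'}

/-- `γ : T → T'` is a Jordan isomorphism: an isomorphism of groups with `γ(0, 1) = (0, 1)` that
preserves the Hua maps. -/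
def IsJordanIso (γ : Ξ.T → Ξ'.T) : Prop :=
  Function.Bijective γ ∧ (∀ p r, γ (p * r) = γ p * γ r) ∧ γ Ξ.unit = Ξ'.unit ∧
    ∀ p r, γ (hua p r) = hua (γ p) (γ r)

/-- `γ` is induced by the isomorphism `Φ = (φ₁, φ)`: `γ(a, t) = (φ₁(a), φ(t))`. -/
def InducedBy (Φ : PseudoQuadraticIso Ξ.K₀ Ξ.q Ξ'.K₀ Ξ'.q) (γ : Ξ.T → Ξ'.T) : Prop :=
  ∀ p, (γ p).vec = Φ.φ₁ p.vec ∧ (γ p).scal = Φ.φ p.scal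

/-- `γ` is induced by an isomorphism of pseudo-quadratic spaces. -/
def CaseI (γ : Ξ.T → Ξ'.T) : Prop :=
  ∃ Φ : PseudoQuadraticIso Ξ.K₀ Ξ.q Ξ'.K₀ Ξ'.q, InducedBy Φ γ

/-- `γ` is induced by `(id_{T'}^i)⁻¹ ∘ Φ` for an `i ∈ {2, 3}` and an isomorphism `Φ` from `Ξ`
onto the parametrization `Ξ'_i` of `T'`. -/
def InducedViaFrame (fr : Frame Ξ') (γ : Ξ.T → Ξ'.T) : Prop :=
  ∃ (third : Bool) (Φ : PseudoQuadraticIso Ξ.K₀ Ξ.q (fr.center₀ third) (fr.form third)),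
    ∀ p, ((γ p).vec, (γ p).scal) = fr.switch third (Φ.φ₁ p.vec, Φ.φ p.scal)

/-- Both spaces are 2-dimensional of type (iv), no isomorphism `K → K'` of skew-fields extends the
map `K₀ → K₀'` that is induced by `γ`, and `γ` is induced by an isomorphism onto another
parametrization of `T'`. -/
def CaseII (γ : Ξ.T → Ξ'.T) : Prop :=
  Ξ.IsTypeIV ∧ Ξ'.IsTypeIV ∧ Module.finrank Kᵐᵒᵖ L = 2 ∧ Module.finrank K'ᵐᵒᵖ L' = 2 ∧
  (¬ ∃ g : K ≃+* K', ∀ p : Ξ.T, p.vec = 0 → (γ p).scal = g p.scal) ∧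
  ∃ fr : Frame Ξ', InducedViaFrame fr γ

/-- The formula
`γ(a x, x^σ q(a) x + u) = (a' φ(s) + b' φ(t)^σ', φ(N(x) q(a) + u))` for `x = s + e t`, where
`s, t ∈ E_a` and `u ∈ K₀`, for some isomorphism of fields `φ : E_a → K'` and some `a', b' ∈ L'`
with `f'(a', b') = 0`. The variable `y` stands for `N(x) q(a) + u` as an element of `E_a`. -/
def SplitFormula (γ : Ξ.T → Ξ'.T) (a : L) (e : K) : Prop :=
  ∃ (φ : Ξ.E a ≃+* K') (a' b' : L'), Ξ'.f a' b' = 0 ∧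
    ∀ (p : Ξ.T) (x : K) (s t y : Ξ.E a), ∀ u ∈ Ξ.K₀, x = s + e * t →
      p.vec = a <• x → p.scal = star x * Ξ.q a * x + u → y = star x * x * Ξ.q a + u →
      (γ p).vec = a' <• φ s + b' <• star (φ t) ∧ (γ p).scal = φ y

/-- `Ξ` is 1-dimensional of type (iv), `Ξ'` is 2-dimensional of type (iii), and `γ` is given by the
formula above for some `a ≠ 0` in `L` and some `e ≠ 0` in `E_a^⊥`. -/
def CaseIII (γ : Ξ.T → Ξ'.T) : Prop :=
  Ξ.IsTypeIV ∧ Ξ'.IsTypeIII ∧ Module.finrank Kᵐᵒᵖ L = 1 ∧ Module.finrank K'ᵐᵒᵖ L' = 2 ∧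
  ∃ (a : L) (e : K), a ≠ 0 ∧ Ξ.IsPerp a e ∧ SplitFormula γ a e

/-- `γ` is bijective and its inverse is as in `CaseIII`. -/
def CaseIIIInv (γ : Ξ.T → Ξ'.T) : Prop :=
  ∃ δ : Ξ'.T → Ξ.T, Function.LeftInverse δ γ ∧ Function.RightInverse δ γ ∧ CaseIII δ

/-- `K ≅ 𝔽₄ ≅ K'`, `dim L = 1`, and `γ` is induced by an isomorphism of pseudo-quadratic spaces
followed by a non-trivial inner automorphism of `T'`. -/
def CaseIV (γ : Ξ.T → Ξ'.T) : Prop :=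
  Nonempty (K ≃+* GaloisField 2 2) ∧ Nonempty (K' ≃+* GaloisField 2 2) ∧
  Module.finrank Kᵐᵒᵖ L = 1 ∧
  ∃ (Φ : PseudoQuadraticIso Ξ.K₀ Ξ.q Ξ'.K₀ Ξ'.q) (γ₀ : Ξ.T → Ξ'.T) (g : Ξ'.T),
    InducedBy Φ γ₀ ∧ MulAut.conj g ≠ 1 ∧ ∀ p, γ p = MulAut.conj g (γ₀ p)

end Maps

end PseudoQuadraticSpace

namespace PseudoQuadraticSpace

section RightScalars

variable {K L : Type*} [DivisionRing K] [AddCommGroup L] [Module Kᵐᵒᵖ L]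

theorem rs_mul (a : L) (x y : K) : a <• (x * y) = (a <• x) <• y := by
  rw [MulOpposite.op_mul, mul_smul]

theorem rs_add (a : L) (x y : K) : a <• (x + y) = a <• x + a <• y := by
  rw [MulOpposite.op_add, add_smul]

theorem rs_sub (a : L) (x y : K) : a <• (x - y) = a <• x - a <• y := by
  rw [MulOpposite.op_sub, sub_smul]

theorem rs_neg (a : L) (x : K) : a <• (-x) = -(a <• x) := by
  rw [MulOpposite.op_neg, neg_smul]

theorem rs_one (a : L) : a <• (1 : K) = a := by
  rw [MulOpposite.op_one, one_smul]

theorem rs_zero (a : L) : a <• (0 : K) = 0 := by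
  rw [MulOpposite.op_zero, zero_smul]

theorem add_rs (a b : L) (x : K) : (a + b) <• x = a <• x + b <• x := smul_add _ _ _

theorem sub_rs (a b : L) (x : K) : (a - b) <• x = a <• x - b <• x := smul_sub _ _ _

theorem neg_rs (a : L) (x : K) : (-a) <• x = -(a <• x) := smul_neg _ _

theorem zero_rs (x : K) : (0 : L) <• x = 0 := smul_zero _

theorem rs_eq_zero {a : L} {x : K} : a <• x = 0 ↔ a = 0 ∨ x = 0 := by
  rw [smul_eq_zero, MulOpposite.op_eq_zero_iff, or_comm]

theorem rs_left_cancel {a : L} {x y : K} (ha : a ≠ 0) (h : a <• x = a <• y) : x = y := by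
  rw [← sub_eq_zero, ← rs_sub, rs_eq_zero] at h
  exact sub_eq_zero.1 (h.resolve_left ha)

theorem rs_right_cancel {a b : L} {x : K} (hx : x ≠ 0) (h : a <• x = b <• x) : a = b := by
  rw [← sub_eq_zero, ← sub_rs, rs_eq_zero] at h
  exact sub_eq_zero.1 (h.resolve_right hx)

end RightScalars

section General

variable {K L : Type*} [DivisionRing K] [StarRing K] [AddCommGroup L] [Module Kᵐᵒᵖ L]
variable {Ξ : PseudoQuadraticSpace K L}

theorem f_sub_right (a b c : L) : Ξ.f a (b - c) = Ξ.f a b - Ξ.f a c := by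
  rw [sub_eq_add_neg, Ξ.f_add_right, f_neg_right, ← sub_eq_add_neg]

theorem star_f (a b : L) : star (Ξ.f a b) = -Ξ.f b a := Ξ.f_skew a b

theorem f_eq_zero_symm {a b : L} (h : Ξ.f a b = 0) : Ξ.f b a = 0 := by
  rw [← neg_eq_zero, ← star_f, h, star_zero]

theorem star_mul_self_mem (x : K) : star x * x ∈ Ξ.K₀ := by
  simpa using Ξ.conj_mem x 1 Ξ.one_mem

theorem mul_star_self_mem (x : K) : x * star x ∈ Ξ.K₀ := by
  simpa using star_mul_self_mem (Ξ := Ξ) (star x)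

theorem inv_mem_K₀ {u : K} (hu : u ∈ Ξ.K₀) : u⁻¹ ∈ Ξ.K₀ := by
  rcases eq_or_ne u 0 with rfl | h
  · simp
  have := Ξ.conj_mem u⁻¹ u hu
  rwa [star_inv₀, Ξ.star_eq u hu, inv_mul_cancel₀ h, one_mul] at this

theorem IsProper.eq_zero_of_forall_mul_mem (hΞ : Ξ.IsProper) {d : K}
    (h : ∀ t, d * t ∈ Ξ.K₀) : d = 0 := by
  by_contra hd
  obtain ⟨x, hx⟩ := hΞ.1
  have := Ξ.star_eq _ (h (d⁻¹ * x))
  rw [mul_inv_cancel_left₀ hd] at this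
  exact hx this

/-- The form `f` is determined by `q` modulo `K₀`. -/
theorem IsProper.f_eq (hΞ : Ξ.IsProper) {a b : L} {d : K}
    (h : ∀ t, Ξ.q (a + b <• t) - (Ξ.q a + Ξ.q (b <• t) + d * t) ∈ Ξ.K₀) : Ξ.f a b = d := by
  refine sub_eq_zero.1 (hΞ.eq_zero_of_forall_mul_mem fun t => ?_)
  have h₁ := Ξ.q_add a (b <• t)
  rw [Ξ.f_smul_right] at h₁
  convert sub_mem (h t) h₁ using 1
  rw [sub_mul]; abel

theorem IsProper.f_self (hΞ : Ξ.IsProper) (p : Ξ.T) :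
    Ξ.f p.vec p.vec = p.scal - star p.scal := by
  have key : Ξ.f p.vec p.vec = Ξ.q p.vec - star (Ξ.q p.vec) := by
    refine hΞ.f_eq fun t => ?_
    have h₁ := Ξ.q_smul p.vec (1 + t)
    have h₂ := Ξ.q_smul p.vec t
    have h₃ := Ξ.trace_mem (star (Ξ.q p.vec) * t)
    rw [rs_add, rs_one] at h₁
    convert add_mem (sub_mem h₁ h₂) h₃ using 1
    simp only [star_add, star_one, star_mul, star_star]
    noncomm_ring
  have h := Ξ.star_eq _ p.mem
  rw [star_sub] at h
  rw [key, sub_eq_sub_iff_add_eq_add]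
  rw [sub_eq_sub_iff_add_eq_add] at h
  rw [← h, add_comm]

/-- The element `(a, t)` of `T`. -/
def T.mk (a : L) (t : K) (h : Ξ.q a - t ∈ Ξ.K₀) : Ξ.T := ⟨(a, t), h⟩

@[simp] theorem T.vec_mk (a : L) (t : K) (h : Ξ.q a - t ∈ Ξ.K₀) : (T.mk a t h).vec = a := rfl

@[simp] theorem T.scal_mk (a : L) (t : K) (h : Ξ.q a - t ∈ Ξ.K₀) : (T.mk a t h).scal = t := rfl

theorem T.vec_one : (1 : Ξ.T).vec = 0 := rfl

theorem T.scal_one : (1 : Ξ.T).scal = 0 := rfl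

theorem T.vec_inv (p : Ξ.T) : (p⁻¹).vec = -p.vec := rfl

theorem T.scal_inv' (p : Ξ.T) : (p⁻¹).scal = -p.scal + Ξ.f p.vec p.vec := rfl

theorem T.scal_inv (hΞ : Ξ.IsProper) (p : Ξ.T) : (p⁻¹).scal = -star p.scal := by
  rw [T.scal_inv', hΞ.f_self]; abel

theorem T.scal_unit : (unit Ξ).scal = 1 := rfl

theorem T.vec_unit : (unit Ξ).vec = 0 := rfl

theorem T.vec_hua (p r : Ξ.T) : (hua p r).vec = r.vec <• star p.scal
    - p.vec <• (p.scal⁻¹ * Ξ.f p.vec r.vec * star p.scal) := rfl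

theorem T.scal_hua (p r : Ξ.T) : (hua p r).scal = p.scal * r.scal * star p.scal := rfl

theorem T.vec_eq_zero_iff (p : Ξ.T) : p.vec = 0 ↔ p.scal ∈ Ξ.K₀ := by
  rw [← Ξ.q_aniso]
  constructor
  · intro h; simpa using sub_mem h p.mem
  · intro h; simpa using add_mem p.mem h

theorem T.scal_ne_zero {p : Ξ.T} (h : p.vec ≠ 0) : p.scal ≠ 0 := fun h' =>
  h (p.vec_eq_zero_iff.2 (h' ▸ zero_mem _))

/-- The element `(0, u)` of `T`. -/
def T.cen (u : K) (hu : u ∈ Ξ.K₀) : Ξ.T := T.mk 0 u (sub_mem q_zero_mem hu)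

@[simp] theorem T.vec_cen (u : K) (hu : u ∈ Ξ.K₀) : (T.cen u hu).vec = 0 := rfl

@[simp] theorem T.scal_cen (u : K) (hu : u ∈ Ξ.K₀) : (T.cen u hu).scal = u := rfl

theorem T.scal_mul_cen (p : Ξ.T) (u : K) (hu : u ∈ Ξ.K₀) :
    (p * T.cen u hu).scal = p.scal + u := by
  rw [T.scal_mul, T.vec_cen, f_zero_left, T.scal_cen, add_zero]

theorem T.vec_mul_cen (p : Ξ.T) (u : K) (hu : u ∈ Ξ.K₀) :
    (p * T.cen u hu).vec = p.vec := by
  rw [T.vec_mul, T.vec_cen, add_zero]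

/-- The standard element `(a, q(a))` of `T` over a vector `a`. -/
def T.lift (a : L) : Ξ.T := T.mk a (Ξ.q a) (by simp)

@[simp] theorem T.vec_lift (a : L) : (T.lift a : Ξ.T).vec = a := rfl

@[simp] theorem T.scal_lift (a : L) : (T.lift a : Ξ.T).scal = Ξ.q a := rfl

/-- The element `(a x, x^σ t x)` of `T` for `(a, t) ∈ T`. -/
def T.rsmul (p : Ξ.T) (x : K) : Ξ.T := T.mk (p.vec <• x) (star x * p.scal * x) (by
  have h₁ := Ξ.q_smul p.vec x
  have h₂ := Ξ.conj_mem x _ p.mem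
  convert add_mem h₁ h₂ using 1
  noncomm_ring)

@[simp] theorem T.vec_rsmul (p : Ξ.T) (x : K) : (p.rsmul x).vec = p.vec <• x := rfl

@[simp] theorem T.scal_rsmul (p : Ξ.T) (x : K) : (p.rsmul x).scal = star x * p.scal * x := rfl

theorem T.exists_cen_of_vec_eq {p r : Ξ.T} (h : p.vec = r.vec) :
    ∃ (u : K) (hu : u ∈ Ξ.K₀), r = p * T.cen u hu := by
  refine ⟨r.scal - p.scal, ?_, T.ext' ?_ ?_⟩
  · have := sub_mem p.mem r.mem
    rw [h] at this
    convert this using 1; abel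
  · rw [T.vec_mul_cen, h]
  · rw [T.scal_mul_cen]; abel

theorem IsProper.exists_trace_ne_zero (hΞ : Ξ.IsProper) : ∃ x : K, x + star x ≠ 0 := by
  by_contra! h
  obtain ⟨x, hx⟩ := hΞ.1
  have h1 := h 1
  have h2 := h x
  rw [star_one] at h1
  have : (x + x : K) = 0 := by rw [← mul_one x, ← mul_add, h1, mul_zero]
  exact hx (by rw [eq_neg_of_add_eq_zero_right h2, eq_comm]; exact eq_neg_of_add_eq_zero_left this)

theorem IsProper.eq_zero_of_forall_trace (hΞ : Ξ.IsProper) {d : K}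
    (h : ∀ t, d * t + star (d * t) = 0) : d = 0 := by
  by_contra hd
  obtain ⟨x, hx⟩ := hΞ.exists_trace_ne_zero
  have := h (d⁻¹ * x)
  rw [mul_inv_cancel_left₀ hd] at this
  exact hx this

theorem T.commute_iff (p r : Ξ.T) :
    p * r = r * p ↔ Ξ.f p.vec r.vec + star (Ξ.f p.vec r.vec) = 0 := by
  rw [star_f]
  constructor
  · intro h
    have := congrArg T.scal h
    rw [T.scal_mul, T.scal_mul, add_comm r.scal] at this
    rw [add_left_cancel this]; abel
  · intro h
    refine T.ext' (by rw [T.vec_mul, T.vec_mul, add_comm]) ?_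
    rw [T.scal_mul, T.scal_mul, add_comm r.scal, add_left_cancel_iff]
    rw [← sub_eq_add_neg, sub_eq_zero] at h
    exact h.symm

theorem IsProper.vec_eq_zero_iff (hΞ : Ξ.IsProper) (p : Ξ.T) :
    p.vec = 0 ↔ ∀ r, p * r = r * p := by
  constructor
  · intro h r
    rw [T.commute_iff, h, f_zero_left, star_zero, add_zero]
  · intro h
    refine hΞ.2.2 _ fun b => hΞ.eq_zero_of_forall_trace fun t => ?_
    have := (T.commute_iff _ _).1 (h (T.lift (b <• t)))
    rwa [T.vec_lift, Ξ.f_smul_right] at this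

/-- The subring of `K` generated by `K₀`. -/
def gen (Ξ : PseudoQuadraticSpace K L) : Subring K := Subring.closure (Ξ.K₀ : Set K)

theorem mem_gen {u : K} (hu : u ∈ Ξ.K₀) : u ∈ Ξ.gen := Subring.subset_closure hu

theorem star_mem_gen {r : K} (hr : r ∈ Ξ.gen) : star r ∈ Ξ.gen := by
  induction hr using Subring.closure_induction with
  | mem x hx => rw [Ξ.star_eq x hx]; exact mem_gen hx
  | zero => rw [star_zero]; exact zero_mem _
  | one => rw [star_one]; exact Subring.one_mem _
  | add x y _ _ hx hy => rw [star_add]; exact add_mem hx hy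
  | neg x _ hx => rw [star_neg]; exact neg_mem hx
  | mul x y _ _ hx hy => rw [star_mul]; exact mul_mem hy hx

theorem inv_mem_gen {r : K} (hr : r ∈ Ξ.gen) : r⁻¹ ∈ Ξ.gen := by
  rcases eq_or_ne r 0 with rfl | h
  · simp
  have hs : star r ≠ 0 := star_ne_zero.2 h
  have : r⁻¹ = star r * (r * star r)⁻¹ := by
    rw [mul_inv_rev, mul_inv_cancel_left₀ hs]
  rw [this]
  exact mul_mem (star_mem_gen hr) (mem_gen (inv_mem_K₀ (mul_star_self_mem r)))

theorem conj_mem_gen {r : K} (hr : r ∈ Ξ.gen) {x : K} (hx : x ≠ 0) : x⁻¹ * r * x ∈ Ξ.gen := by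
  induction hr using Subring.closure_induction with
  | mem u hu =>
    have hs : star x ≠ 0 := star_ne_zero.2 hx
    have : x⁻¹ * u * x = (star x * x)⁻¹ * (star x * u * x) := by
      rw [mul_inv_rev]
      simp only [mul_assoc]
      rw [inv_mul_cancel_left₀ hs]
    rw [this]
    exact mul_mem (mem_gen (inv_mem_K₀ (star_mul_self_mem x))) (mem_gen (Ξ.conj_mem x u hu))
  | zero => simp [zero_mem]
  | one => rw [mul_one, inv_mul_cancel₀ hx]; exact Subring.one_mem _
  | add r s _ _ hr hs =>
    rw [mul_add, add_mul]; exact add_mem hr hs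
  | neg r _ hr => rw [mul_neg, neg_mul]; exact neg_mem hr
  | mul r s _ _ hr hs =>
    have : x⁻¹ * (r * s) * x = (x⁻¹ * r * x) * (x⁻¹ * s * x) := by
      simp only [mul_assoc]; rw [mul_inv_cancel_left₀ hx]
    rw [this]; exact mul_mem hr hs

/-- `K₀` lies in the centre of `K`. -/
def IsCentral (Ξ : PseudoQuadraticSpace K L) : Prop := ∀ u ∈ Ξ.K₀, ∀ x : K, u * x = x * u

/-- Either `K₀` generates `K`, or it is central. -/
theorem gen_eq_top_or_isCentral (Ξ : PseudoQuadraticSpace K L) : Ξ.gen = ⊤ ∨ Ξ.IsCentral := by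
  by_cases h : ∃ y, y ∉ Ξ.gen
  swap
  · push Not at h
    exact Or.inl (eq_top_iff.2 fun y _ => h y)
  right
  have key : ∀ x, x ∉ Ξ.gen → ∀ r ∈ Ξ.gen, r * x = x * r := by
    intro x hx r hr
    have hx0 : x ≠ 0 := fun h => hx (h ▸ zero_mem _)
    have hx1 : 1 + x ≠ 0 := fun h => hx (by
      rw [eq_neg_of_add_eq_zero_right h]; exact neg_mem (Subring.one_mem _))
    set r₁ := x⁻¹ * r * x with h₁
    set r₂ := (1 + x)⁻¹ * r * (1 + x) with h₂
    have m₁ : r₁ ∈ Ξ.gen := conj_mem_gen hr hx0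
    have m₂ : r₂ ∈ Ξ.gen := conj_mem_gen hr hx1
    have e₁ : x * r₁ = r * x := by rw [h₁, mul_assoc, mul_inv_cancel_left₀ hx0]
    have e₂ : (1 + x) * r₂ = r * (1 + x) := by rw [h₂, mul_assoc, mul_inv_cancel_left₀ hx1]
    have e₃ : x * (r₁ - r₂) = r₂ - r := by
      rw [mul_sub, e₁]
      rw [add_mul, one_mul, mul_add, mul_one] at e₂
      rw [sub_eq_sub_iff_add_eq_add, add_comm, ← e₂]
    by_cases h0 : r₁ - r₂ = 0
    · rw [h0, mul_zero] at e₃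
      rw [← e₁, sub_eq_zero.1 h0, sub_eq_zero.1 e₃.symm]
    · exact absurd (by
        have : x = (r₂ - r) * (r₁ - r₂)⁻¹ := by rw [← e₃, mul_inv_cancel_right₀ h0]
        rw [this]
        exact mul_mem (sub_mem m₂ hr) (inv_mem_gen (sub_mem m₁ m₂))) hx
  obtain ⟨y, hy⟩ := h
  intro u hu x
  by_cases hx : x ∈ Ξ.gen
  · have hxy : x + y ∉ Ξ.gen := fun h => hy (by simpa using sub_mem h hx)
    have h₁ := key _ hxy u (mem_gen hu)
    rw [mul_add, add_mul, key y hy u (mem_gen hu)] at h₁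
    exact add_right_cancel h₁
  · exact key x hx u (mem_gen hu)

end General

section Central

variable {K L : Type*} [DivisionRing K] [StarRing K] [AddCommGroup L] [Module Kᵐᵒᵖ L]
variable {Ξ : PseudoQuadraticSpace K L}

theorem IsProper.exists_trace_eq_one (hΞ : Ξ.IsProper) (hc : Ξ.IsCentral) :
    ∃ x : K, x + star x = 1 := by
  obtain ⟨x, hx⟩ := hΞ.exists_trace_ne_zero
  refine ⟨x * (x + star x)⁻¹, ?_⟩
  have h := inv_mem_K₀ (Ξ.trace_mem x)
  rw [star_mul, Ξ.star_eq _ h, hc _ h, ← add_mul, mul_inv_cancel₀ hx]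

/-- In the quadratic case, `K₀` consists of the central elements that are fixed by `σ`. -/
theorem IsProper.mem_K₀_iff (hΞ : Ξ.IsProper) (hc : Ξ.IsCentral) {x : K} :
    x ∈ Ξ.K₀ ↔ star x = x ∧ ∀ y, x * y = y * x := by
  constructor
  · intro h; exact ⟨Ξ.star_eq x h, hc x h⟩
  · rintro ⟨h₁, h₂⟩
    obtain ⟨y, hy⟩ := hΞ.exists_trace_eq_one hc
    have := Ξ.trace_mem (x * y)
    rwa [star_mul, h₁, ← h₂, ← mul_add, hy, mul_one] at this

theorem IsProper.mul_mem_K₀ (hΞ : Ξ.IsProper) (hc : Ξ.IsCentral) {x y : K}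
    (hx : x ∈ Ξ.K₀) (hy : y ∈ Ξ.K₀) : x * y ∈ Ξ.K₀ := by
  rw [hΞ.mem_K₀_iff hc] at *
  refine ⟨by rw [star_mul, hx.1, hy.1, hx.2], fun z => ?_⟩
  rw [mul_assoc, hy.2, ← mul_assoc, hx.2, mul_assoc]

theorem IsProper.mem_gen_iff (hΞ : Ξ.IsProper) (hc : Ξ.IsCentral) {x : K} :
    x ∈ Ξ.gen ↔ x ∈ Ξ.K₀ := by
  refine ⟨fun hx => ?_, mem_gen⟩
  induction hx using Subring.closure_induction with
  | mem x hx => exact hx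
  | zero => exact zero_mem _
  | one => exact Ξ.one_mem
  | add x y _ _ hx hy => exact add_mem hx hy
  | neg x _ hx => exact neg_mem hx
  | mul x y _ _ hx hy => exact hΞ.mul_mem_K₀ hc hx hy

theorem IsCentral.star_mul_self (hc : Ξ.IsCentral) (x : K) : star x * x = x * star x := by
  have h := hc _ (Ξ.trace_mem x) x
  rw [add_mul, mul_add] at h
  exact add_left_cancel h

/-- The trace `x + x^σ`. -/
def tr (Ξ : PseudoQuadraticSpace K L) (x : K) : Ξ.gen := ⟨x + star x, mem_gen (Ξ.trace_mem x)⟩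

/-- The norm `x^σ x`. -/
def nm (Ξ : PseudoQuadraticSpace K L) (x : K) : Ξ.gen :=
  ⟨star x * x, mem_gen (star_mul_self_mem x)⟩

@[simp] theorem coe_tr (x : K) : (Ξ.tr x : K) = x + star x := rfl

@[simp] theorem coe_nm (x : K) : (Ξ.nm x : K) = star x * x := rfl

theorem star_eq_tr_sub (x : K) : star x = Ξ.tr x - x := by simp

theorem IsProper.coe_comm (hΞ : Ξ.IsProper) (hc : Ξ.IsCentral) (r : Ξ.gen) (x : K) :
    (r : K) * x = x * r := hc _ ((hΞ.mem_gen_iff hc).1 r.2) x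

theorem IsProper.star_coe (hΞ : Ξ.IsProper) (hc : Ξ.IsCentral) (r : Ξ.gen) :
    star (r : K) = r := Ξ.star_eq _ ((hΞ.mem_gen_iff hc).1 r.2)

theorem sq_eq_tr_nm (x : K) : x * x = Ξ.tr x * x - Ξ.nm x := by
  simp [add_mul]

/-- `1, t` are linearly independent over `K₀` if `t ∉ K₀`. -/
theorem IsProper.coe_add_coe_mul_eq_zero (hΞ : Ξ.IsProper) (hc : Ξ.IsCentral) {t : K}
    (ht : t ∉ Ξ.K₀) {r s : Ξ.gen} (h : (r : K) + s * t = 0) : r = 0 ∧ s = 0 := by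
  have hs : s = 0 := by
    by_contra hs
    have hs' : (s : K) ≠ 0 := fun h => hs (Subtype.ext h)
    apply ht
    rw [← hΞ.mem_gen_iff hc]
    have : t = (s : K)⁻¹ * (-r) := by
      rw [neg_eq_of_add_eq_zero_right h, inv_mul_cancel_left₀ hs']
    rw [this]
    exact mul_mem (inv_mem_gen s.2) (neg_mem r.2)
  subst hs
  refine ⟨Subtype.ext ?_, rfl⟩
  simpa using h

theorem IsProper.mem_E_iff (hΞ : Ξ.IsProper) (hc : Ξ.IsCentral) (p : Ξ.T) {x : K} :
    x ∈ Ξ.E p.vec ↔ ∃ r s : Ξ.gen, x = r + s * p.scal := by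
  constructor
  · intro hx
    induction hx using Subring.closure_induction with
    | mem x hx =>
      rcases hx with rfl | hx
      · exact ⟨⟨_, mem_gen p.mem⟩, 1, by simp⟩
      · exact ⟨⟨x, mem_gen hx⟩, 0, by simp⟩
    | zero => exact ⟨0, 0, by simp⟩
    | one => exact ⟨1, 0, by simp⟩
    | add x y _ _ hx hy =>
      obtain ⟨r, s, rfl⟩ := hx
      obtain ⟨r', s', rfl⟩ := hy
      exact ⟨r + r', s + s', by push_cast; rw [add_mul]; abel⟩
    | neg x _ hx =>
      obtain ⟨r, s, rfl⟩ := hx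
      exact ⟨-r, -s, by push_cast; rw [neg_mul]; abel⟩
    | mul x y _ _ hx hy =>
      obtain ⟨r, s, rfl⟩ := hx
      obtain ⟨r', s', rfl⟩ := hy
      refine ⟨r * r' - s * s' * Ξ.nm p.scal, r * s' + s * r' + s * s' * Ξ.tr p.scal, ?_⟩
      have h := sq_eq_tr_nm (Ξ := Ξ) p.scal
      have e₁ : (s : K) * p.scal * (s' * p.scal) = s * s' * (p.scal * p.scal) := by
        rw [mul_assoc, ← mul_assoc p.scal, ← hΞ.coe_comm hc s' p.scal]; simp only [mul_assoc]
      have e₂ : (s : K) * p.scal * r' = s * r' * p.scal := by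
        rw [mul_assoc, ← hΞ.coe_comm hc r', ← mul_assoc]
      rw [add_mul, mul_add, mul_add, e₁, e₂, h]
      push_cast
      simp only [mul_sub, add_mul, mul_assoc]
      abel
  · rintro ⟨r, s, rfl⟩
    have hK : ∀ u ∈ Ξ.K₀, u ∈ Ξ.E p.vec := fun u hu =>
      Subring.subset_closure (Set.mem_insert_of_mem _ hu)
    have hq : p.scal ∈ Ξ.E p.vec := by
      have : p.scal = Ξ.q p.vec - (Ξ.q p.vec - p.scal) := by abel
      rw [this]
      exact sub_mem (Subring.subset_closure (Set.mem_insert _ _)) (hK _ p.mem)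
    have hg : ∀ r : Ξ.gen, (r : K) ∈ Ξ.E p.vec := fun r => hK _ ((hΞ.mem_gen_iff hc).1 r.2)
    exact add_mem (hg r) (mul_mem (hg s) hq)

end Central

end PseudoQuadraticSpace

namespace PseudoQuadraticSpace

variable {K L K' L' : Type*} [DivisionRing K] [StarRing K] [AddCommGroup L] [Module Kᵐᵒᵖ L]
  [DivisionRing K'] [StarRing K'] [AddCommGroup L'] [Module K'ᵐᵒᵖ L']

/-- An isomorphism `γ` of the groups `T`, `T'` of two proper spaces, together with the additive
bijection `φ₁ : L → L'` that it induces and a ring isomorphism `φ` of the subrings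
generated by `K₀` and `K₀'` with respect to which `φ₁` is semilinear. -/
structure GroupIso (Ξ : PseudoQuadraticSpace K L) (Ξ' : PseudoQuadraticSpace K' L') where
  proper : Ξ.IsProper
  proper' : Ξ'.IsProper
  γ : Ξ.T ≃* Ξ'.T
  φ₁ : L ≃+ L'
  φ : Ξ.gen ≃+* Ξ'.gen
  vec_γ : ∀ p, (γ p).vec = φ₁ p.vec
  scal_γ_mul_cen : ∀ (p : Ξ.T) (u : K) (hu : u ∈ Ξ.K₀),
    (γ (p * T.cen u hu)).scal = (γ p).scal + φ ⟨u, mem_gen hu⟩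
  map_smul : ∀ (a : L) (r : Ξ.gen), φ₁ (a <• (r : K)) = φ₁ a <• (φ r : K')

variable {Ξ : PseudoQuadraticSpace K L} {Ξ' : PseudoQuadraticSpace K' L'}

theorem vec_eq_zero_of_mulEquiv (hΞ : Ξ.IsProper) (hΞ' : Ξ'.IsProper) (γ : Ξ.T ≃* Ξ'.T) (p : Ξ.T)
    (h : p.vec = 0) : (γ p).vec = 0 := by
  rw [hΞ.vec_eq_zero_iff] at h
  rw [hΞ'.vec_eq_zero_iff]
  intro r
  obtain ⟨r, rfl⟩ := γ.surjective r
  rw [← map_mul, h, map_mul]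

theorem vec_eq_of_mulEquiv (hΞ : Ξ.IsProper) (hΞ' : Ξ'.IsProper) (γ : Ξ.T ≃* Ξ'.T) (p r : Ξ.T)
    (h : p.vec = r.vec) : (γ p).vec = (γ r).vec := by
  obtain ⟨u, hu, rfl⟩ := T.exists_cen_of_vec_eq h
  rw [map_mul, T.vec_mul, vec_eq_zero_of_mulEquiv hΞ hΞ' γ (T.cen u hu) rfl, add_zero]

theorem exists_vecMap (hΞ : Ξ.IsProper) (hΞ' : Ξ'.IsProper) (γ : Ξ.T ≃* Ξ'.T) :
    ∃ φ₁ : L ≃+ L', ∀ p, (γ p).vec = φ₁ p.vec := by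
  refine ⟨⟨⟨fun a => (γ (T.lift a)).vec, fun a => (γ.symm (T.lift a)).vec, fun a => ?_,
    fun a => ?_⟩, fun a b => ?_⟩, fun p => vec_eq_of_mulEquiv hΞ hΞ' γ p (T.lift p.vec) rfl⟩
  · have := vec_eq_of_mulEquiv hΞ' hΞ γ.symm (T.lift (γ (T.lift a)).vec) (γ (T.lift a)) rfl
    rw [γ.symm_apply_apply] at this
    exact this
  · have := vec_eq_of_mulEquiv hΞ hΞ' γ (T.lift (γ.symm (T.lift a)).vec) (γ.symm (T.lift a)) rfl
    rw [γ.apply_symm_apply] at this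
    exact this
  · have := vec_eq_of_mulEquiv hΞ hΞ' γ (T.lift (a + b)) (T.lift a * T.lift b) rfl
    rw [map_mul] at this
    exact this

theorem GroupIso.exists_of_smul (hΞ : Ξ.IsProper) (hΞ' : Ξ'.IsProper) (γ : Ξ.T ≃* Ξ'.T)
    (h : ∀ (u : K) (hu : u ∈ Ξ.K₀) (p r : Ξ.T), r.vec = p.vec <• u →
      (γ r).vec = (γ p).vec <• (γ (T.cen u hu)).scal) :
    ∃ G : GroupIso Ξ Ξ', G.γ = γ := by
  obtain ⟨φ₁, hφ₁⟩ := exists_vecMap hΞ hΞ' γ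
  obtain ⟨a₀, ha₀⟩ := hΞ.2.1
  have ha₀' : φ₁ a₀ ≠ 0 := by simpa using ha₀
  have hcen : ∀ u hu, (γ (T.cen u hu)).vec = 0 := fun u hu =>
    vec_eq_zero_of_mulEquiv hΞ hΞ' γ _ rfl
  have hbase : ∀ u (hu : u ∈ Ξ.K₀) a, φ₁ (a <• u) = φ₁ a <• (γ (T.cen u hu)).scal := by
    intro u hu a
    have := h u hu (T.lift a) (T.lift (a <• u)) rfl
    rwa [hφ₁, hφ₁] at this
  have hex : ∀ r : Ξ.gen, ∃ r' : Ξ'.gen, ∀ a, φ₁ (a <• (r : K)) = φ₁ a <• (r' : K') := by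
    rintro ⟨r, hr⟩
    induction hr using Subring.closure_induction with
    | mem u hu =>
      exact ⟨⟨_, mem_gen ((T.vec_eq_zero_iff _).1 (hcen u hu))⟩, hbase u hu⟩
    | zero => exact ⟨0, fun a => by simp⟩
    | one => exact ⟨1, fun a => by simp⟩
    | add x y _ _ hx hy =>
      obtain ⟨x', hx⟩ := hx
      obtain ⟨y', hy⟩ := hy
      refine ⟨x' + y', fun a => ?_⟩
      have h₁ := hx a
      have h₂ := hy a
      push_cast
      rw [rs_add, map_add, rs_add, h₁, h₂]
    | neg x _ hx =>
      obtain ⟨x', hx⟩ := hx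
      refine ⟨-x', fun a => ?_⟩
      have h₁ := hx a
      push_cast
      rw [rs_neg, map_neg, rs_neg, h₁]
    | mul x y _ _ hx hy =>
      obtain ⟨x', hx⟩ := hx
      obtain ⟨y', hy⟩ := hy
      refine ⟨x' * y', fun a => ?_⟩
      have h₁ := hx a
      have h₂ := hy (a <• x)
      push_cast
      rw [rs_mul, rs_mul, h₂, h₁]
  choose φ hφ using hex
  have huniq : ∀ (r : Ξ.gen) (r' : Ξ'.gen), φ₁ (a₀ <• (r : K)) = φ₁ a₀ <• (r' : K') →
      φ r = r' := by
    intro r r' h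
    rw [hφ] at h
    exact Subtype.ext (rs_left_cancel ha₀' h)
  have hφcen : ∀ u (hu : u ∈ Ξ.K₀), (γ (T.cen u hu)).scal = φ ⟨u, mem_gen hu⟩ := by
    intro u hu
    have := hbase u hu a₀
    have h₂ := hφ ⟨u, mem_gen hu⟩ a₀
    exact rs_left_cancel ha₀' (this.symm.trans h₂)
  let φh : Ξ.gen →+* Ξ'.gen :=
    { toFun := φ
      map_one' := huniq _ _ (by simp)
      map_zero' := huniq _ _ (by simp)
      map_add' := fun x y => huniq _ _ (by
        push_cast; rw [rs_add, map_add, rs_add, hφ, hφ])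
      map_mul' := fun x y => huniq _ _ (by
        push_cast; rw [rs_mul, rs_mul, hφ, hφ]) }
  have hinj : Function.Injective φh := by
    rw [injective_iff_map_eq_zero]
    intro r hr
    have := hφ r a₀
    have hr' : φ r = 0 := hr
    rw [hr', ZeroMemClass.coe_zero, rs_zero, map_eq_zero_iff _ φ₁.injective, rs_eq_zero] at this
    exact Subtype.ext (this.resolve_left ha₀)
  have hsurj : Function.Surjective φh := by
    rintro ⟨r', hr'⟩
    induction hr' using Subring.closure_induction with
    | mem u hu =>
      set p := γ.symm (T.cen u hu) with hp
      have hv : p.vec = 0 := vec_eq_zero_of_mulEquiv hΞ' hΞ γ.symm _ rfl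
      have hm := (T.vec_eq_zero_iff _).1 hv
      refine ⟨⟨p.scal, mem_gen hm⟩, Subtype.ext ?_⟩
      have e : T.cen p.scal hm = p := T.ext' hv.symm rfl
      have := hφcen p.scal hm
      have e' : γ (T.cen p.scal hm) = T.cen u hu := by rw [e, hp, γ.apply_symm_apply]
      rw [e'] at this
      exact this.symm
    | zero => exact ⟨0, map_zero _⟩
    | one => exact ⟨1, map_one _⟩
    | add x y _ _ hx hy =>
      obtain ⟨x', hx⟩ := hx
      obtain ⟨y', hy⟩ := hy
      exact ⟨x' + y', by rw [map_add, hx, hy]; rfl⟩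
    | neg x _ hx =>
      obtain ⟨x', hx⟩ := hx
      exact ⟨-x', by rw [map_neg, hx]; rfl⟩
    | mul x y _ _ hx hy =>
      obtain ⟨x', hx⟩ := hx
      obtain ⟨y', hy⟩ := hy
      exact ⟨x' * y', by rw [map_mul, hx, hy]; rfl⟩
  refine ⟨⟨hΞ, hΞ', γ, φ₁, RingEquiv.ofBijective φh ⟨hinj, hsurj⟩, hφ₁, fun p u hu => ?_,
    fun a r => hφ r a⟩, rfl⟩
  rw [map_mul, T.scal_mul, hcen, f_zero_left, add_zero, hφcen]
  rfl

namespace GroupIso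

variable (G : GroupIso Ξ Ξ')

theorem scal_γ_cen (u : K) (hu : u ∈ Ξ.K₀) :
    (G.γ (T.cen u hu)).scal = G.φ ⟨u, mem_gen hu⟩ := by
  have := G.scal_γ_mul_cen 1 u hu
  rwa [one_mul, map_one, T.scal_one, zero_add] at this

theorem scal_γ_of_vec_eq_zero (p : Ξ.T) (hp : p.vec = 0) :
    (G.γ p).scal = G.φ ⟨p.scal, mem_gen (p.vec_eq_zero_iff.1 hp)⟩ := by
  rw [← G.scal_γ_cen _ (p.vec_eq_zero_iff.1 hp)]
  congr 2
  exact T.ext' hp rfl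

/-- The element of `T'` that corresponds to an element of `T` with the same vector. -/
theorem scal_γ_sub {p r : Ξ.T} (h : p.vec = r.vec) {u : Ξ.gen} (hu : r.scal = p.scal + u) :
    (G.γ r).scal = (G.γ p).scal + G.φ u := by
  have hu' : (u : K) ∈ Ξ.K₀ := by
    have := sub_mem p.mem r.mem
    rw [h, hu] at this
    convert this using 1; abel
  have : r = p * T.cen (u : K) hu' := T.ext' (by rw [T.vec_mul_cen, h]) (by rw [T.scal_mul_cen, hu])
  rw [this, G.scal_γ_mul_cen]

theorem scal_γ_mul (p r : Ξ.T) : (G.γ (p * r)).scal =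
    (G.γ p).scal + (G.γ r).scal + Ξ'.f (G.φ₁ r.vec) (G.φ₁ p.vec) := by
  rw [map_mul, T.scal_mul, G.vec_γ, G.vec_γ]

theorem γ_mem (p : Ξ.T) : Ξ'.q (G.φ₁ p.vec) - (G.γ p).scal ∈ Ξ'.K₀ := by
  rw [← G.vec_γ]; exact T.mem _

theorem φ₁_ne_zero {a : L} (h : a ≠ 0) : G.φ₁ a ≠ 0 := by simpa using h

theorem φ_mem_iff (r : Ξ.gen) : (G.φ r : K') ∈ Ξ'.K₀ ↔ (r : K) ∈ Ξ.K₀ := by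
  constructor
  · intro h
    set p := G.γ.symm (T.cen _ h) with hp
    have hv : p.vec = 0 := vec_eq_zero_of_mulEquiv G.proper' G.proper G.γ.symm _ rfl
    have h₂ := G.scal_γ_of_vec_eq_zero p hv
    have h₁ : (G.γ p).scal = G.φ r := by rw [hp, MulEquiv.apply_symm_apply]; rfl
    rw [h₁] at h₂
    have h₃ := G.φ.injective (Subtype.ext h₂)
    rw [h₃]
    exact (p.vec_eq_zero_iff.1 hv)
  · intro h
    have := G.scal_γ_cen _ h
    rw [← this, ← T.vec_eq_zero_iff]
    exact vec_eq_zero_of_mulEquiv G.proper G.proper' G.γ _ rfl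

/-- The trace of the form `f` is the commutator map of `T` and hence preserved. -/
theorem map_tr_f (a b : L) :
    (G.φ (Ξ.tr (Ξ.f a b)) : K') = Ξ'.f (G.φ₁ a) (G.φ₁ b) + star (Ξ'.f (G.φ₁ a) (G.φ₁ b)) := by
  have h₁ := G.scal_γ_mul (T.lift b) (T.lift a)
  have h₂ := G.scal_γ_mul (T.lift a) (T.lift b)
  have h₃ := G.scal_γ_sub (p := T.lift a * T.lift b) (r := T.lift b * T.lift a)
    (u := Ξ.tr (Ξ.f a b)) (by rw [T.vec_mul, T.vec_mul, add_comm]) (by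
      rw [T.scal_mul, T.scal_mul, coe_tr, star_f, T.vec_lift, T.vec_lift]; abel)
  rw [h₁, h₂] at h₃
  rw [star_f]
  simp only [T.vec_lift] at h₃
  have h₄ := sub_eq_of_eq_add' h₃
  rw [← h₄]; abel

/-- The inverse isomorphism. -/
def symm : GroupIso Ξ' Ξ where
  proper := G.proper'
  proper' := G.proper
  γ := G.γ.symm
  φ₁ := G.φ₁.symm
  φ := G.φ.symm
  vec_γ p := by
    obtain ⟨p, rfl⟩ := G.γ.surjective p
    rw [G.vec_γ, MulEquiv.symm_apply_apply, AddEquiv.symm_apply_apply]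
  scal_γ_mul_cen p u hu := by
    obtain ⟨p, rfl⟩ := G.γ.surjective p
    obtain ⟨⟨v, hv⟩, hvu⟩ := G.φ.surjective ⟨u, mem_gen hu⟩
    have hv' : v ∈ Ξ.K₀ := (G.φ_mem_iff ⟨v, hv⟩).1 (by rw [hvu]; exact hu)
    have : T.cen u hu = G.γ (T.cen v hv') := T.ext'
      (by rw [G.vec_γ, T.vec_cen, T.vec_cen, map_zero])
      (by rw [T.scal_cen, G.scal_γ_cen, hvu])
    rw [this, ← map_mul, MulEquiv.symm_apply_apply, MulEquiv.symm_apply_apply, T.scal_mul_cen,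
      ← hvu, RingEquiv.symm_apply_apply]
  map_smul a r := by
    rw [AddEquiv.symm_apply_eq, G.map_smul, AddEquiv.apply_symm_apply, RingEquiv.apply_symm_apply]

theorem symm_φ₁_φ₁ (a : L) : G.symm.φ₁ (G.φ₁ a) = a := G.φ₁.symm_apply_apply a

theorem symm_γ_γ (p : Ξ.T) : G.symm.γ (G.γ p) = p := G.γ.symm_apply_apply p

theorem γ_symm_γ (p : Ξ'.T) : G.γ (G.symm.γ p) = p := G.γ.apply_symm_apply p

theorem symm_φ_φ (r : Ξ.gen) : G.symm.φ (G.φ r) = r := G.φ.symm_apply_apply r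

theorem φ_symm_φ (r : Ξ'.gen) : G.φ (G.symm.φ r) = r := G.φ.apply_symm_apply r

end GroupIso

/-- The group isomorphism underlying a Jordan isomorphism. -/
noncomputable def IsJordanIso.toMulEquiv {γ : Ξ.T → Ξ'.T} (h : IsJordanIso γ) : Ξ.T ≃* Ξ'.T :=
  { Equiv.ofBijective γ h.1 with map_mul' := h.2.1 }

theorem IsJordanIso.coe_toMulEquiv {γ : Ξ.T → Ξ'.T} (h : IsJordanIso γ) : ⇑h.toMulEquiv = γ := rfl

theorem IsJordanIso.of_inverse {γ : Ξ.T → Ξ'.T} {δ : Ξ'.T → Ξ.T} (h₁ : Function.LeftInverse δ γ)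
    (h₂ : Function.RightInverse δ γ) (h : IsJordanIso δ) : IsJordanIso γ := by
  refine ⟨⟨h₁.injective, h₂.surjective⟩, fun p r => ?_, ?_, fun p r => ?_⟩
  · apply h.1.1; rw [h₁, h.2.1, h₁, h₁]
  · apply h.1.1; rw [h₁, h.2.2.1]
  · apply h.1.1; rw [h₁, h.2.2.2, h₁, h₁]

theorem IsJordanIso.exists_groupIso (hΞ : Ξ.IsProper) (hΞ' : Ξ'.IsProper) {γ : Ξ.T → Ξ'.T}
    (h : IsJordanIso γ) : ∃ G : GroupIso Ξ Ξ', ⇑G.γ = γ := by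
  obtain ⟨G, hG⟩ := GroupIso.exists_of_smul hΞ hΞ' h.toMulEquiv (by
    intro u hu p r hr
    rw [h.coe_toMulEquiv]
    have hcv : (γ (T.cen u hu)).vec = 0 :=
      vec_eq_zero_of_mulEquiv hΞ hΞ' h.toMulEquiv _ rfl
    have hcs := (T.vec_eq_zero_iff _).1 hcv
    have h₁ := congrArg T.vec (h.2.2.2 (T.cen u hu) p)
    rw [T.vec_hua, hcv, zero_rs, sub_zero, Ξ'.star_eq _ hcs] at h₁
    rw [← h₁]
    obtain ⟨φ₁, hφ₁⟩ := exists_vecMap hΞ hΞ' h.toMulEquiv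
    rw [← h.coe_toMulEquiv, hφ₁, hφ₁, hr, T.vec_hua, T.vec_cen, zero_rs, sub_zero, T.scal_cen,
      Ξ.star_eq _ hu])
  exact ⟨G, by rw [hG]; rfl⟩

/-- `γ` is induced by an isomorphism of pseudo-quadratic spaces if `φ₁` is semilinear with
respect to an isomorphism of skew-fields that describes `γ` on second components. -/
theorem GroupIso.caseI (G : GroupIso Ξ Ξ') (ψ : K ≃+* K')
    (h₁ : ∀ a x, G.φ₁ (a <• x) = G.φ₁ a <• ψ x) (h₂ : ∀ p, (G.γ p).scal = ψ p.scal)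
    (h₃ : ∀ x, ψ (star x) = star (ψ x)) : CaseI G.γ := by
  have hmem : ∀ x, ψ x ∈ Ξ'.K₀ ↔ x ∈ Ξ.K₀ := by
    intro x
    constructor
    · intro hx
      have := G.symm.vec_γ (T.cen _ hx)
      rw [T.vec_cen, map_zero, T.vec_eq_zero_iff] at this
      convert this
      apply ψ.injective
      rw [← h₂, G.γ_symm_γ, T.scal_cen]
    · intro hx
      have := G.vec_γ (T.cen _ hx)
      rwa [T.vec_cen, map_zero, T.vec_eq_zero_iff, h₂] at this
  refine ⟨⟨ψ, G.φ₁, h₁, h₃, hmem, fun a => ?_⟩, fun p => ⟨G.vec_γ p, h₂ p⟩⟩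
  have := G.γ_mem (T.lift a)
  rw [h₂] at this
  have h := neg_mem this
  rwa [neg_sub] at h

/-- An isomorphism of proper pseudo-quadratic spaces is compatible with the forms `f`. -/
theorem map_f (hΞ' : Ξ'.IsProper) (Φ : PseudoQuadraticIso Ξ.K₀ Ξ.q Ξ'.K₀ Ξ'.q) (a b : L) :
    Φ.φ (Ξ.f a b) = Ξ'.f (Φ.φ₁ a) (Φ.φ₁ b) := by
  symm
  refine hΞ'.f_eq fun t => ?_
  obtain ⟨t, rfl⟩ := Φ.φ.surjective t
  have h := (Φ.map_mem _).2 (Ξ.q_add a (b <• t))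
  have h₁ := Φ.map_q (a + b <• t)
  have h₂ := Φ.map_q a
  have h₃ := Φ.map_q (b <• t)
  rw [map_add, Φ.map_smul] at h₁
  rw [Φ.map_smul] at h₃
  rw [Ξ.f_smul_right] at h
  simp only [map_sub, map_add, map_mul] at h
  convert add_mem (add_mem (sub_mem h h₁) h₂) h₃ using 1
  abel

theorem isJordanIso_of_inducedBy (hΞ' : Ξ'.IsProper) {γ : Ξ.T → Ξ'.T}
    (Φ : PseudoQuadraticIso Ξ.K₀ Ξ.q Ξ'.K₀ Ξ'.q) (h : InducedBy Φ γ) : IsJordanIso γ := by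
  refine ⟨⟨fun p r hpr => ?_, fun p => ?_⟩, fun p r => ?_, ?_, fun p r => ?_⟩
  · refine T.ext' (Φ.φ₁.injective ?_) (Φ.φ.injective ?_)
    · rw [← (h p).1, hpr, (h r).1]
    · rw [← (h p).2, hpr, (h r).2]
  · refine ⟨T.mk (Φ.φ₁.symm p.vec) (Φ.φ.symm p.scal) ?_, T.ext' ?_ ?_⟩
    · rw [← Φ.map_mem, map_sub, RingEquiv.apply_symm_apply]
      have := Φ.map_q (Φ.φ₁.symm p.vec)
      rw [AddEquiv.apply_symm_apply] at this
      simpa using add_mem this p.mem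
    · rw [(h _).1, T.vec_mk, AddEquiv.apply_symm_apply]
    · rw [(h _).2, T.scal_mk, RingEquiv.apply_symm_apply]
  · refine T.ext' ?_ ?_
    · rw [(h _).1, T.vec_mul, T.vec_mul, map_add, (h p).1, (h r).1]
    · rw [(h _).2, T.scal_mul, T.scal_mul, map_add, map_add, (h p).1, (h r).1, (h p).2, (h r).2,
        map_f hΞ']
  · exact T.ext' (by rw [(h _).1, T.vec_unit, T.vec_unit, map_zero])
      (by rw [(h _).2, T.scal_unit, T.scal_unit, map_one])
  · refine T.ext' ?_ ?_
    · rw [(h _).1, T.vec_hua, T.vec_hua, map_sub, Φ.map_smul, Φ.map_smul, (h p).1, (h r).1,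
        (h p).2, map_mul, map_mul, map_inv₀, Φ.map_star, map_f hΞ']
    · rw [(h _).2, T.scal_hua, T.scal_hua, map_mul, map_mul, Φ.map_star, (h p).2, (h r).2]

/-- If `K₀` generates `K`, then `K` is not commutative. -/
theorem IsProper.exists_not_comm (hΞ : Ξ.IsProper) (h : Ξ.gen = ⊤) :
    ∃ u ∈ Ξ.K₀, ∃ x, u * x ≠ x * u := by
  by_contra! hc
  obtain ⟨x, hx⟩ := hΞ.1
  have := (hΞ.mem_gen_iff hc (x := x)).1 (h ▸ Subring.mem_top x)
  exact hx (Ξ.star_eq _ this)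

theorem GroupIso.isCentral (G : GroupIso Ξ Ξ') (hc : Ξ'.IsCentral) : Ξ.IsCentral := by
  refine Ξ.gen_eq_top_or_isCentral.resolve_left fun htop => ?_
  obtain ⟨u, hu, x, hx⟩ := G.proper.exists_not_comm htop
  have hx' : x ∈ Ξ.gen := htop ▸ Subring.mem_top x
  have : (⟨u, mem_gen hu⟩ : Ξ.gen) * ⟨x, hx'⟩ = ⟨x, hx'⟩ * ⟨u, mem_gen hu⟩ := by
    apply G.φ.injective
    rw [map_mul, map_mul]
    exact Subtype.ext (G.proper'.coe_comm hc _ _)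
  exact hx (congrArg Subtype.val this)

theorem GroupIso.isCentral_iff (G : GroupIso Ξ Ξ') : Ξ.IsCentral ↔ Ξ'.IsCentral :=
  ⟨G.symm.isCentral, G.isCentral⟩

/-- If `K₀` is not central, every Jordan isomorphism is induced by an isomorphism of
pseudo-quadratic spaces. -/
theorem IsJordanIso.caseI_of_not_isCentral (hΞ : Ξ.IsProper) (hΞ' : Ξ'.IsProper) {γ : Ξ.T → Ξ'.T}
    (h : IsJordanIso γ) (hc : ¬ Ξ.IsCentral) : CaseI γ := by
  obtain ⟨G, rfl⟩ := h.exists_groupIso hΞ hΞ'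
  have htop := Ξ.gen_eq_top_or_isCentral.resolve_right hc
  have htop' := Ξ'.gen_eq_top_or_isCentral.resolve_right (fun h' => hc (G.isCentral_iff.2 h'))
  have ht : ∀ x, x ∈ Ξ.gen := fun x => htop ▸ Subring.mem_top x
  have ht' : ∀ x, x ∈ Ξ'.gen := fun x => htop' ▸ Subring.mem_top x
  let ι : Ξ.gen ≃+* K := RingEquiv.ofBijective Ξ.gen.subtype
    ⟨Subtype.val_injective, fun x => ⟨⟨x, ht x⟩, rfl⟩⟩
  let ι' : Ξ'.gen ≃+* K' := RingEquiv.ofBijective Ξ'.gen.subtype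
    ⟨Subtype.val_injective, fun x => ⟨⟨x, ht' x⟩, rfl⟩⟩
  let ψ : K ≃+* K' := ι.symm.trans (G.φ.trans ι')
  have hψ : ∀ r : Ξ.gen, ψ r = G.φ r := by
    intro r
    have : ι.symm (r : K) = r := (RingEquiv.symm_apply_eq ι).2 rfl
    change ι' (G.φ (ι.symm (r : K))) = _
    rw [this]; rfl
  have hK₀ : ∀ u ∈ Ξ.K₀, ψ u ∈ Ξ'.K₀ := fun u hu => by
    have := hψ ⟨u, mem_gen hu⟩
    change ψ u = _ at this
    rw [this]; exact (G.φ_mem_iff _).2 hu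
  have hK₀' : ∀ u ∈ Ξ'.K₀, ∃ v ∈ Ξ.K₀, ψ v = u := fun u hu => by
    obtain ⟨v, hv⟩ := G.φ.surjective ⟨u, mem_gen hu⟩
    refine ⟨v, (G.φ_mem_iff _).1 (by rw [hv]; exact hu), by rw [hψ, hv]⟩
  have hstar : ∀ x, ψ (star x) = star (ψ x) := by
    intro x
    have hx := ht x
    induction hx using Subring.closure_induction with
    | mem u hu => rw [Ξ.star_eq u hu, Ξ'.star_eq _ (hK₀ u hu)]
    | zero => simp
    | one => simp
    | add x y _ _ hx hy => rw [star_add, map_add, map_add, star_add, hx, hy]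
    | neg x _ hx => rw [star_neg, map_neg, map_neg, star_neg, hx]
    | mul x y _ _ hx hy => rw [star_mul, map_mul, map_mul, star_mul, hx, hy]
  refine G.caseI ψ (fun a x => ?_) (fun p => ?_) hstar
  · have := G.map_smul a ⟨x, ht x⟩
    rw [← hψ] at this
    exact this
  by_cases hp : p.vec = 0
  · rw [G.scal_γ_of_vec_eq_zero p hp, ← hψ]
  -- `(γ p).scal = z ψ(p.scal)` for a central element `z`
  have hcen : ∀ r : Ξ.T, r.vec ≠ 0 → ∃ z : K', (∀ x, z * x = x * z) ∧
      ψ r.scal = (G.γ r).scal * z := by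
    intro r hr
    have hr' : (G.γ r).scal ≠ 0 := T.scal_ne_zero (by rw [G.vec_γ]; exact G.φ₁_ne_zero hr)
    have hv : ∀ v ∈ Ξ.K₀, ψ (r.scal * v * star r.scal) =
        (G.γ r).scal * ψ v * star (G.γ r).scal := by
      intro v hv
      have h₁ := congrArg T.scal (h.2.2.2 r (T.cen v hv))
      rw [T.scal_hua, G.scal_γ_cen, ← hψ] at h₁
      rw [← h₁, G.scal_γ_of_vec_eq_zero, ← hψ]
      · rfl
      · rw [T.vec_hua, T.vec_cen, f_zero_right, zero_rs, mul_zero, zero_mul, rs_zero, sub_zero]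
    set t := (G.γ r).scal with ht_def
    have hst : star t ≠ 0 := star_ne_zero.2 hr'
    set z := t⁻¹ * ψ r.scal with hz
    have hz0 : z ≠ 0 := mul_ne_zero (inv_ne_zero hr') (by simpa using T.scal_ne_zero hr)
    have hzt : ψ r.scal = t * z := by rw [hz, mul_inv_cancel_left₀ hr']
    have hzv : ∀ v ∈ Ξ'.K₀, z * v * star z = v := by
      intro v hv'
      obtain ⟨w, hw, rfl⟩ := hK₀' v hv'
      have h₂ := hv w hw
      rw [map_mul, map_mul, hstar, hzt, star_mul] at h₂
      apply mul_left_cancel₀ hr'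
      apply mul_right_cancel₀ hst
      rw [← h₂]; simp only [mul_assoc]
    have hz1 : star z = z⁻¹ := by
      have := hzv 1 Ξ'.one_mem
      rw [mul_one] at this
      exact eq_inv_of_mul_eq_one_right this
    refine ⟨z, fun x => ?_, hzt⟩
    have hx := ht' x
    induction hx using Subring.closure_induction with
    | mem v hv' =>
      have := hzv v hv'
      rw [hz1, mul_inv_eq_iff_eq_mul₀ hz0] at this
      exact this
    | zero => simp
    | one => simp
    | add x y _ _ hx hy => rw [mul_add, add_mul, hx, hy]
    | neg x _ hx => rw [mul_neg, neg_mul, hx]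
    | mul x y _ _ hx hy => rw [← mul_assoc, hx, mul_assoc, hy, mul_assoc]
  have hinv : ∀ {z : K'}, (∀ x, z * x = x * z) → ∀ x, z⁻¹ * x = x * z⁻¹ := fun {z} hz x => by
    rcases eq_or_ne z 0 with rfl | h0
    · simp
    rw [inv_mul_eq_iff_eq_mul₀ h0, ← mul_assoc, hz, mul_assoc, mul_inv_cancel₀ h0, mul_one]
  obtain ⟨z, hz, hzt⟩ := hcen p hp
  -- comparing `p` with `p · (0, u)`
  have hshift : ∀ u ∈ Ξ.K₀, z = 1 ∨ ∃ w, (∀ x, w * x = x * w) ∧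
      (G.γ p).scal * w = ψ u := by
    intro u hu
    obtain ⟨z₂, hz₂, hzt₂⟩ := hcen (p * T.cen u hu) (by rwa [T.vec_mul_cen])
    rw [T.scal_mul_cen, G.scal_γ_mul_cen, ← hψ, map_add, hzt, add_mul] at hzt₂
    change _ + ψ u = _ + ψ u * z₂ at hzt₂
    by_cases h1 : z₂ = 1
    · left
      rw [h1, mul_one, mul_one] at hzt₂
      have h₂ := add_right_cancel hzt₂
      have hne : (G.γ p).scal ≠ 0 := T.scal_ne_zero (by rw [G.vec_γ]; exact G.φ₁_ne_zero hp)
      exact mul_left_cancel₀ hne (h₂.trans (mul_one _).symm)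
    · right
      have h1' : z₂ - 1 ≠ 0 := sub_ne_zero.2 h1
      have hc1 : ∀ x, (z₂ - 1) * x = x * (z₂ - 1) := fun x => by
        rw [sub_mul, mul_sub, hz₂, one_mul, mul_one]
      refine ⟨(z - z₂) * (z₂ - 1)⁻¹, fun x => ?_, ?_⟩
      · rw [mul_assoc, hinv hc1, ← mul_assoc, sub_mul, hz, hz₂, ← mul_sub, mul_assoc]
      · rw [← mul_assoc, mul_inv_eq_iff_eq_mul₀ h1', mul_sub, mul_sub, mul_one,
          sub_eq_sub_iff_add_eq_add, hzt₂, add_comm]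
  have hz1 : z = 1 := by
    by_contra hz1
    obtain ⟨u, hu, hux⟩ := hΞ.exists_not_comm htop
    obtain ⟨w₁, hw₁, e₁⟩ := (hshift 1 Ξ.one_mem).resolve_left hz1
    obtain ⟨w₂, hw₂, e₂⟩ := (hshift u hu).resolve_left hz1
    rw [map_one] at e₁
    have hw0 : w₁ ≠ 0 := fun h0 => by rw [h0, mul_zero] at e₁; exact zero_ne_one e₁
    have e₃ : ψ u = w₁⁻¹ * w₂ := by
      rw [← e₂, eq_inv_of_mul_eq_one_left e₁]
    obtain ⟨x, hx⟩ := hux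
    apply hx
    apply ψ.injective
    rw [map_mul, map_mul, e₃, mul_assoc, hw₂, ← mul_assoc, hinv hw₁, mul_assoc]
  rw [hzt, hz1, mul_one]

end PseudoQuadraticSpace

namespace PseudoQuadraticSpace

section

variable {K L : Type*} [DivisionRing K] [StarRing K] [AddCommGroup L] [Module Kᵐᵒᵖ L]
variable {Ξ : PseudoQuadraticSpace K L}

/-- The first component of a Hua map. -/
def huaVec (p : Ξ.T) (b : L) : L :=
  b <• star p.scal - p.vec <• (p.scal⁻¹ * Ξ.f p.vec b * star p.scal)

theorem T.vec_hua' (p r : Ξ.T) : (hua p r).vec = huaVec p r.vec := rfl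

/-- In the quadratic case, `K₀` is commutative. -/
abbrev IsProper.genCommRing (hΞ : Ξ.IsProper) (hc : Ξ.IsCentral) : CommRing Ξ.gen :=
  { (inferInstance : Ring Ξ.gen) with
    mul_comm := fun x y => Subtype.ext (hΞ.coe_comm hc x y) }

theorem coe_ne_zero {r : Ξ.gen} (h : r ≠ 0) : (r : K) ≠ 0 := fun h' => h (Subtype.ext h')

theorem tr_star (x : K) : Ξ.tr (star x) = Ξ.tr x := Subtype.ext (by simp [add_comm])

theorem IsCentral.nm_star (hc : Ξ.IsCentral) (x : K) : Ξ.nm (star x) = Ξ.nm x :=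
  Subtype.ext (by simp [hc.star_mul_self x])

theorem T.scal_not_mem {p : Ξ.T} (h : p.vec ≠ 0) : p.scal ∉ Ξ.K₀ := fun h' =>
  h (p.vec_eq_zero_iff.2 h')

theorem IsProper.nm_add_coe (hΞ : Ξ.IsProper) (hc : Ξ.IsCentral) (x : K) (u : Ξ.gen) :
    Ξ.nm (x + u) = Ξ.nm x + u * Ξ.tr x + u * u := Subtype.ext (by
  simp only [coe_nm, coe_tr, star_add, hΞ.star_coe hc, add_mul, mul_add, AddMemClass.coe_add,
    MulMemClass.coe_mul, hΞ.coe_comm hc u]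
  abel)

theorem IsProper.tr_add_coe (hΞ : Ξ.IsProper) (hc : Ξ.IsCentral) (x : K) (u : Ξ.gen) :
    Ξ.tr (x + u) = Ξ.tr x + u + u := Subtype.ext (by
  simp only [coe_tr, star_add, hΞ.star_coe hc, AddMemClass.coe_add]
  abel)

theorem IsProper.nm_ne_zero (x : K) (h : x ≠ 0) : Ξ.nm x ≠ 0 := fun h' => by
  have : star x * x = 0 := congrArg Subtype.val h'
  exact (mul_ne_zero (star_ne_zero.2 h) h) this

theorem IsCentral.star_cube (hc : Ξ.IsCentral) (x : K) : star x * star x * star x =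
    ((Ξ.tr x * Ξ.tr x - Ξ.nm x : Ξ.gen) : K) * star x - (Ξ.tr x * Ξ.nm x : Ξ.gen) := by
  have h₁ := sq_eq_tr_nm (Ξ := Ξ) (star x)
  rw [tr_star, hc.nm_star] at h₁
  rw [h₁, sub_mul, mul_assoc, h₁]
  push_cast
  rw [mul_sub, sub_mul]
  simp only [mul_assoc]
  abel

theorem IsProper.huaVec_self_nm (hΞ : Ξ.IsProper) (hc : Ξ.IsCentral) {r : Ξ.T} (hr : r.vec ≠ 0) :
    huaVec r r.vec <• (Ξ.nm r.scal : K) = r.vec <• (star r.scal * star r.scal * star r.scal) := by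
  have hr0 := T.scal_ne_zero hr
  have hcm := hc.star_mul_self r.scal
  have hcm' : ∀ y, star r.scal * (r.scal * y) = r.scal * (star r.scal * y) := fun y => by
    rw [← mul_assoc, hcm, mul_assoc]
  rw [huaVec, hΞ.f_self, ← rs_sub, ← rs_mul]
  congr 2
  rw [mul_sub, inv_mul_cancel₀ hr0, coe_nm, hcm]
  simp only [sub_mul, one_mul, sub_sub_cancel, mul_assoc, hcm', inv_mul_cancel_left₀ hr0]

end

variable {K L K' L' : Type*} [DivisionRing K] [StarRing K] [AddCommGroup L] [Module Kᵐᵒᵖ L]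
  [DivisionRing K'] [StarRing K'] [AddCommGroup L'] [Module K'ᵐᵒᵖ L']
  {Ξ : PseudoQuadraticSpace K L} {Ξ' : PseudoQuadraticSpace K' L'}

namespace GroupIso

variable (G : GroupIso Ξ Ξ')

theorem map_smul_mul (a : L) (x : K) (r : Ξ.gen) :
    G.φ₁ (a <• (x * r)) = G.φ₁ (a <• x) <• (G.φ r : K') := by
  rw [rs_mul, G.map_smul]

theorem map_smul_mul' (hc : Ξ.IsCentral) (a : L) (x : K) (r : Ξ.gen) :
    G.φ₁ (a <• (r * x)) = G.φ₁ (a <• x) <• (G.φ r : K') := by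
  rw [G.proper.coe_comm hc, G.map_smul_mul]

theorem φ_ne_zero {r : Ξ.gen} (h : r ≠ 0) : (G.φ r : K') ≠ 0 :=
  coe_ne_zero (by simpa using h)

variable {G}

theorem map_nm_of_hua (hc : Ξ.IsCentral) (hc' : Ξ'.IsCentral) (hJ : IsJordanIso G.γ) (p : Ξ.T) :
    G.φ (Ξ.nm p.scal) = Ξ'.nm (G.γ p).scal := by
  have h := congrArg T.scal (hJ.2.2.2 p Ξ.unit)
  rw [G.scal_γ_of_vec_eq_zero, hJ.2.2.1, T.scal_hua (G.γ p), T.scal_unit, mul_one] at h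
  · apply Subtype.ext
    rw [coe_nm, hc'.star_mul_self, ← h]
    congr 2
    refine Subtype.ext ?_
    rw [coe_nm, hc.star_mul_self]
    simp only [T.scal_hua, T.scal_unit, mul_one]
  · rw [T.vec_hua, T.vec_unit, f_zero_right, zero_rs, mul_zero, zero_mul, rs_zero, sub_zero]

theorem map_tr_of_map_nm (hc : Ξ.IsCentral) (hc' : Ξ'.IsCentral)
    (h : ∀ p, G.φ (Ξ.nm p.scal) = Ξ'.nm (G.γ p).scal) (p : Ξ.T) :
    G.φ (Ξ.tr p.scal) = Ξ'.tr (G.γ p).scal := by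
  have h₁ := h (p * T.cen 1 Ξ.one_mem)
  rw [T.scal_mul_cen, G.scal_γ_mul_cen] at h₁
  have e := G.proper.nm_add_coe hc p.scal 1
  have e' := G.proper'.nm_add_coe hc' (G.γ p).scal 1
  have e₁ : (G.φ ⟨1, mem_gen Ξ.one_mem⟩ : K') = (1 : Ξ'.gen) := congrArg Subtype.val (map_one G.φ)
  rw [OneMemClass.coe_one] at e
  rw [e, e₁, e', map_add, map_add, h p, one_mul, one_mul, one_mul, one_mul, map_one] at h₁
  exact add_left_cancel (add_right_cancel h₁)

/-- If `K₀` has more than two elements, then `φ₁(a t) = φ₁(a) t'` for `γ(a, t) = (φ₁(a), t')`. -/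
theorem map_vec_scal_of_hua (hc : Ξ.IsCentral) (hc' : Ξ'.IsCentral) (hJ : IsJordanIso G.γ)
    {l : Ξ.gen} (hl0 : l ≠ 0) (hl1 : l ≠ 1)
    (p : Ξ.T) : G.φ₁ (p.vec <• p.scal) = G.φ₁ p.vec <• (G.γ p).scal := by
  by_cases hp : p.vec = 0
  · rw [hp, zero_rs, map_zero, zero_rs]
  have hnm := map_nm_of_hua hc hc' hJ
  have htr := map_tr_of_map_nm hc hc' hnm
  have step : ∀ r : Ξ.T, r.vec ≠ 0 → Ξ.tr r.scal * Ξ.tr r.scal - Ξ.nm r.scal ≠ 0 →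
      G.φ₁ (r.vec <• r.scal) = G.φ₁ r.vec <• (G.γ r).scal := by
    intro r hr hne
    have hr' : (G.γ r).vec ≠ 0 := by rw [G.vec_γ]; exact G.φ₁_ne_zero hr
    have h₁ : G.φ₁ (huaVec r r.vec) = huaVec (G.γ r) (G.γ r).vec := by
      rw [← T.vec_hua', ← G.vec_γ, hJ.2.2.2, T.vec_hua']
    have h₂ := congrArg G.φ₁ (G.proper.huaVec_self_nm hc hr)
    rw [G.map_smul, h₁, hnm, G.proper'.huaVec_self_nm hc' hr', hc.star_cube, hc'.star_cube, rs_sub,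
      rs_sub, map_sub,
      G.map_smul_mul' hc, G.map_smul, map_mul, htr, hnm, G.vec_γ] at h₂
    have h₃ := (sub_left_inj.1 h₂).symm
    rw [map_sub, map_mul, htr, hnm, G.proper'.coe_comm hc', rs_mul] at h₃
    have h₄ : G.φ₁ (r.vec <• star r.scal) = G.φ₁ r.vec <• star (G.γ r).scal := by
      refine rs_right_cancel ?_ h₃
      have := G.φ_ne_zero hne
      rwa [map_sub, map_mul, htr, hnm] at this
    have e : r.scal = Ξ.tr r.scal - star r.scal := by simp
    have e' : (G.γ r).scal = Ξ'.tr (G.γ r).scal - star (G.γ r).scal := by simp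
    rw [e, rs_sub, map_sub, h₄, G.map_smul, htr, ← rs_sub, ← e']
  let _ := G.proper.genCommRing hc
  by_cases hall : ∀ u : Ξ.gen, Ξ.tr (p.scal + u) * Ξ.tr (p.scal + u) - Ξ.nm (p.scal + u) = 0
  · exfalso
    simp only [G.proper.tr_add_coe hc, G.proper.nm_add_coe hc] at hall
    have h0 := hall 0
    have h1 := hall 1
    have h2 := hall l
    have e0 : Ξ.nm p.scal = Ξ.tr p.scal * Ξ.tr p.scal := by linear_combination -h0
    have hdom : ∀ x y : Ξ.gen, x * y = 0 → x = 0 ∨ y = 0 := fun x y h => by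
      have : (x : K) * y = 0 := by rw [← MulMemClass.coe_mul, h]; rfl
      exact (mul_eq_zero.1 this).imp Subtype.ext Subtype.ext
    by_cases h3 : (3 : Ξ.gen) = 0
    · apply T.scal_not_mem hp
      have hsq := sq_eq_tr_nm (Ξ := Ξ) p.scal
      have h3' : (3 : K) = 0 := congrArg Subtype.val h3
      have : (p.scal + Ξ.tr p.scal) * (p.scal + Ξ.tr p.scal) = 0 := by
        rw [e0] at hsq
        have : (p.scal + Ξ.tr p.scal) * (p.scal + Ξ.tr p.scal) = 3 * (Ξ.tr p.scal * p.scal) := by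
          rw [add_mul, mul_add, mul_add, hsq, ← G.proper.coe_comm hc]
          push_cast
          noncomm_ring
        rw [this, h3', zero_mul]
      have h₂ := eq_neg_of_add_eq_zero_left (mul_self_eq_zero.1 this)
      rw [h₂]
      exact neg_mem ((G.proper.mem_gen_iff hc).1 (Ξ.tr p.scal).2)
    · have f1 : (3 : Ξ.gen) * (Ξ.tr p.scal + 1) = 0 := by linear_combination h1 - h0
      have f2 : (3 : Ξ.gen) * (l * (Ξ.tr p.scal + l)) = 0 := by linear_combination h2 - h0
      have g1 := (hdom _ _ f1).resolve_left h3
      have g2 := (hdom _ _ ((hdom _ _ f2).resolve_left h3)).resolve_left hl0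
      exact hl1 (by linear_combination g2 - g1)
  · push Not at hall
    obtain ⟨u, hu⟩ := hall
    have hu' := (G.proper.mem_gen_iff hc).1 u.2
    have := step (p * T.cen (u : K) hu') (by rwa [T.vec_mul_cen]) (by rwa [T.scal_mul_cen])
    rw [T.scal_mul_cen, T.vec_mul_cen, G.scal_γ_mul_cen, rs_add, map_add, G.map_smul,
      rs_add] at this
    exact add_right_cancel this

end GroupIso

end PseudoQuadraticSpace

namespace PseudoQuadraticSpace

variable {K L K' L' : Type*} [DivisionRing K] [StarRing K] [AddCommGroup L] [Module Kᵐᵒᵖ L]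
  [DivisionRing K'] [StarRing K'] [AddCommGroup L'] [Module K'ᵐᵒᵖ L']
  {Ξ : PseudoQuadraticSpace K L} {Ξ' : PseudoQuadraticSpace K' L'}

/-- An isomorphism of the groups `T`, `T'` in the quadratic case that satisfies
`φ₁(a t) = φ₁(a) t'` for `γ(a, t) = (φ₁(a), t')`, where `K₀` has more than two elements. -/
structure QuadIso (Ξ : PseudoQuadraticSpace K L) (Ξ' : PseudoQuadraticSpace K' L') extends
    GroupIso Ξ Ξ' where
  central : Ξ.IsCentral
  central' : Ξ'.IsCentral
  exists_ne : ∃ l : Ξ.gen, l ≠ 0 ∧ l ≠ 1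
  map_vec_scal : ∀ p, φ₁ (p.vec <• p.scal) = φ₁ p.vec <• (γ p).scal

theorem IsCentral.inv_mul_star_mul_nm (hc : Ξ.IsCentral) {t : K} (ht : t ≠ 0) :
    t⁻¹ * star t * (Ξ.nm t : K) = Ξ.tr t * star t - Ξ.nm t := by
  have h := sq_eq_tr_nm (Ξ := Ξ) (star t)
  rw [tr_star, hc.nm_star] at h
  rw [← h, coe_nm, hc.star_mul_self, mul_assoc, ← mul_assoc (star t), hc.star_mul_self, mul_assoc,
    inv_mul_cancel_left₀ ht]

theorem IsProper.huaVec_smul (hΞ : Ξ.IsProper) (hc : Ξ.IsCentral) (p : Ξ.T) (b : L) (v : K) :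
    huaVec p b <• (p.scal * v * star p.scal) = huaVec p (b <• v) <• (Ξ.nm p.scal : K) := by
  have hn : ∀ y : K, y * star p.scal * Ξ.nm p.scal =
      star p.scal * (p.scal * y * star p.scal) := fun y => by
    rw [← hΞ.coe_comm hc, coe_nm]; simp only [mul_assoc]
  rw [huaVec, huaVec, sub_rs, sub_rs, Ξ.f_smul_right]
  simp only [← rs_mul]
  congr 3
  · rw [hn]
  · have := hn v
    simp only [mul_assoc] at this ⊢
    rw [this]

theorem one_hua (r : Ξ.T) : hua 1 r = 1 :=
  T.ext' (by simp [T.vec_hua, T.scal_one, T.vec_one]) (by simp [T.scal_hua, T.scal_one])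

namespace QuadIso

/-- The inverse isomorphism. -/
def symm (Q : QuadIso Ξ Ξ') : QuadIso Ξ' Ξ where
  toGroupIso := Q.toGroupIso.symm
  central := Q.central'
  central' := Q.central
  exists_ne := by
    obtain ⟨l, h0, h1⟩ := Q.exists_ne
    exact ⟨Q.φ l, by simpa using h0, by simpa using h1⟩
  map_vec_scal p := by
    obtain ⟨p, rfl⟩ := Q.γ.surjective p
    rw [Q.symm_γ_γ, Q.vec_γ, ← Q.map_vec_scal, Q.symm_φ₁_φ₁, Q.symm_φ₁_φ₁]

theorem coe_comm (Q : QuadIso Ξ Ξ') (r : Ξ.gen) (x : K) : (r : K) * x = x * r :=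
  Q.proper.coe_comm Q.central r x

theorem coe_comm' (Q : QuadIso Ξ Ξ') (r : Ξ'.gen) (x : K') : (r : K') * x = x * r :=
  Q.proper'.coe_comm Q.central' r x

theorem star_coe (Q : QuadIso Ξ Ξ') (r : Ξ.gen) : star (r : K) = r := Q.proper.star_coe Q.central r

theorem star_coe' (Q : QuadIso Ξ Ξ') (r : Ξ'.gen) : star (r : K') = r :=
  Q.proper'.star_coe Q.central' r

variable (Q : QuadIso Ξ Ξ')

theorem map_vec_star_scal (p : Ξ.T) :
    Q.φ₁ (p.vec <• star p.scal) = Q.φ₁ p.vec <• star (Q.γ p).scal := by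
  have h := Q.map_vec_scal p⁻¹
  rwa [T.vec_inv, T.scal_inv Q.proper, map_inv, T.scal_inv Q.proper', neg_rs, rs_neg, neg_neg,
    map_neg, neg_rs, rs_neg, neg_neg] at h

theorem map_tr (p : Ξ.T) : Q.φ (Ξ.tr p.scal) = Ξ'.tr (Q.γ p).scal := by
  apply Subtype.ext
  by_cases hp : p.vec = 0
  · have h := p.vec_eq_zero_iff.1 hp
    have e : Ξ.tr p.scal = ⟨p.scal, mem_gen h⟩ + ⟨p.scal, mem_gen h⟩ :=
      Subtype.ext (by simp [Ξ.star_eq _ h])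
    rw [coe_tr, Q.scal_γ_of_vec_eq_zero p hp, Q.star_coe', e, map_add]
    rfl
  · refine rs_left_cancel (Q.φ₁_ne_zero hp) ?_
    rw [← Q.map_smul, coe_tr, coe_tr, rs_add, rs_add, map_add, Q.map_vec_scal,
      Q.map_vec_star_scal]

theorem scal_γ_smul (p : Ξ.T) (l : Ξ.gen) {r : Ξ.T} (hr : r.vec = p.vec <• (l : K))
    (hs : r.scal = (l * l : Ξ.gen) * p.scal) (hp : p.vec ≠ 0) (hl : l ≠ 0) :
    (Q.γ r).scal = (Q.φ (l * l) : K') * (Q.γ p).scal := by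
  have h := Q.map_vec_scal r
  rw [hr, hs, Q.map_smul, ← rs_mul, ← rs_mul, Q.map_smul_mul' Q.central,
    Q.map_smul_mul' Q.central, Q.map_vec_scal, ← rs_mul, ← rs_mul] at h
  have h₂ := rs_left_cancel (Q.φ₁_ne_zero hp) h
  apply mul_left_cancel₀ (Q.φ_ne_zero hl)
  rw [← h₂, Q.coe_comm' (Q.φ (l * l)) (Q.φ l : K'), ← mul_assoc, ← Q.coe_comm' (Q.φ l), mul_assoc,
    Q.coe_comm' (Q.φ (l * l))]

/-- The linearization of `map_vec_scal`. -/
theorem map_linearized (p : Ξ.T) (b : L) :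
    Q.φ₁ (p.vec <• Ξ.f b p.vec + b <• p.scal) =
      Q.φ₁ p.vec <• Ξ'.f (Q.φ₁ b) (Q.φ₁ p.vec) + Q.φ₁ b <• (Q.γ p).scal := by
  by_cases hp : p.vec = 0
  · rw [hp, zero_rs, zero_add, map_zero, zero_rs, zero_add, Q.scal_γ_of_vec_eq_zero p hp,
      ← Q.map_smul]
  obtain ⟨l, hl0, hl1⟩ := Q.exists_ne
  have key : ∀ r : Ξ.T, Q.φ₁ (r.vec <• Ξ.f b r.vec + b <• r.scal)
      + Q.φ₁ (r.vec <• Ξ.q b + b <• Ξ.f b r.vec) =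
      (Q.φ₁ r.vec <• Ξ'.f (Q.φ₁ b) (Q.φ₁ r.vec) + Q.φ₁ b <• (Q.γ r).scal) +
      (Q.φ₁ r.vec <• (Q.γ (T.lift b)).scal + Q.φ₁ b <• Ξ'.f (Q.φ₁ b) (Q.φ₁ r.vec)) := by
    intro r
    have h := Q.map_vec_scal (r * T.lift b)
    have h₁ := Q.map_vec_scal r
    have h₂ := Q.map_vec_scal (T.lift b)
    rw [Q.scal_γ_mul, T.vec_mul, T.scal_mul] at h
    simp only [T.vec_lift, T.scal_lift, add_rs, rs_add, map_add] at h h₁ h₂ ⊢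
    rw [h₁, h₂] at h
    have := congrArg (fun y => y - Q.φ₁ r.vec <• (Q.γ r).scal -
      Q.φ₁ b <• (Q.γ (T.lift b)).scal) h
    convert this using 1
    · abel
    · abel
  have h₁ := key p
  have h₂ := key (p.rsmul l)
  have hsc : (p.rsmul (l : K)).scal = (l * l : Ξ.gen) * p.scal := by
    rw [T.scal_rsmul, Q.star_coe, mul_assoc, ← Q.coe_comm, ← mul_assoc]; rfl
  rw [Q.scal_γ_smul p l rfl hsc hp hl0, hsc] at h₂
  have e₁ : p.vec <• (l : K) <• Ξ.f b (p.vec <• (l : K)) + b <• (((l * l : Ξ.gen) : K) * p.scal) =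
      (p.vec <• Ξ.f b p.vec + b <• p.scal) <• ((l * l : Ξ.gen) : K) := by
    rw [Ξ.f_smul_right, add_rs, ← rs_mul, ← rs_mul, ← rs_mul, Q.coe_comm (l * l), Q.coe_comm l]
    push_cast; simp only [mul_assoc]
  have e₂ : p.vec <• (l : K) <• Ξ.q b + b <• Ξ.f b (p.vec <• (l : K)) =
      (p.vec <• Ξ.q b + b <• Ξ.f b p.vec) <• (l : K) := by
    rw [Ξ.f_smul_right, add_rs, ← rs_mul, ← rs_mul, ← rs_mul, Q.coe_comm l]
  have e₃ : Q.φ₁ (p.vec <• (l : K)) <• Ξ'.f (Q.φ₁ b) (Q.φ₁ (p.vec <• (l : K))) +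
      Q.φ₁ b <• ((Q.φ (l * l) : K') * (Q.γ p).scal) =
      (Q.φ₁ p.vec <• Ξ'.f (Q.φ₁ b) (Q.φ₁ p.vec) + Q.φ₁ b <• (Q.γ p).scal) <•
        (Q.φ (l * l) : K') := by
    rw [Q.map_smul, Ξ'.f_smul_right, add_rs, ← rs_mul, ← rs_mul, ← rs_mul,
      Q.coe_comm' (Q.φ (l * l)),
      Q.coe_comm' (Q.φ l), map_mul]
    push_cast; simp only [mul_assoc]
  have e₄ : Q.φ₁ (p.vec <• (l : K)) <• (Q.γ (T.lift b)).scal +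
      Q.φ₁ b <• Ξ'.f (Q.φ₁ b) (Q.φ₁ (p.vec <• (l : K))) =
      (Q.φ₁ p.vec <• (Q.γ (T.lift b)).scal + Q.φ₁ b <• Ξ'.f (Q.φ₁ b) (Q.φ₁ p.vec)) <•
        (Q.φ l : K') := by
    rw [Q.map_smul, Ξ'.f_smul_right, add_rs, ← rs_mul, ← rs_mul, ← rs_mul, Q.coe_comm' (Q.φ l)]
  rw [T.vec_rsmul, e₁, e₂, e₃, e₄, Q.map_smul, Q.map_smul] at h₂
  set A := Q.φ₁ (p.vec <• Ξ.f b p.vec + b <• p.scal)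
  set B := Q.φ₁ (p.vec <• Ξ.q b + b <• Ξ.f b p.vec)
  set A' := Q.φ₁ p.vec <• Ξ'.f (Q.φ₁ b) (Q.φ₁ p.vec) + Q.φ₁ b <• (Q.γ p).scal
  set B' := Q.φ₁ p.vec <• (Q.γ (T.lift b)).scal + Q.φ₁ b <• Ξ'.f (Q.φ₁ b) (Q.φ₁ p.vec)
  have h₃ : B - B' = -(A - A') := by
    rw [neg_sub, sub_eq_sub_iff_add_eq_add, add_comm B, h₁, add_comm]
  have h₄ : (A - A') <• (Q.φ (l * l) : K') + (B - B') <• (Q.φ l : K') = 0 := by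
    rw [sub_rs, sub_rs, ← sub_eq_zero.2 h₂]; abel
  rw [h₃, neg_rs, ← sub_eq_add_neg, ← rs_sub, rs_eq_zero] at h₄
  refine sub_eq_zero.1 (h₄.resolve_right fun h => ?_)
  rw [sub_eq_zero] at h
  have h₅ := Q.φ.injective (Subtype.ext h)
  have h₆ : (l : K) * l = l * 1 := by rw [mul_one]; exact congrArg Subtype.val h₅
  exact hl1 (Subtype.ext (mul_left_cancel₀ (coe_ne_zero hl0) h₆))

theorem map_nm (p : Ξ.T) : Q.φ (Ξ.nm p.scal) = Ξ'.nm (Q.γ p).scal := by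
  by_cases hp : p.vec = 0
  · have h := p.vec_eq_zero_iff.1 hp
    have e : Ξ.nm p.scal = ⟨p.scal, mem_gen h⟩ * ⟨p.scal, mem_gen h⟩ :=
      Subtype.ext (by simp [Ξ.star_eq _ h])
    apply Subtype.ext
    rw [coe_nm, Q.scal_γ_of_vec_eq_zero p hp, Q.star_coe', e, map_mul]
    rfl
  let _ := Q.proper'.genCommRing Q.central'
  have hdom : ∀ x y : Ξ'.gen, x * y = 0 → x = 0 ∨ y = 0 := fun x y h => by
    have : (x : K') * y = 0 := by rw [← MulMemClass.coe_mul, h]; rfl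
    exact (mul_eq_zero.1 this).imp Subtype.ext Subtype.ext
  have key : ∀ r : Ξ.T, r.vec ≠ 0 →
      Ξ'.nm (Q.γ r).scal * Ξ'.nm (Q.γ r).scal = Q.φ (Ξ.nm r.scal) * Q.φ (Ξ.nm r.scal) ∧
      Ξ'.nm (Q.γ r).scal * Ξ'.tr (Q.γ r).scal = Q.φ (Ξ.nm r.scal) * Ξ'.tr (Q.γ r).scal := by
    intro r hr
    set t := r.scal with ht
    set t' := (Q.γ r).scal with ht'
    have ht'0 : t' ∉ Ξ'.K₀ := T.scal_not_mem (by rw [Q.vec_γ]; exact Q.φ₁_ne_zero hr)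
    set s' := (Q.γ (r.rsmul t)).scal with hs'
    have hsc : (r.rsmul t).scal = Ξ.nm t * t := rfl
    have h₁ := Q.map_vec_star_scal (r.rsmul t)
    rw [hsc, T.vec_rsmul, Q.map_vec_scal, star_mul, Q.star_coe, ← rs_mul, ← mul_assoc,
      ← Q.central.star_mul_self, ← rs_mul] at h₁
    have h₂ : Q.φ₁ (r.vec <• (star t * t * (Ξ.nm t : K))) =
        Q.φ₁ r.vec <• ((Q.φ (Ξ.nm t * Ξ.nm t) : Ξ'.gen) : K') := by
      rw [← Q.map_smul]; rfl
    rw [h₂] at h₁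
    have h₃ := rs_left_cancel (Q.φ₁_ne_zero hr) h₁
    have hk : s' - Ξ'.nm t' * t' ∈ Ξ'.K₀ := by
      have e₁ := Q.γ_mem (r.rsmul t)
      have e₂ := ((Q.γ r).rsmul t').mem
      rw [T.vec_rsmul, Q.vec_γ, T.scal_rsmul] at e₂
      rw [T.vec_rsmul, Q.map_vec_scal] at e₁
      convert sub_mem e₂ e₁ using 1
      rw [coe_nm]; abel
    set k : Ξ'.gen := ⟨_, mem_gen hk⟩ with hk_def
    have hsk : s' = Ξ'.nm t' * t' + k := by rw [hk_def]; simp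
    have h₄ : (t' * star s' : K') = (Ξ'.nm t' * Ξ'.nm t' : Ξ'.gen) + k * t' := by
      rw [hsk, star_add, star_mul, Q.star_coe', Q.star_coe', mul_add, ← mul_assoc,
        ← Q.central'.star_mul_self, Q.coe_comm' k]
      rfl
    rw [h₄] at h₃
    have h₅ : (((Ξ'.nm t' * Ξ'.nm t' - Q.φ (Ξ.nm t * Ξ.nm t) : Ξ'.gen) : K') + k * t') = 0 := by
      rw [AddSubgroupClass.coe_sub, h₃]; abel
    obtain ⟨h₆, h₇⟩ := Q.proper'.coe_add_coe_mul_eq_zero Q.central' ht'0 h₅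
    refine ⟨by rw [sub_eq_zero.1 h₆, map_mul], ?_⟩
    have h₈ := Q.map_tr (r.rsmul t)
    rw [hsc, ← hs', hsk, h₇, ZeroMemClass.coe_zero, add_zero] at h₈
    have e : Ξ.tr (Ξ.nm t * t) = Ξ.nm t * Ξ.tr t := Subtype.ext (by
      rw [coe_tr, star_mul, Q.star_coe, ← Q.coe_comm, MulMemClass.coe_mul, coe_tr, mul_add])
    have e' : Ξ'.tr (Ξ'.nm t' * t') = Ξ'.nm t' * Ξ'.tr t' := Subtype.ext (by
      rw [coe_tr, star_mul, Q.star_coe', ← Q.coe_comm', MulMemClass.coe_mul, coe_tr, mul_add])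
    rw [e, e', map_mul, Q.map_tr] at h₈
    exact h₈.symm
  have key₂ : ∀ r : Ξ.T, r.vec ≠ 0 → Ξ'.tr (Q.γ r).scal ≠ 0 →
      Q.φ (Ξ.nm r.scal) = Ξ'.nm (Q.γ r).scal := by
    intro r hr h0
    obtain ⟨_, h⟩ := key r hr
    have : (Q.φ (Ξ.nm r.scal) - Ξ'.nm (Q.γ r).scal) * Ξ'.tr (Q.γ r).scal = 0 := by
      linear_combination -h
    exact sub_eq_zero.1 ((hdom _ _ this).resolve_right h0)
  by_cases h0 : Ξ'.tr (Q.γ p).scal = 0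
  swap
  · exact key₂ p hp h0
  by_cases h2 : (2 : Ξ'.gen) = 0
  · obtain ⟨h, _⟩ := key p hp
    have : (Q.φ (Ξ.nm p.scal) - Ξ'.nm (Q.γ p).scal) * (Q.φ (Ξ.nm p.scal) - Ξ'.nm (Q.γ p).scal)
        = 0 := by
      linear_combination h + (Q.φ (Ξ.nm p.scal) * Q.φ (Ξ.nm p.scal)
        - Q.φ (Ξ.nm p.scal) * Ξ'.nm (Q.γ p).scal) * h2
    exact sub_eq_zero.1 ((hdom _ _ this).elim id id)
  · have e₁ : (Q.φ ⟨1, mem_gen Ξ.one_mem⟩ : K') = (1 : Ξ'.gen) :=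
      congrArg Subtype.val (map_one Q.φ)
    have h := key₂ (p * T.cen 1 Ξ.one_mem) (by rwa [T.vec_mul_cen]) (by
      rw [Q.scal_γ_mul_cen, e₁, Q.proper'.tr_add_coe Q.central', h0, zero_add]
      intro h; apply h2; linear_combination h)
    have e₂ := Q.proper.nm_add_coe Q.central p.scal 1
    have e₃ := Q.map_tr p
    rw [OneMemClass.coe_one] at e₂
    rw [Q.scal_γ_mul_cen, e₁, Q.proper'.nm_add_coe Q.central', T.scal_mul_cen, e₂,
      map_add, map_add, map_mul, map_mul, map_one, e₃] at h
    exact add_right_cancel (add_right_cancel h)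

theorem scal_ne_zero' {p : Ξ.T} (h : p.scal ≠ 0) : (Q.γ p).scal ≠ 0 := by
  intro h'
  have h₁ := Q.map_nm p
  have h₂ : Ξ'.nm (Q.γ p).scal = 0 := Subtype.ext (by simp [h'])
  rw [h₂] at h₁
  exact IsProper.nm_ne_zero _ h ((map_eq_zero_iff _ Q.φ.injective).1 h₁)

theorem map_vec_inv_scal (p : Ξ.T) (h : p.scal ≠ 0) :
    Q.φ₁ (p.vec <• p.scal⁻¹) = Q.φ₁ p.vec <• (Q.γ p).scal⁻¹ := by
  have h' := Q.scal_ne_zero' h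
  refine rs_right_cancel (Q.φ_ne_zero (IsProper.nm_ne_zero _ h)) ?_
  rw [← Q.map_smul, ← rs_mul, Q.map_nm, ← rs_mul, coe_nm, coe_nm, Q.central.star_mul_self,
    Q.central'.star_mul_self, inv_mul_cancel_left₀ h, inv_mul_cancel_left₀ h',
    Q.map_vec_star_scal]

theorem map_huaVec (p : Ξ.T) (b : L) : Q.φ₁ (huaVec p b) = huaVec (Q.γ p) (Q.φ₁ b) := by
  by_cases hp : p.vec = 0
  · have h := p.vec_eq_zero_iff.1 hp
    rw [huaVec, huaVec, Q.vec_γ, hp, zero_rs, map_zero, zero_rs, sub_zero, sub_zero,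
      Ξ.star_eq _ h, Q.scal_γ_of_vec_eq_zero p hp, Q.star_coe', ← Q.map_smul]
  have h0 := T.scal_ne_zero hp
  have h0' := Q.scal_ne_zero' h0
  have hs0 : star p.scal ≠ 0 := star_ne_zero.2 h0
  have hs0' : star (Q.γ p).scal ≠ 0 := star_ne_zero.2 h0'
  set t := p.scal with ht
  set t' := (Q.γ p).scal with ht'
  set r := p.rsmul t⁻¹ with hr
  have hrs : r.scal = (star t)⁻¹ := by
    rw [hr, T.scal_rsmul, star_inv₀, mul_assoc, mul_inv_cancel₀ h0, mul_one]
  have hrv : Q.φ₁ r.vec = Q.φ₁ p.vec <• t'⁻¹ := Q.map_vec_inv_scal p h0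
  have hnm : (Q.φ (Ξ.nm t) : K') = star t' * t' := congrArg Subtype.val (Q.map_nm p)
  have hnm0 : (Q.φ (Ξ.nm t) : K') ≠ 0 := Q.φ_ne_zero (IsProper.nm_ne_zero _ h0)
  have hrs' : (Q.γ r).scal = (star t')⁻¹ := by
    have h₁ := Q.map_vec_scal r
    rw [hrv, hrs, hr, T.vec_rsmul, ← rs_mul, ← mul_inv_rev, ← rs_mul] at h₁
    have h₂ := congrArg (fun y => y <• (Q.φ (Ξ.nm t) : K')) h₁
    beta_reduce at h₂
    have hn0 : star t * t ≠ 0 := mul_ne_zero hs0 h0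
    rw [← Q.map_smul, ← rs_mul, coe_nm, inv_mul_cancel₀ hn0, rs_one, ← rs_mul,
      ← rs_one (K := K') (Q.φ₁ p.vec), ← rs_mul, one_mul] at h₂
    have h₃ := rs_left_cancel (Q.φ₁_ne_zero hp) h₂
    rw [hnm, Q.central'.star_mul_self] at h₃
    have h₄ : t'⁻¹ * (Q.γ r).scal = (t' * star t')⁻¹ := eq_inv_of_mul_eq_one_left h₃.symm
    rw [inv_mul_eq_iff_eq_mul₀ h0'] at h₄
    rw [h₄, ← Q.central'.star_mul_self, mul_inv_rev, mul_inv_cancel_left₀ h0']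
  have hX : Q.φ₁ (p.vec <• (t⁻¹ * Ξ.f b p.vec * star t) + b <• t) =
      Q.φ₁ p.vec <• (t'⁻¹ * Ξ'.f (Q.φ₁ b) (Q.φ₁ p.vec) * star t') + Q.φ₁ b <• t' := by
    have h₁ := congrArg (fun y => y <• (Q.φ (Ξ.nm t) : K')) (Q.map_linearized r b)
    beta_reduce at h₁
    rw [← Q.map_smul, hrv, hrs', hrs, add_rs, add_rs, hr, T.vec_rsmul, Ξ.f_smul_right,
      Ξ'.f_smul_right, ← rs_mul, ← rs_mul, ← rs_mul, ← rs_mul, ← rs_mul, ← rs_mul, hnm, coe_nm,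
      inv_mul_cancel_left₀ hs0, inv_mul_cancel_left₀ hs0', Q.central.star_mul_self,
      Q.central'.star_mul_self] at h₁
    simpa only [mul_assoc, inv_mul_cancel_left₀ h0, inv_mul_cancel_left₀ h0'] using h₁
  have hY : Q.φ₁ (p.vec <• (t⁻¹ * star t)) = Q.φ₁ p.vec <• (t'⁻¹ * star t') := by
    have e := Q.central.inv_mul_star_mul_nm h0
    have e' := Q.central'.inv_mul_star_mul_nm h0'
    refine rs_right_cancel hnm0 ?_
    rw [← Q.map_smul, ← rs_mul, ← rs_mul, e, Q.map_nm, e', rs_sub, rs_sub, map_sub,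
      Q.map_smul_mul' Q.central, Q.map_vec_star_scal, Q.map_smul, Q.map_nm, Q.map_tr, ← rs_mul,
      Q.coe_comm']
  have hg := Q.map_tr_f b p.vec
  have e₁ : huaVec p b = b <• (Ξ.tr t : K) - (p.vec <• (t⁻¹ * Ξ.f b p.vec * star t) + b <• t)
      + p.vec <• (t⁻¹ * star t) <• (Ξ.tr (Ξ.f b p.vec) : K) := by
    rw [huaVec, ← rs_mul, ← Q.coe_comm, ← mul_assoc, Q.coe_comm _ t⁻¹, coe_tr, coe_tr, star_f,
      mul_add, add_mul, rs_add, rs_add, mul_neg, neg_mul, rs_neg]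
    abel
  have e₂ : huaVec (Q.γ p) (Q.φ₁ b) = Q.φ₁ b <• (Ξ'.tr t' : K') -
      (Q.φ₁ p.vec <• (t'⁻¹ * Ξ'.f (Q.φ₁ b) (Q.φ₁ p.vec) * star t') + Q.φ₁ b <• t')
      + Q.φ₁ p.vec <• (t'⁻¹ * star t') <• (Ξ'.tr (Ξ'.f (Q.φ₁ b) (Q.φ₁ p.vec)) : K') := by
    rw [huaVec, ← rs_mul, ← Q.coe_comm', ← mul_assoc, Q.coe_comm' _ t'⁻¹, coe_tr, coe_tr, star_f,
      mul_add, add_mul, rs_add, rs_add, mul_neg, neg_mul, rs_neg, Q.vec_γ]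
    abel
  rw [e₁, e₂, map_add, map_sub, hX, Q.map_smul, Q.map_smul, hY, Q.map_tr, hg, coe_tr (Ξ'.f _ _)]

/-- The group isomorphism is a Jordan isomorphism. -/
theorem isJordanIso : IsJordanIso Q.γ := by
  refine ⟨Q.γ.bijective, map_mul Q.γ, ?_, fun p r => ?_⟩
  · refine T.ext' ?_ ?_
    · rw [Q.vec_γ, T.vec_unit, map_zero, T.vec_unit]
    · rw [Q.scal_γ_of_vec_eq_zero _ T.vec_unit]
      exact congrArg Subtype.val (map_one Q.φ)
  by_cases h0 : p.scal = 0
  · have hp : p = 1 := T.ext' (p.vec_eq_zero_iff.2 (h0 ▸ zero_mem _)) h0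
    rw [hp, one_hua, map_one, one_hua]
  have hv : (Q.γ (hua p r)).vec = (hua (Q.γ p) (Q.γ r)).vec := by
    rw [Q.vec_γ, T.vec_hua', Q.map_huaVec, T.vec_hua', Q.vec_γ]
  refine T.ext' hv ?_
  by_cases hr : r.vec = 0
  · have hrm := r.vec_eq_zero_iff.1 hr
    rw [Q.scal_γ_of_vec_eq_zero, T.scal_hua (Q.γ p), Q.scal_γ_of_vec_eq_zero r hr,
      ← Q.coe_comm', mul_assoc, ← Q.central'.star_mul_self]
    · have : (⟨(hua p r).scal, mem_gen ((T.vec_eq_zero_iff _).1 (by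
          rw [T.vec_hua', hr, huaVec]; simp [f_zero_right]))⟩ : Ξ.gen) =
          ⟨r.scal, mem_gen hrm⟩ * Ξ.nm p.scal := Subtype.ext (by
        rw [MulMemClass.coe_mul, coe_nm, Q.central.star_mul_self]
        simp only [T.scal_hua]
        rw [← Q.central _ hrm, mul_assoc])
      rw [this, map_mul, Q.map_nm]; rfl
    · rw [T.vec_hua', hr, huaVec]; simp [f_zero_right]
  · have hs0 : star p.scal ≠ 0 := star_ne_zero.2 h0
    have hne : (hua p r).vec ≠ 0 := by
      rw [Ne, T.vec_eq_zero_iff, T.scal_hua]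
      intro h
      apply T.scal_not_mem hr
      have := Ξ.conj_mem (star p.scal)⁻¹ _ h
      rw [star_inv₀, star_star] at this
      simpa only [mul_assoc, inv_mul_cancel_left₀ h0, mul_inv_cancel₀ hs0, mul_one] using this
    have key := Q.proper.huaVec_smul Q.central p r.vec r.scal
    have key' := Q.proper'.huaVec_smul Q.central' (Q.γ p) (Q.γ r).vec (Q.γ r).scal
    have h := Q.map_vec_scal (hua p r)
    rw [T.vec_hua', T.scal_hua, key, Q.map_smul, Q.map_huaVec, Q.map_huaVec, Q.map_vec_scal,
      Q.map_nm, ← Q.vec_γ, ← key'] at h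
    have hne' : (Q.γ (hua p r)).vec ≠ 0 := by rw [Q.vec_γ]; exact Q.φ₁_ne_zero hne
    rw [hv, T.vec_hua'] at hne'
    rw [T.scal_hua (Q.γ p)]
    exact (rs_left_cancel hne' h).symm

end QuadIso

theorem IsJordanIso.exists_quadIso (hΞ : Ξ.IsProper) (hΞ' : Ξ'.IsProper) {γ : Ξ.T → Ξ'.T}
    (h : IsJordanIso γ) (hc : Ξ.IsCentral) (hF : ∃ l ∈ Ξ.K₀, l ≠ 0 ∧ l ≠ 1) :
    ∃ Q : QuadIso Ξ Ξ', ⇑Q.γ = γ := by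
  obtain ⟨G, rfl⟩ := h.exists_groupIso hΞ hΞ'
  obtain ⟨l, hl, hl0, hl1⟩ := hF
  have h0 : (⟨l, mem_gen hl⟩ : Ξ.gen) ≠ 0 := fun h => hl0 (congrArg Subtype.val h)
  have h1 : (⟨l, mem_gen hl⟩ : Ξ.gen) ≠ 1 := fun h => hl1 (congrArg Subtype.val h)
  exact ⟨⟨G, hc, G.isCentral_iff.1 hc, ⟨_, h0, h1⟩,
    GroupIso.map_vec_scal_of_hua hc (G.isCentral_iff.1 hc) h h0 h1⟩, rfl⟩

end PseudoQuadraticSpace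

namespace PseudoQuadraticSpace

variable {K L : Type*} [DivisionRing K] [StarRing K] [AddCommGroup L] [Module Kᵐᵒᵖ L]
variable {Ξ : PseudoQuadraticSpace K L}

/-- In the quadratic case with `K` not commutative, `K₀` is the centre of `K`. -/
theorem IsProper.mem_K₀_iff_center (hΞ : Ξ.IsProper) (hc : Ξ.IsCentral)
    (hn : ∃ x y : K, x * y ≠ y * x) {z : K} : z ∈ Ξ.K₀ ↔ ∀ y, z * y = y * z := by
  refine ⟨fun h => hc z h, fun hz => (hΞ.mem_K₀_iff hc).2 ⟨?_, hz⟩⟩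
  by_contra hs
  obtain ⟨x, y, hxy⟩ := hn
  apply hxy
  have hz' : ∀ y, star z * y = y * star z := fun y => by
    have := congrArg star (hz (star y))
    rw [star_mul, star_mul, star_star] at this
    exact this.symm
  have h₁ : ∀ w, (y * (z - star z)) * w = w * (y * (z - star z)) := by
    intro w
    have e : y * (z - star z) = (y * z + star (y * z)) - star z * (y + star y) := by
      rw [star_mul, mul_sub, mul_add, ← hz']; abel
    rw [e, sub_mul, mul_sub, hc _ (Ξ.trace_mem _), mul_assoc, hc _ (Ξ.trace_mem _), ← mul_assoc,
      hz', mul_assoc]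
  have hd : z - star z ≠ 0 := fun h => hs (sub_eq_zero.1 h).symm
  have h₂ := h₁ x
  have h₃ : (z - star z) * x = x * (z - star z) := by rw [sub_mul, mul_sub, hz, hz']
  rw [mul_assoc, h₃, ← mul_assoc, ← mul_assoc] at h₂
  exact (mul_right_cancel₀ hd h₂).symm

/-- Elements `α`, `e` of `K` with `α^σ ≠ α` and `0 ≠ e`, `e α = α^σ e`. -/
structure IsQuatPair (Ξ : PseudoQuadraticSpace K L) (α e : K) : Prop where
  ne : star α ≠ α
  e_ne : e ≠ 0
  anti : e * α = star α * e

theorem anti_star_of_anti (Ξ : PseudoQuadraticSpace K L) (hc : Ξ.IsCentral) {α z : K}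
    (h : z * α = star α * z) : z * star α = α * z := by
  have h₁ := hc _ (Ξ.trace_mem α) z
  rw [add_mul, mul_add, h, add_comm (star α * z)] at h₁
  exact (add_right_cancel h₁).symm

theorem star_eq_neg_of_anti (Ξ : PseudoQuadraticSpace K L) (hc : Ξ.IsCentral) {α z : K}
    (hα : star α ≠ α) (h : z * α = star α * z) : star z = -z := by
  have h' : star z * α = star α * star z := by
    have := congrArg star h
    rw [star_mul, star_mul, star_star] at this
    exact this.symm
  have h₁ : (z + star z) * (α - star α) = 0 := by
    rw [mul_sub, hc _ (Ξ.trace_mem z) (star α), add_mul, h, h', mul_add, sub_self]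
  exact (neg_eq_of_add_eq_zero_right
    ((mul_eq_zero.1 h₁).resolve_right (sub_ne_zero.2 hα.symm))).symm

theorem commutator_anti (Ξ : PseudoQuadraticSpace K L) (α y : K) (hc : Ξ.IsCentral) :
    (α * y - y * α) * α = star α * (α * y - y * α) := by
  have h₁ := sq_eq_tr_nm (Ξ := Ξ) α
  have h₂ := star_eq_tr_sub (Ξ := Ξ) α
  have h₃ := hc _ (Ξ.trace_mem α) y
  have h₄ := hc _ (star_mul_self_mem (Ξ := Ξ) α) y
  rw [sub_mul, mul_assoc y, h₁, mul_sub, mul_sub, ← mul_assoc, ← mul_assoc (star α)]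
  rw [coe_tr, coe_nm, ← h₄, ← mul_assoc, ← h₃]
  noncomm_ring

theorem exists_quatPair (hΞ : Ξ.IsProper) (hc : Ξ.IsCentral) (hn : ∃ x y : K, x * y ≠ y * x)
    {α : K} (hα : star α ≠ α) : ∃ e, Ξ.IsQuatPair α e := by
  have : α ∉ Ξ.K₀ := fun h => hα (Ξ.star_eq α h)
  rw [hΞ.mem_K₀_iff_center hc hn] at this
  push Not at this
  obtain ⟨y, hy⟩ := this
  exact ⟨α * y - y * α, hα, sub_ne_zero.2 hy, commutator_anti Ξ α y hc⟩

theorem even_odd {α A B : K} (hα : star α ≠ α) (hA : A * α = α * A) (hB : B * α = star α * B)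
    (h : A + B = 0) : A = 0 ∧ B = 0 := by
  have hAB : A = -B := eq_neg_of_add_eq_zero_left h
  have h₁ : (α - star α) * A = 0 := by
    rw [sub_mul, ← hA, hAB, neg_mul, hB, mul_neg, sub_self]
  have h₂ := (mul_eq_zero.1 h₁).resolve_left (sub_ne_zero.2 hα.symm)
  exact ⟨h₂, by rwa [h₂, zero_add] at h⟩

theorem exists_even_add_odd (hc : Ξ.IsCentral) {α : K} (hα : star α ≠ α) (y : K) :
    ∃ A B, A * α = α * A ∧ B * α = star α * B ∧ y = A + B := by
  have hδ : α - star α ≠ 0 := sub_ne_zero.2 hα.symm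
  have hδα : (α - star α)⁻¹ * α = α * (α - star α)⁻¹ := by
    rw [inv_mul_eq_iff_eq_mul₀ hδ, ← mul_assoc, sub_mul, hc.star_mul_self, ← mul_sub,
      mul_assoc, mul_inv_cancel₀ hδ, mul_one]
  have hδα' : (α - star α)⁻¹ * star α = star α * (α - star α)⁻¹ := by
    rw [inv_mul_eq_iff_eq_mul₀ hδ, ← mul_assoc, sub_mul, ← hc.star_mul_self, ← mul_sub,
      mul_assoc, mul_inv_cancel₀ hδ, mul_one]
  refine ⟨(α - star α)⁻¹ * (y * α - star α * y), (α - star α)⁻¹ * (α * y - y * α), ?_, ?_, ?_⟩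
  · have h₁ : (y * α - star α * y) * α = α * (y * α - star α * y) := by
      have e₁ := sq_eq_tr_nm (Ξ := Ξ) α
      have e₂ := hc _ (star_mul_self_mem (Ξ := Ξ) α) y
      have e₃ := hc _ (Ξ.trace_mem α) y
      rw [sub_mul, mul_assoc y, e₁, mul_sub, mul_sub, coe_nm, ← e₂, ← mul_assoc, coe_tr, ← e₃,
        ← mul_assoc, ← mul_assoc, ← hc.star_mul_self]
      noncomm_ring
    rw [mul_assoc, h₁, ← mul_assoc, hδα, mul_assoc]
  · rw [mul_assoc, commutator_anti Ξ α y hc, ← mul_assoc, ← mul_assoc, hδα']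
  · rw [← mul_add, eq_inv_mul_iff_mul_eq₀ hδ]; noncomm_ring

namespace IsQuatPair

variable {α e : K}

theorem star_e (hc : Ξ.IsCentral) (h : Ξ.IsQuatPair α e) : star e = -e :=
  star_eq_neg_of_anti Ξ hc h.ne h.anti

theorem e_star (hc : Ξ.IsCentral) (h : Ξ.IsQuatPair α e) : e * star α = α * e :=
  anti_star_of_anti Ξ hc h.anti

theorem commute_mul_inv_e (hc : Ξ.IsCentral) (h : Ξ.IsQuatPair α e) {z : K}
    (hz : z * α = star α * z) :
    z * e⁻¹ * α = α * (z * e⁻¹) := by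
  have h₁ : e⁻¹ * α = star α * e⁻¹ := by
    rw [inv_mul_eq_iff_eq_mul₀ h.e_ne, ← mul_assoc, h.e_star hc, mul_inv_cancel_right₀ h.e_ne]
  rw [mul_assoc, h₁, ← mul_assoc, anti_star_of_anti Ξ hc hz, mul_assoc]

/-- The centralizer of `α` is `K₀ + K₀ α`. -/
theorem exists_of_commute (hΞ : Ξ.IsProper) (hc : Ξ.IsCentral) (h : Ξ.IsQuatPair α e) {s : K}
    (hs : s * α = α * s) : ∃ r c : Ξ.gen, s = r + c * α := by
  have hcomm_star : ∀ {x : K}, x * α = α * x → x * star α = star α * x := by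
    intro x hx
    rw [star_eq_tr_sub (Ξ := Ξ) α, mul_sub, sub_mul, hx, hΞ.coe_comm hc]
  have hstar_comm : ∀ {x : K}, x * α = α * x → star x * α = α * star x := by
    intro x hx
    have := congrArg star (hcomm_star hx)
    rw [star_mul, star_mul, star_star] at this
    exact this.symm
  have he : ∀ {x : K}, x * α = α * x → e * star x = x * e := by
    intro x hx
    have h₁ : (x * e) * α = star α * (x * e) := by
      rw [mul_assoc, h.anti, ← mul_assoc, hcomm_star hx, mul_assoc]
    have h₂ := star_eq_neg_of_anti Ξ hc h.ne h₁
    rw [star_mul, h.star_e hc, neg_mul, neg_inj] at h₂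
    exact h₂
  have hCC : ∀ {x y : K}, x * α = α * x → y * α = α * y → x * y = y * x := by
    intro x y hx hy
    have hx' := hstar_comm hx
    have hy' := hstar_comm hy
    have hxy : star x * star y * α = α * (star x * star y) := by
      rw [mul_assoc, hy', ← mul_assoc, hx', mul_assoc]
    have h₁ := he hxy
    rw [mul_assoc, ← he hy', ← mul_assoc, ← he hx', mul_assoc, star_mul, star_star, star_star]
      at h₁
    exact (mul_left_cancel₀ h.e_ne h₁).symm
  have hδ : α - star α ≠ 0 := sub_ne_zero.2 h.ne.symm
  have hδc : ∀ {x : K}, x * α = α * x → (α - star α)⁻¹ * x = x * (α - star α)⁻¹ := by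
    intro x hx
    rw [inv_mul_eq_iff_eq_mul₀ hδ, ← mul_assoc, sub_mul, ← hx, ← hcomm_star hx, ← mul_sub,
      mul_assoc, mul_inv_cancel₀ hδ, mul_one]
  have hfix : ∀ {u : K}, star u = u → u * α = α * u → u ∈ Ξ.K₀ := by
    intro u hu huα
    refine (hΞ.mem_K₀_iff hc).2 ⟨hu, fun y => ?_⟩
    have hue : u * e = e * u := by rw [← he huα, hu]
    have hodd : ∀ z, z * α = star α * z → u * z = z * u := by
      intro z hz
      have := hCC huα (h.commute_mul_inv_e hc hz)
      rw [← inv_mul_cancel_right₀ h.e_ne z, ← mul_assoc, this, mul_assoc, hue, ← mul_assoc]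
    obtain ⟨A, B, hA, hB, rfl⟩ := exists_even_add_odd hc h.ne y
    rw [mul_add, add_mul, hodd _ hB, hCC huα hA]
  have hs' := hstar_comm hs
  have hd : (s - star s) * α = α * (s - star s) := by rw [sub_mul, mul_sub, hs, hs']
  have hcm : (α - star α)⁻¹ * (s - star s) ∈ Ξ.K₀ := by
    refine hfix ?_ ?_
    · rw [star_mul, star_sub, star_star, star_inv₀, star_sub, star_star, ← neg_sub s,
        ← neg_sub α, inv_neg, neg_mul_neg, hδc hd]
    · rw [mul_assoc, hd, ← mul_assoc, hδc rfl, mul_assoc]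
  set c : Ξ.gen := ⟨_, mem_gen hcm⟩ with hc_def
  have hcδ : s - star s = c * (α - star α) := by
    change _ = (α - star α)⁻¹ * (s - star s) * (α - star α)
    rw [hδc hd, inv_mul_cancel_right₀ hδ]
  have hr : s - c * α ∈ Ξ.K₀ := by
    refine hfix ?_ ?_
    · rw [star_sub, star_mul, hΞ.star_coe hc, ← hΞ.coe_comm hc]
      have : star s = s - c * (α - star α) := by rw [← hcδ]; abel
      rw [this]; noncomm_ring
    · rw [sub_mul, mul_sub, hs, ← mul_assoc, ← hΞ.coe_comm hc, mul_assoc]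
  exact ⟨⟨_, mem_gen hr⟩, c, by simp⟩

theorem exists_decomp (hΞ : Ξ.IsProper) (hc : Ξ.IsCentral) (h : Ξ.IsQuatPair α e) (y : K) :
    ∃ r s m k : Ξ.gen, y = (r + s * α) + (m + k * α) * e := by
  obtain ⟨A, B, hA, hB, rfl⟩ := exists_even_add_odd hc h.ne y
  obtain ⟨r, s, rfl⟩ := h.exists_of_commute hΞ hc hA
  obtain ⟨m, k, hmk⟩ := h.exists_of_commute hΞ hc (h.commute_mul_inv_e hc hB)
  exact ⟨r, s, m, k, by rw [← hmk, inv_mul_cancel_right₀ h.e_ne]⟩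

theorem eq_zero_of_decomp (hΞ : Ξ.IsProper) (hc : Ξ.IsCentral) (h : Ξ.IsQuatPair α e)
    {r s m k : Ξ.gen} (h0 : (r + s * α : K) + (m + k * α) * e = 0) :
    r = 0 ∧ s = 0 ∧ m = 0 ∧ k = 0 := by
  have hα : α ∉ Ξ.K₀ := fun h' => h.ne (Ξ.star_eq _ h')
  have hE : ∀ r s : Ξ.gen, (r + s * α : K) * α = α * (r + s * α) := by
    intro r s
    rw [add_mul, mul_add, hΞ.coe_comm hc r, ← mul_assoc α, ← hΞ.coe_comm hc s α]
  have hE' : ∀ r s : Ξ.gen, (r + s * α : K) * star α = star α * (r + s * α) := by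
    intro r s
    rw [add_mul, mul_add, hΞ.coe_comm hc r, ← mul_assoc (star α), ← hΞ.coe_comm hc s,
      mul_assoc, mul_assoc, hc.star_mul_self]
  obtain ⟨h₁, h₂⟩ := even_odd h.ne (hE r s)
    (by rw [mul_assoc, h.anti, ← mul_assoc, hE', mul_assoc]) h0
  have h₃ := (mul_eq_zero.1 h₂).resolve_right h.e_ne
  obtain ⟨rfl, rfl⟩ := hΞ.coe_add_coe_mul_eq_zero hc hα h₁
  obtain ⟨rfl, rfl⟩ := hΞ.coe_add_coe_mul_eq_zero hc hα h₃
  exact ⟨rfl, rfl, rfl, rfl⟩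

end IsQuatPair

/-- A quaternion pair identifies `K` with a quaternion algebra over any field that is isomorphic
to `K₀`. -/
theorem IsQuatPair.exists_equiv {α e : K} (hΞ : Ξ.IsProper) (hc : Ξ.IsCentral)
    (h : Ξ.IsQuatPair α e) {F : Type*} [Field F] (κ : F →+* K) (hκ : ∀ c, κ c ∈ Ξ.K₀)
    (hκs : ∀ u ∈ Ξ.K₀, ∃ c, κ c = u) {c₁ c₂ c₃ : F} (h₁ : κ c₁ = -(star α * α))
    (h₂ : κ c₂ = α + star α) (h₃ : κ c₃ = e * e) :
    ∃ g : ℍ[F, c₁, c₂, c₃] ≃+* K, (∀ x, g (star x) = star (g x)) ∧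
      ∀ x, g x = (κ x.re + κ x.imI * α) + (κ x.imJ + κ x.imK * α) * e := by
  let _ : Algebra F K := κ.toAlgebra' fun c x => hc _ (hκ c) x
  have hsm : ∀ (c : F) (x : K), c • x = κ c * x := fun c x => Algebra.smul_def c x
  let B : QuaternionAlgebra.Basis K c₁ c₂ c₃ :=
    { i := α
      j := e
      k := α * e
      i_mul_i := by rw [hsm, hsm, h₁, h₂, sq_eq_tr_nm (Ξ := Ξ) α, coe_tr, coe_nm]; noncomm_ring
      j_mul_j := by rw [hsm, h₃, mul_one]
      i_mul_j := rfl
      j_mul_i := by rw [hsm, h₂, h.anti]; noncomm_ring }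
  have hB : ∀ x, B.liftHom x = (κ x.re + κ x.imI * α) + (κ x.imJ + κ x.imK * α) * e := by
    intro x
    change B.lift x = _
    rw [QuaternionAlgebra.Basis.lift, hsm, hsm, hsm, add_mul, mul_assoc]
    change κ x.re + κ x.imI * α + κ x.imJ * e + κ x.imK * (α * e) = _
    abel
  have hinj : Function.Injective B.liftHom := by
    rw [injective_iff_map_eq_zero]
    intro x hx
    rw [hB] at hx
    obtain ⟨e₁, e₂, e₃, e₄⟩ := h.eq_zero_of_decomp hΞ hc (r := ⟨_, mem_gen (hκ x.re)⟩)
      (s := ⟨_, mem_gen (hκ x.imI)⟩) (m := ⟨_, mem_gen (hκ x.imJ)⟩)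
      (k := ⟨_, mem_gen (hκ x.imK)⟩) hx
    have hz : ∀ c, κ c = 0 → c = 0 := fun c => (map_eq_zero κ).1
    ext
    · exact hz _ (congrArg Subtype.val e₁)
    · exact hz _ (congrArg Subtype.val e₂)
    · exact hz _ (congrArg Subtype.val e₃)
    · exact hz _ (congrArg Subtype.val e₄)
  have hsurj : Function.Surjective B.liftHom := by
    intro y
    obtain ⟨r, s, m, k, rfl⟩ := h.exists_decomp hΞ hc y
    have hg : ∀ r : Ξ.gen, ∃ c, κ c = r := fun r => hκs _ ((hΞ.mem_gen_iff hc).1 r.2)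
    obtain ⟨r', hr⟩ := hg r
    obtain ⟨s', hs⟩ := hg s
    obtain ⟨m', hm⟩ := hg m
    obtain ⟨k', hk⟩ := hg k
    exact ⟨⟨r', s', m', k'⟩, by rw [hB]; simp only [hr, hs, hm, hk]⟩
  refine ⟨RingEquiv.ofBijective (B.liftHom : ℍ[F, c₁, c₂, c₃] →+* K) ⟨hinj, hsurj⟩,
    fun x => ?_, hB⟩
  change B.liftHom (star x) = star (B.liftHom x)
  have hst : ∀ c, star (κ c) = κ c := fun c => Ξ.star_eq _ (hκ c)
  have hcm : ∀ c y, κ c * y = y * κ c := fun c y => hc _ (hκ c) y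
  rw [hB, hB]
  simp only [QuaternionAlgebra.re_star, QuaternionAlgebra.imI_star, QuaternionAlgebra.imJ_star,
    QuaternionAlgebra.imK_star, map_add, map_mul, map_neg, h₂, star_add, star_mul, hst,
    h.star_e hc]
  have t₁ : e * (κ x.imK * star α) = κ x.imK * α * e := by
    rw [← mul_assoc, ← hcm, mul_assoc, h.e_star hc, mul_assoc]
  have t₂ : e * κ x.imJ = κ x.imJ * e := (hcm _ _).symm
  rw [← hcm x.imI, ← hcm x.imI, ← hcm x.imK, neg_mul e, mul_add e, t₁, t₂]
  noncomm_ring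

/-- The spaces of type (iv) are those with `K₀` central and `K` not commutative. -/
theorem IsProper.isTypeIV_iff (hΞ : Ξ.IsProper) :
    Ξ.IsTypeIV ↔ Ξ.IsCentral ∧ ∃ x y : K, x * y ≠ y * x := by
  constructor
  · rintro ⟨h₁, c₁, c₂, c₃, g, hg, -⟩
    refine ⟨fun u hu x => (Subring.mem_center_iff.1 ((h₁ u).1 hu) x).symm, ?_⟩
    by_contra! hcomm
    obtain ⟨x, hx⟩ := g.surjective ⟨0, 1, 0, 0⟩
    have := hg ⟨x, Subring.mem_center_iff.2 fun y => hcomm y x⟩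
    rw [hx] at this
    have h2 := congrArg QuaternionAlgebra.imI this
    exact one_ne_zero h2
  · rintro ⟨hc, hn⟩
    have hK : ∀ x, x ∈ Ξ.K₀ ↔ x ∈ Subring.center K := fun x => by
      rw [hΞ.mem_K₀_iff_center hc hn, Subring.mem_center_iff]
      exact forall_congr' fun y => eq_comm
    refine ⟨hK, ?_⟩
    obtain ⟨α, hα⟩ := hΞ.1
    obtain ⟨e, he⟩ := exists_quatPair hΞ hc hn hα
    obtain ⟨g, hg₁, hg₂⟩ := he.exists_equiv hΞ hc (Subring.center K).subtype
      (fun c => (hK _).2 c.2) (fun u hu => ⟨⟨u, (hK u).1 hu⟩, rfl⟩)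
      (c₁ := ⟨-(star α * α), neg_mem ((hK _).1 (star_mul_self_mem α))⟩)
      (c₂ := ⟨α + star α, (hK _).1 (Ξ.trace_mem α)⟩)
      (c₃ := ⟨e * e, by
        have := neg_mem (star_mul_self_mem (Ξ := Ξ) e)
        rw [he.star_e hc, neg_mul, neg_neg] at this
        exact (hK _).1 this⟩) rfl rfl rfl
    refine ⟨_, _, _, g.symm, fun c => ?_, fun x => ?_⟩
    · rw [RingEquiv.symm_apply_eq, hg₂]
      simp
    · rw [RingEquiv.symm_apply_eq, hg₁, RingEquiv.apply_symm_apply]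

theorem IsProper.isTypeIII_iff (hΞ : Ξ.IsProper) :
    Ξ.IsTypeIII ↔ Ξ.IsCentral ∧ ∀ x y : K, x * y = y * x := by
  constructor
  · rintro ⟨h, -, -⟩
    exact ⟨fun u _ x => h u x, h⟩
  · rintro ⟨hc, h⟩
    refine ⟨h, hΞ.1, fun x => ?_⟩
    rw [hΞ.mem_K₀_iff hc]
    exact ⟨fun h => h.1, fun h' => ⟨h', h x⟩⟩

/-- `E_a^⊥` in terms of an element `(a, α)` of `T`. -/
theorem IsProper.isPerp_iff (hΞ : Ξ.IsProper) (hc : Ξ.IsCentral) (p : Ξ.T)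
    (hp : star p.scal ≠ p.scal) {e : K} : Ξ.IsPerp p.vec e ↔ Ξ.IsQuatPair p.scal e := by
  constructor
  · rintro ⟨he, h⟩
    have h₁ := h 1 (Subring.one_mem _)
    have h₂ := h p.scal ((hΞ.mem_E_iff hc p).2 ⟨0, 1, by simp⟩)
    rw [star_one, one_mul, mul_one] at h₁
    rw [eq_neg_of_add_eq_zero_right h₁, neg_mul, ← sub_eq_add_neg, sub_eq_zero] at h₂
    exact ⟨hp, he, h₂.symm⟩
  · intro h
    refine ⟨h.e_ne, fun x hx => ?_⟩
    obtain ⟨r, s, rfl⟩ := (hΞ.mem_E_iff hc p).1 hx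
    rw [h.star_e hc, star_add, star_mul, hΞ.star_coe hc, hΞ.star_coe hc, ← hΞ.coe_comm hc s,
      add_mul, neg_mul, mul_add, mul_assoc, ← h.anti, ← mul_assoc, ← mul_assoc, hΞ.coe_comm hc s,
      hΞ.coe_comm hc r]
    abel

end PseudoQuadraticSpace

namespace PseudoQuadraticSpace

section

variable {K L : Type*} [DivisionRing K] [StarRing K] [AddCommGroup L] [Module Kᵐᵒᵖ L]
variable {Ξ : PseudoQuadraticSpace K L}

theorem T.vec_ne_zero_of_star_ne {p : Ξ.T} (h : star p.scal ≠ p.scal) : p.vec ≠ 0 := fun h' =>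
  h (Ξ.star_eq _ (p.vec_eq_zero_iff.1 h'))

theorem IsProper.coe_add_mul_mul (hΞ : Ξ.IsProper) (hc : Ξ.IsCentral) (α : K)
    (r s r' s' : Ξ.gen) : ((r : K) + s * α) * (r' + s' * α) =
      ((r * r' - s * s' * Ξ.nm α : Ξ.gen) : K) +
        ((r * s' + s * r' + s * s' * Ξ.tr α : Ξ.gen) : K) * α := by
  have h := sq_eq_tr_nm (Ξ := Ξ) α
  have e₁ : (s : K) * α * (s' * α) = s * s' * (α * α) := by
    rw [mul_assoc, ← mul_assoc α, ← hΞ.coe_comm hc s' α]; simp only [mul_assoc]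
  have e₂ : (s : K) * α * r' = s * r' * α := by
    rw [mul_assoc, ← hΞ.coe_comm hc r', ← mul_assoc]
  rw [add_mul, mul_add, mul_add, e₁, e₂, h]
  push_cast
  simp only [mul_sub, add_mul, mul_assoc]
  abel

theorem IsProper.coe_add_mul_star (hΞ : Ξ.IsProper) (hc : Ξ.IsCentral) (α : K)
    (r s : Ξ.gen) : star ((r : K) + s * α) =
      ((r + s * Ξ.tr α : Ξ.gen) : K) + ((-s : Ξ.gen) : K) * α := by
  rw [star_add, star_mul, hΞ.star_coe hc, hΞ.star_coe hc, ← hΞ.coe_comm hc,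
    star_eq_tr_sub (Ξ := Ξ)]
  push_cast
  noncomm_ring

/-- The conjugation properties of a quaternion pair. -/
theorem IsQuatPair.star_mul_mul (hc : Ξ.IsCentral) {α e : K} (h : Ξ.IsQuatPair α e) :
    star e * α * e = Ξ.nm e * star α := by
  rw [mul_assoc, ← h.e_star hc, ← mul_assoc, coe_nm]

theorem IsQuatPair.star_mul_star_mul {α e : K} (h : Ξ.IsQuatPair α e) :
    star e * star α * e = Ξ.nm e * α := by
  rw [mul_assoc, ← h.anti, ← mul_assoc, coe_nm]

theorem IsQuatPair.not_comm {α e : K} (h : Ξ.IsQuatPair α e) : e * α ≠ α * e := fun h' =>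
  h.ne (mul_right_cancel₀ h.e_ne (h.anti.symm.trans h'))

theorem IsQuatPair.huaVec_smul (hΞ : Ξ.IsProper) (hc : Ξ.IsCentral) {p : Ξ.T} {e : K}
    (h : Ξ.IsQuatPair p.scal e) : huaVec p (p.vec <• e) = p.vec <• (e * p.scal) := by
  have h0 := T.scal_ne_zero (T.vec_ne_zero_of_star_ne h.ne)
  rw [huaVec, Ξ.f_smul_right, hΞ.f_self, ← rs_mul, ← rs_sub]
  congr 2
  have e₁ : p.scal⁻¹ * ((p.scal - star p.scal) * e) * star p.scal =
      p.scal * e - star p.scal * e := by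
    rw [mul_assoc, mul_assoc, h.e_star hc, ← mul_assoc (p.scal - star p.scal), sub_mul,
      hc.star_mul_self, ← mul_sub, mul_assoc, inv_mul_cancel_left₀ h0, sub_mul]
  rw [e₁, h.e_star hc, sub_sub_cancel, h.anti]

theorem huaVec_of_f_eq_zero {p : Ξ.T} {b : L} (h : Ξ.f p.vec b = 0) :
    huaVec p b = b <• star p.scal := by
  rw [huaVec, h, mul_zero, zero_mul, rs_zero, sub_zero]

/-- If `K` is commutative, then `K = K₀ + K₀ t` for `t ∉ K₀`. -/
theorem IsProper.exists_add_mul_of_comm (hΞ : Ξ.IsProper) (hcomm : ∀ x y : K, x * y = y * x)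
    {t : K} (ht : t ∉ Ξ.K₀) (y : K) : ∃ r s : Ξ.gen, y = r + s * t := by
  have hc : Ξ.IsCentral := fun u _ x => hcomm u x
  have hmem : ∀ {x : K}, star x = x → x ∈ Ξ.K₀ := fun h => (hΞ.mem_K₀_iff hc).2 ⟨h, hcomm _⟩
  have hδ : t - star t ≠ 0 := fun h => ht (hmem (sub_eq_zero.1 h).symm)
  have hs : (y - star y) * (t - star t)⁻¹ ∈ Ξ.K₀ := hmem (by
    rw [star_mul, star_inv₀, star_sub, star_sub, star_star, star_star, ← neg_sub y, ← neg_sub t,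
      inv_neg, neg_mul_neg, hcomm])
  have hr : y - (y - star y) * (t - star t)⁻¹ * t ∈ Ξ.K₀ := hmem (by
    rw [star_sub, star_mul, Ξ.star_eq _ hs, hcomm (star t)]
    have : (y - star y) * (t - star t)⁻¹ * (t - star t) = y - star y := by
      rw [mul_assoc, inv_mul_cancel₀ hδ, mul_one]
    rw [mul_sub, sub_eq_sub_iff_add_eq_add] at this
    rw [sub_eq_sub_iff_add_eq_add, add_comm (star y), this])
  exact ⟨⟨_, mem_gen hr⟩, ⟨_, mem_gen hs⟩, by simp⟩

end

variable {K L K' L' : Type*} [DivisionRing K] [StarRing K] [AddCommGroup L] [Module Kᵐᵒᵖ L]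
  [DivisionRing K'] [StarRing K'] [AddCommGroup L'] [Module K'ᵐᵒᵖ L']
  {Ξ : PseudoQuadraticSpace K L} {Ξ' : PseudoQuadraticSpace K' L'}

namespace QuadIso

variable (Q : QuadIso Ξ Ξ')

/-- A semilinear `φ₁` comes from an isomorphism of pseudo-quadratic spaces. -/
theorem caseI_of_semilinear (ψ : K ≃+* K') (h : ∀ b x, Q.φ₁ (b <• x) = Q.φ₁ b <• ψ x) :
    CaseI Q.γ := by
  obtain ⟨a₀, ha₀⟩ := Q.proper.2.1
  have hg : ∀ r : Ξ.gen, ψ r = Q.φ r := fun r =>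
    rs_left_cancel (Q.φ₁_ne_zero ha₀) (by rw [← h, Q.map_smul])
  have hmem : ∀ x, ψ x ∈ Ξ'.K₀ → x ∈ Ξ.K₀ := by
    intro x hx
    rw [← Q.proper.mem_gen_iff Q.central]
    have : x = Q.symm.φ ⟨_, mem_gen hx⟩ := by
      apply ψ.injective
      rw [hg]
      exact (congrArg Subtype.val (Q.φ_symm_φ ⟨_, mem_gen hx⟩)).symm
    rw [this]
    exact Subtype.property _
  refine Q.toGroupIso.caseI ψ h (fun p => ?_) fun x => ?_
  · by_cases hp : p.vec = 0
    · rw [Q.scal_γ_of_vec_eq_zero p hp, ← hg]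
    · exact rs_left_cancel (Q.φ₁_ne_zero hp) (by rw [← h, Q.map_vec_scal])
  · by_cases hx : x ∈ Ξ.K₀
    · have := hg ⟨x, mem_gen hx⟩
      change ψ x = _ at this
      rw [Ξ.star_eq x hx, this, Q.star_coe']
    · have e₁ := congrArg ψ (sq_eq_tr_nm (Ξ := Ξ) x)
      rw [map_mul, map_sub, map_mul, hg, hg, sq_eq_tr_nm (Ξ := Ξ') (ψ x)] at e₁
      have e₂ : (((Q.φ (Ξ.nm x) - Ξ'.nm (ψ x) : Ξ'.gen) : K') +
          ((Ξ'.tr (ψ x) - Q.φ (Ξ.tr x) : Ξ'.gen) : K') * ψ x) = 0 := by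
        rw [AddSubgroupClass.coe_sub, AddSubgroupClass.coe_sub, sub_mul,
          ← sub_eq_zero.2 e₁]
        abel
      have e₃ := (Q.proper'.coe_add_coe_mul_eq_zero Q.central' (fun h => hx (hmem x h)) e₂).2
      rw [star_eq_tr_sub (Ξ := Ξ), map_sub, hg, ← sub_eq_zero.1 e₃, ← star_eq_tr_sub (Ξ := Ξ')]

theorem star_scal_ne {p : Ξ.T} (h : star p.scal ≠ p.scal) :
    star (Q.γ p).scal ≠ (Q.γ p).scal := by
  intro h'
  have h₁ := Q.map_vec_star_scal p
  rw [h', ← Q.map_vec_scal] at h₁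
  exact h (rs_left_cancel (T.vec_ne_zero_of_star_ne h) (Q.φ₁.injective h₁))

theorem map_vec_coe_add_mul (p : Ξ.T) (r s : Ξ.gen) :
    Q.φ₁ (p.vec <• ((r : K) + s * p.scal)) =
      Q.φ₁ p.vec <• ((Q.φ r : K') + Q.φ s * (Q.γ p).scal) := by
  rw [rs_add, map_add, Q.map_smul, Q.map_smul_mul' Q.central, Q.map_vec_scal, rs_add, ← rs_mul,
    Q.coe_comm']

variable {p : Ξ.T} {e : K}

theorem map_smul_anti_nm (he : Ξ.IsQuatPair p.scal e) :
    Q.φ₁ (p.vec <• (e * p.scal)) <• (Q.φ (Ξ.nm e) : K') =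
    Q.φ₁ (p.vec <• e) <• star (Q.γ (p.rsmul e)).scal := by
  have h := Q.map_vec_star_scal (p.rsmul e)
  rw [T.vec_rsmul, T.scal_rsmul, ← rs_mul, star_mul, star_mul, star_star, ← mul_assoc (star e),
    he.star_mul_star_mul, ← mul_assoc, ← Q.coe_comm, mul_assoc, Q.map_smul_mul' Q.central] at h
  exact h

theorem map_smul_anti (he : Ξ.IsQuatPair p.scal e) : Q.φ₁ (p.vec <• (e * p.scal)) =
    huaVec (Q.γ p) (Q.φ₁ (p.vec <• e)) := by
  rw [← Q.map_huaVec, he.huaVec_smul Q.proper Q.central]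

theorem nm_e_ne (he : Ξ.IsQuatPair p.scal e) : (Q.φ (Ξ.nm e) : K') ≠ 0 :=
  Q.φ_ne_zero (IsProper.nm_ne_zero _ he.e_ne)

/-- The behaviour of `φ₁` on `a K` if `φ₁(a e)` does not lie in `φ₁(a) K'`. -/
theorem of_not_mem_span (he : Ξ.IsQuatPair p.scal e)
    (hn : ∀ x' : K', Q.φ₁ (p.vec <• e) ≠ Q.φ₁ p.vec <• x') :
    Ξ'.f (Q.φ₁ p.vec) (Q.φ₁ (p.vec <• e)) = 0 ∧
    Q.φ₁ (p.vec <• (e * p.scal)) = Q.φ₁ (p.vec <• e) <• star (Q.γ p).scal ∧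
    (Q.γ (p.rsmul e)).scal = Q.φ (Ξ.nm e) * (Q.γ p).scal := by
  have h₁ := Q.map_smul_anti_nm he
  have h₂ := Q.map_smul_anti he
  have hp := T.vec_ne_zero_of_star_ne he.ne
  have h0 := Q.scal_ne_zero' (T.scal_ne_zero hp)
  rw [h₂, huaVec, sub_rs, ← rs_mul, Q.vec_γ] at h₁
  set c := Q.φ₁ (p.vec <• e)
  set N := (Q.φ (Ξ.nm e) : K') with hN
  set x := (Q.γ p).scal⁻¹ * Ξ'.f (Q.φ₁ p.vec) c * star (Q.γ p).scal with hx
  set d := star (Q.γ p).scal * N - star (Q.γ (p.rsmul e)).scal with hd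
  have h₃ : c <• d = Q.φ₁ p.vec <• (x * N) := by
    rw [hd, rs_sub, ← h₁, rs_mul _ x]; abel
  have hd0 : d = 0 := by
    by_contra hd0
    apply hn (x * N * d⁻¹)
    rw [rs_mul, ← h₃, ← rs_mul, mul_inv_cancel₀ hd0, rs_one]
  have hf : Ξ'.f (Q.φ₁ p.vec) c = 0 := by
    rw [hd0, rs_zero, eq_comm, rs_eq_zero] at h₃
    have h₄ := (mul_eq_zero.1 (h₃.resolve_left (Q.φ₁_ne_zero hp))).resolve_right (Q.nm_e_ne he)
    have h₅ := (mul_eq_zero.1 h₄).resolve_right (star_ne_zero.2 h0)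
    exact (mul_eq_zero.1 h₅).resolve_left (inv_ne_zero h0)
  refine ⟨hf, ?_, ?_⟩
  · rw [h₂, huaVec_of_f_eq_zero (by rw [Q.vec_γ]; exact hf)]
  · have := congrArg star (sub_eq_zero.1 hd0)
    rw [star_mul, star_star, star_star, Q.star_coe'] at this
    exact this.symm

theorem map_decomp (he : Ξ.IsQuatPair p.scal e)
    (hn : ∀ x' : K', Q.φ₁ (p.vec <• e) ≠ Q.φ₁ p.vec <• x') (r s m k : Ξ.gen) :
    Q.φ₁ (p.vec <• (((r : K) + s * p.scal) + (m + k * p.scal) * e)) =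
      Q.φ₁ p.vec <• ((Q.φ r : K') + Q.φ s * (Q.γ p).scal) +
      Q.φ₁ (p.vec <• e) <• ((Q.φ m : K') + Q.φ k * (Q.γ p).scal) := by
  obtain ⟨-, h₁, -⟩ := Q.of_not_mem_span he hn
  have h₂ : Q.φ₁ (p.vec <• (p.scal * e)) = Q.φ₁ (p.vec <• e) <• (Q.γ p).scal := by
    have e₁ : p.scal * e = Ξ.tr p.scal * e - e * p.scal := by
      rw [← he.e_star Q.central, star_eq_tr_sub (Ξ := Ξ), mul_sub, Q.coe_comm]
    rw [e₁, rs_sub, map_sub, h₁, Q.map_smul_mul' Q.central, Q.map_tr, ← rs_sub, coe_tr]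
    congr 2; abel
  rw [rs_add, map_add, Q.map_vec_coe_add_mul, add_mul, rs_add _ ((m : K) * e), map_add,
    Q.map_smul_mul' Q.central,
    mul_assoc, Q.map_smul_mul' Q.central, h₂, rs_add _ (Q.φ m : K'), ← rs_mul _ _ (Q.φ k : K'),
    Q.coe_comm' (Q.φ k)]

/-- If `φ₁(a e)` does not lie in `φ₁(a) K'`, then these two vectors span `L'`. -/
theorem exists_eq_add_of_not_mem_span (he : Ξ.IsQuatPair p.scal e)
    (hn : ∀ x' : K', Q.φ₁ (p.vec <• e) ≠ Q.φ₁ p.vec <• x')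
    (v : L') : ∃ x y : K', v = Q.φ₁ p.vec <• x + Q.φ₁ (p.vec <• e) <• y := by
  obtain ⟨hf, h₁, h₂⟩ := Q.of_not_mem_span he hn
  have hp := T.vec_ne_zero_of_star_ne he.ne
  have hne := Q.star_scal_ne he.ne
  have hfa : Ξ'.f (Q.φ₁ p.vec) (Q.φ₁ p.vec) = (Q.γ p).scal - star (Q.γ p).scal := by
    rw [← Q.proper'.f_self, Q.vec_γ]
  have hfa0 : Ξ'.f (Q.φ₁ p.vec) (Q.φ₁ p.vec) ≠ 0 := by rw [hfa]; exact sub_ne_zero.2 hne.symm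
  have hfc0 : Ξ'.f (Q.φ₁ (p.vec <• e)) (Q.φ₁ (p.vec <• e)) ≠ 0 := by
    have := Q.proper'.f_self (Q.γ (p.rsmul e))
    rw [Q.vec_γ, T.vec_rsmul] at this
    rw [this, h₂, star_mul, Q.star_coe', ← Q.coe_comm', ← mul_sub]
    exact mul_ne_zero (Q.nm_e_ne he) (sub_ne_zero.2 hne.symm)
  set a' := Q.φ₁ p.vec with ha'
  set c := Q.φ₁ (p.vec <• e) with hc
  set x := (Ξ'.f a' a')⁻¹ * Ξ'.f a' v with hx
  set y := (Ξ'.f c c)⁻¹ * Ξ'.f c v with hy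
  refine ⟨x, y, sub_eq_zero.1 ?_⟩
  by_contra hd
  set d' := v - (a' <• x + c <• y) with hd'
  have hda : Ξ'.f a' d' = 0 := by
    rw [hd', f_sub_right, Ξ'.f_add_right, Ξ'.f_smul_right, Ξ'.f_smul_right, hf, zero_mul,
      add_zero, hx, mul_inv_cancel_left₀ hfa0, sub_self]
  have hdc : Ξ'.f c d' = 0 := by
    rw [hd', f_sub_right, Ξ'.f_add_right, Ξ'.f_smul_right, Ξ'.f_smul_right, f_eq_zero_symm hf,
      zero_mul, zero_add, hy, mul_inv_cancel_left₀ hfc0, sub_self]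
  obtain ⟨d, hdd⟩ := Q.φ₁.surjective d'
  have hd0 : d ≠ 0 := fun h => hd (by rw [← hdd, h, map_zero])
  have hfd : Ξ.f p.vec d = 0 := by
    apply f_eq_zero_symm
    refine Q.proper.eq_zero_of_forall_trace fun t => ?_
    rw [← Ξ.f_smul_right, ← coe_tr (Ξ := Ξ)]
    obtain ⟨r, s, m, k, rfl⟩ := he.exists_decomp Q.proper Q.central t
    have h := Q.map_tr_f d (p.vec <• (((r : K) + s * p.scal) + (m + k * p.scal) * e))
    rw [Q.map_decomp he hn, hdd, Ξ'.f_add_right, Ξ'.f_smul_right, Ξ'.f_smul_right,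
      f_eq_zero_symm hda, f_eq_zero_symm hdc, zero_mul, zero_mul, add_zero, star_zero,
      add_zero] at h
    have h' := (map_eq_zero_iff _ Q.φ.injective).1 (Subtype.ext h)
    rw [h']; rfl
  have h₃ := Q.map_huaVec p d
  rw [huaVec_of_f_eq_zero hfd, hdd, huaVec_of_f_eq_zero (by rw [Q.vec_γ]; exact hda)] at h₃
  have h₄ := Q.map_huaVec (p.rsmul e) d
  rw [huaVec_of_f_eq_zero (by rw [T.vec_rsmul, Ξ.f_smul_left, hfd, mul_zero]), hdd,
    huaVec_of_f_eq_zero (by rw [Q.vec_γ]; exact hdc), T.scal_rsmul, h₂, star_mul, star_mul,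
    star_star, ← mul_assoc, he.star_mul_star_mul, Q.map_smul_mul' Q.central, star_mul, Q.star_coe',
    rs_mul d'] at h₄
  have h₅ := rs_right_cancel (Q.nm_e_ne he) h₄
  rw [← h₃] at h₅
  exact he.ne (rs_left_cancel hd0 (Q.φ₁.injective h₅)).symm

/-- If `φ₁(a e)` does not lie in `φ₁(a) K'`, then no isomorphism `K → K'` extends `φ`. -/
theorem not_exists_ringEquiv (he : Ξ.IsQuatPair p.scal e)
    (hn : ∀ x' : K', Q.φ₁ (p.vec <• e) ≠ Q.φ₁ p.vec <• x')
    (g : K ≃+* K') : ¬ ∀ r : Ξ.gen, g r = Q.φ r := by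
  intro hg
  obtain ⟨hf, h₁, h₂⟩ := Q.of_not_mem_span he hn
  have hn' : ∃ x y : K', x * y ≠ y * x := ⟨g e, g p.scal, fun h => he.not_comm (by
    apply g.injective; rw [map_mul, map_mul, h])⟩
  have hp := T.vec_ne_zero_of_star_ne he.ne
  set α' := (Q.γ p).scal with hα'
  have hα'0 : α' ∉ Ξ'.K₀ := T.scal_not_mem (by rw [Q.vec_γ]; exact Q.φ₁_ne_zero hp)
  have htr : g p.scal + g (star p.scal) = Ξ'.tr α' := by
    rw [← map_add, ← Q.map_tr, ← hg, coe_tr]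
  have hnm : g (star p.scal) * g p.scal = Ξ'.nm α' := by
    rw [← map_mul, ← Q.map_nm, ← hg, coe_nm]
  have hx : ∃ x, x ≠ 0 ∧ α' * x = x * g p.scal := by
    have key : ∀ y, α' * (α' * y - y * g (star p.scal)) =
        (α' * y - y * g (star p.scal)) * g p.scal := by
      intro y
      have e₁ : g p.scal = Ξ'.tr α' - g (star p.scal) := by rw [← htr]; abel
      rw [sub_mul, mul_assoc y, hnm, e₁, mul_sub, ← mul_assoc, sq_eq_tr_nm (Ξ := Ξ') α',
        mul_sub (α' * y), ← Q.coe_comm', ← Q.coe_comm', sub_mul]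
      noncomm_ring
    by_contra! h
    have h0 : ∀ y, α' * y - y * g (star p.scal) = 0 := fun y => by
      by_contra hy
      exact h _ hy (key y)
    have h1 := h0 1
    rw [mul_one, one_mul] at h1
    apply hα'0
    rw [Q.proper'.mem_K₀_iff_center Q.central' hn']
    intro y
    have := h0 y
    rw [← sub_eq_zero.1 h1] at this
    exact sub_eq_zero.1 this
  obtain ⟨x, hx0, hx⟩ := hx
  have hxs : star α' * x = x * g (star p.scal) := by
    rw [star_eq_tr_sub (Ξ := Ξ'), sub_mul, hx, Q.coe_comm', ← htr]; noncomm_ring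
  set e' := x * g e * x⁻¹ with he'
  have hq : Ξ'.IsQuatPair α' e' := by
    refine ⟨Q.star_scal_ne he.ne, ?_, ?_⟩
    · exact mul_ne_zero (mul_ne_zero hx0 (by simpa using he.e_ne)) (inv_ne_zero hx0)
    · have e₁ : x⁻¹ * α' = g p.scal * x⁻¹ := by
        rw [inv_mul_eq_iff_eq_mul₀ hx0, ← mul_assoc, ← hx, mul_inv_cancel_right₀ hx0]
      rw [he', mul_assoc, e₁, ← mul_assoc, mul_assoc x, ← map_mul, he.anti, map_mul, ← mul_assoc,
        ← mul_assoc, ← mul_assoc, hxs]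
  have hN : Ξ'.nm e' = Q.φ (Ξ.nm e) := by
    apply Subtype.ext
    rw [← hg, coe_nm, coe_nm, hq.star_e Q.central', he.star_e Q.central, neg_mul, neg_mul, map_neg,
      neg_inj]
    have e₁ : g (e * e) = -Q.φ (Ξ.nm e) := by
      rw [← hg, coe_nm, he.star_e Q.central, neg_mul, map_neg, neg_neg]
    have e₂ : e' * e' = x * g (e * e) * x⁻¹ := by
      rw [he', map_mul]; simp only [mul_assoc]; rw [inv_mul_cancel_left₀ hx0]
    rw [e₂, e₁, mul_neg, neg_mul, ← Q.coe_comm', mul_inv_cancel_right₀ hx0]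
  have hz : ((Q.γ p).rsmul e' * Q.γ (p.rsmul e)).vec = 0 := by
    rw [T.vec_eq_zero_iff, T.scal_mul, T.scal_rsmul, h₂, Q.vec_γ, T.vec_rsmul, T.vec_rsmul,
      Ξ'.f_smul_right, Q.vec_γ, f_eq_zero_symm hf, zero_mul, add_zero, hq.star_mul_mul Q.central',
      hN, ← mul_add, add_comm, ← Q.proper'.mem_gen_iff Q.central']
    exact mul_mem (Subtype.property _) (Ξ'.tr α').2
  rw [T.vec_mul, Q.vec_γ, T.vec_rsmul, T.vec_rsmul, Q.vec_γ] at hz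
  apply hn (-e')
  rw [rs_neg, eq_neg_of_add_eq_zero_right hz]

end QuadIso

end PseudoQuadraticSpace

namespace PseudoQuadraticSpace

variable {K L K' L' : Type*} [DivisionRing K] [StarRing K] [AddCommGroup L] [Module Kᵐᵒᵖ L]
  [DivisionRing K'] [StarRing K'] [AddCommGroup L'] [Module K'ᵐᵒᵖ L']
  {Ξ : PseudoQuadraticSpace K L} {Ξ' : PseudoQuadraticSpace K' L'}

/-- The elements of the centre of `K`, as elements of the subring generated by `K₀`. -/
def centerToGen (h : ∀ z ∈ Subring.center K, z ∈ Ξ.K₀) : Subring.center K →+* Ξ.gen :=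
  Subring.inclusion fun z hz => mem_gen (h z hz)

theorem IsProper.mem_K₀_iff_mem_center (hΞ : Ξ.IsProper) (hc : Ξ.IsCentral)
    (hn : ∃ x y : K, x * y ≠ y * x) {z : K} : z ∈ Ξ.K₀ ↔ z ∈ Subring.center K := by
  rw [hΞ.mem_K₀_iff_center hc hn, Subring.mem_center_iff]
  exact forall_congr' fun y => eq_comm

/-- Two quaternion pairs with the same invariants give rise to an isomorphism of skew-fields. -/
theorem IsQuatPair.exists_ringEquiv {α e : K} (hΞ : Ξ.IsProper) (hc : Ξ.IsCentral)
    (hΞ' : Ξ'.IsProper) (hc' : Ξ'.IsCentral) (h : Ξ.IsQuatPair α e) {α' e' : K'}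
    (h' : Ξ'.IsQuatPair α' e') (φ : Ξ.gen ≃+* Ξ'.gen) (htr : φ (Ξ.tr α) = Ξ'.tr α')
    (hnm : φ (Ξ.nm α) = Ξ'.nm α') (hnm' : φ (Ξ.nm e) = Ξ'.nm e') :
    ∃ ψ : K ≃+* K', (∀ x, ψ (star x) = star (ψ x)) ∧ ∀ r s m k : Ξ.gen,
      ψ ((r + s * α) + (m + k * α) * e) = ((φ r : K') + φ s * α') + (φ m + φ k * α') * e' := by
  have hcen : ∀ {z}, z ∈ Ξ.K₀ ↔ z ∈ Subring.center K :=
    hΞ.mem_K₀_iff_mem_center hc ⟨e, α, h.not_comm⟩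
  have hgen : ∀ r : Ξ.gen, (r : K) ∈ Subring.center K := fun r =>
    hcen.1 ((hΞ.mem_gen_iff hc).1 r.2)
  let κ' : Subring.center K →+* K' := Ξ'.gen.subtype.comp
    ((φ : Ξ.gen →+* Ξ'.gen).comp (centerToGen fun z hz => hcen.2 hz))
  have hκ' : ∀ r : Ξ.gen, κ' ⟨r, hgen r⟩ = φ r := fun r => rfl
  have hee : e * e = -Ξ.nm e := by rw [coe_nm, h.star_e hc, neg_mul, neg_neg]
  have hee' : e' * e' = -Ξ'.nm e' := by rw [coe_nm, h'.star_e hc', neg_mul, neg_neg]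
  obtain ⟨g, hg₁, hg₂⟩ := h.exists_equiv hΞ hc (Subring.center K).subtype
    (fun c => hcen.2 c.2) (fun u hu => ⟨⟨u, hcen.1 hu⟩, rfl⟩)
    (c₁ := -⟨_, hgen (Ξ.nm α)⟩) (c₂ := ⟨_, hgen (Ξ.tr α)⟩) (c₃ := -⟨_, hgen (Ξ.nm e)⟩)
    (by simp) (by simp) (by rw [hee]; simp)
  obtain ⟨g', hg'₁, hg'₂⟩ := h'.exists_equiv hΞ' hc' κ'
    (fun c => (hΞ'.mem_gen_iff hc').1 (Subtype.property _)) (fun u hu => by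
      obtain ⟨r, hr⟩ := φ.surjective ⟨u, mem_gen hu⟩
      exact ⟨⟨r, hgen r⟩, by rw [hκ', hr]⟩)
    (c₁ := -⟨_, hgen (Ξ.nm α)⟩) (c₂ := ⟨_, hgen (Ξ.tr α)⟩) (c₃ := -⟨_, hgen (Ξ.nm e)⟩)
    (by rw [map_neg, hκ', hnm, coe_nm]) (by rw [hκ', htr, coe_tr])
    (by rw [map_neg, hκ', hnm', hee'])
  refine ⟨g.symm.trans g', fun x => ?_, fun r s m k => ?_⟩
  · obtain ⟨y, rfl⟩ := g.surjective x
    rw [← hg₁, RingEquiv.trans_apply, RingEquiv.trans_apply, RingEquiv.symm_apply_apply,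
      RingEquiv.symm_apply_apply, hg'₁]
  · have : (r + s * α : K) + (m + k * α) * e =
        g ⟨⟨r, hgen r⟩, ⟨s, hgen s⟩, ⟨m, hgen m⟩, ⟨k, hgen k⟩⟩ := by
      rw [hg₂]; rfl
    rw [this, RingEquiv.trans_apply, RingEquiv.symm_apply_apply, hg'₂]
    simp only [hκ']

namespace QuadIso

variable (Q : QuadIso Ξ Ξ')

/-- If `φ₁(a e)` lies in `φ₁(a) K'`, then `γ` is induced by an isomorphism of pseudo-quadratic
spaces. -/
theorem caseI_of_mem_span {p : Ξ.T} {e : K} (he : Ξ.IsQuatPair p.scal e) {e' : K'}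
    (h : Q.φ₁ (p.vec <• e) = Q.φ₁ p.vec <• e') : CaseI Q.γ := by
  have hp := T.vec_ne_zero_of_star_ne he.ne
  have hp' := Q.φ₁_ne_zero hp
  have hne := Q.star_scal_ne he.ne
  set α := p.scal with hα
  set α' := (Q.γ p).scal with hα'
  have hfa : Ξ.f p.vec p.vec = α - star α := Q.proper.f_self p
  have hfa' : Ξ'.f (Q.φ₁ p.vec) (Q.φ₁ p.vec) = α' - star α' := by
    rw [← Q.vec_γ]; exact Q.proper'.f_self (Q.γ p)
  have hδ : α - star α ≠ 0 := sub_ne_zero.2 he.ne.symm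
  have hδ' : α' - star α' ≠ 0 := sub_ne_zero.2 hne.symm
  have he0 : e' ≠ 0 := by
    rintro rfl
    rw [rs_zero] at h
    exact Q.φ₁_ne_zero (fun h0 => (rs_eq_zero.1 h0).elim hp he.e_ne) h
  -- the trace form shows that `e'` anticommutes with `α'`
  have ht₁ : (α' - star α') * e' = star e' * (α' - star α') := by
    have h₁ := Q.map_tr_f p.vec (p.vec <• e)
    rw [h, Ξ.f_smul_right, Ξ'.f_smul_right, hfa, hfa'] at h₁
    have h₂ : Ξ.tr ((α - star α) * e) = 0 := Subtype.ext (by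
      rw [coe_tr, star_mul, star_sub, star_star, he.star_e Q.central, neg_mul, mul_sub, sub_mul,
        he.anti, he.e_star Q.central, ZeroMemClass.coe_zero]
      abel)
    rw [h₂, map_zero, ZeroMemClass.coe_zero, star_mul, star_sub, star_star] at h₁
    rw [← sub_eq_zero, eq_comm, h₁]
    noncomm_ring
  have ht₂ : star α' * (α' - star α') * e' = star e' * (α' - star α') * α' := by
    have h₁ := Q.map_tr_f (p.vec <• α) (p.vec <• e)
    rw [h, Q.map_vec_scal, Ξ.f_smul_right, Ξ'.f_smul_right, Ξ.f_smul_left, Ξ'.f_smul_left,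
      hfa, hfa'] at h₁
    have h₂ : Ξ.tr (star α * (α - star α) * e) = 0 := Subtype.ext (by
      have e₁ : e * ((star α - α) * α) = (α - star α) * star α * e := by
        rw [← mul_assoc, mul_sub, he.anti, he.e_star Q.central, sub_mul, mul_assoc, mul_assoc,
          he.anti, sub_mul, sub_mul]
        simp only [mul_assoc]
      rw [coe_tr, star_mul, star_mul, star_sub, star_star, he.star_e Q.central, neg_mul,
        e₁, mul_sub, sub_mul α, Q.central.star_mul_self, sub_mul, ZeroMemClass.coe_zero]
      abel)
    rw [h₂, map_zero, ZeroMemClass.coe_zero, star_mul, star_mul, star_sub, star_star,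
      ← hα'] at h₁
    rw [← sub_eq_zero, eq_comm, h₁]
    noncomm_ring
  have he' : Ξ'.IsQuatPair α' e' := by
    refine ⟨hne, he0, mul_left_cancel₀ hδ' ?_⟩
    rw [← mul_assoc, ht₁, ← ht₂, mul_sub, Q.central'.star_mul_self, ← sub_mul, mul_assoc]
  have h₁ : Q.φ₁ (p.vec <• (e * α)) = Q.φ₁ p.vec <• (e' * α') := by
    rw [Q.map_smul_anti he, h, ← Q.vec_γ, he'.huaVec_smul Q.proper' Q.central']
  have hN : Q.φ (Ξ.nm e) = Ξ'.nm e' := by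
    have h₂ := Q.map_smul_anti_nm he
    rw [h₁, h, ← rs_mul, ← rs_mul, mul_assoc] at h₂
    have h₃ := congrArg star (mul_left_cancel₀ he0 (rs_left_cancel hp' h₂))
    rw [star_star, star_mul, Q.star_coe'] at h₃
    have h₄ := sub_mem (Q.γ_mem (p.rsmul e)) ((Q.γ p).rsmul e').mem
    rw [T.vec_rsmul, T.vec_rsmul, h, Q.vec_γ, ← h₃, T.scal_rsmul, he'.star_mul_mul Q.central',
      sub_sub_sub_cancel_left, ← sub_mul] at h₄
    by_contra hne'
    have h₅ : (Ξ'.nm e' - Q.φ (Ξ.nm e) : K') ≠ 0 :=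
      sub_ne_zero.2 fun h => hne' (Subtype.ext h.symm)
    have h₆ := mul_mem (inv_mem_gen (sub_mem (Ξ'.nm e').2 (Q.φ (Ξ.nm e)).2)) (mem_gen h₄)
    rw [inv_mul_cancel_left₀ h₅, Q.proper'.mem_gen_iff Q.central'] at h₆
    apply hne
    have := Ξ'.star_eq _ h₆
    rw [star_star] at this
    exact this.symm
  obtain ⟨ψ, hψs, hψ⟩ := he.exists_ringEquiv Q.proper Q.central Q.proper' Q.central' he' Q.φ
    (Q.map_tr p) (Q.map_nm p) hN
  have hψr : ∀ r : Ξ.gen, ψ r = Q.φ r := fun r => by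
    have := hψ r 0 0 0
    simpa using this
  have hψα : ψ α = α' := by
    have := hψ 0 1 0 0
    simpa using this
  have hψe : ψ e = e' := by
    have := hψ 0 0 1 0
    simpa using this
  have hax : ∀ x, Q.φ₁ (p.vec <• x) = Q.φ₁ p.vec <• ψ x := by
    intro x
    obtain ⟨r, s, m, k, rfl⟩ := he.exists_decomp Q.proper Q.central x
    have e₁ : Q.φ₁ (p.vec <• (α * e)) = Q.φ₁ p.vec <• (α' * e') := by
      have t : α * e = Ξ.tr α * e - e * α := by
        rw [← he.e_star Q.central, star_eq_tr_sub (Ξ := Ξ), mul_sub, Q.coe_comm]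
      rw [t, rs_sub, map_sub, Q.map_smul_mul' Q.central, h, h₁, Q.map_tr, ← rs_mul, ← rs_sub,
        ← mul_sub, ← star_eq_tr_sub (Ξ := Ξ'), he'.e_star Q.central']
    rw [hψ, rs_add, map_add, Q.map_vec_coe_add_mul, add_mul, rs_add _ ((m : K) * e), map_add,
      Q.map_smul_mul' Q.central, mul_assoc, Q.map_smul_mul' Q.central, e₁, h, add_mul,
      rs_add _ ((Q.φ r : K') + _), rs_add _ ((Q.φ m : K') * e'), ← rs_mul, ← rs_mul,
      mul_assoc (Q.φ k : K'), Q.coe_comm' (Q.φ k), Q.coe_comm' (Q.φ m)]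
  -- the vectors orthogonal to `a`
  have hS : ∀ y : K, ∀ b, Ξ.f p.vec b = 0 → Q.φ₁ (b <• y) = Q.φ₁ b <• ψ y := by
    have hadd : ∀ y z : K, (∀ b, Ξ.f p.vec b = 0 → Q.φ₁ (b <• y) = Q.φ₁ b <• ψ y) →
        (∀ b, Ξ.f p.vec b = 0 → Q.φ₁ (b <• z) = Q.φ₁ b <• ψ z) →
        ∀ b, Ξ.f p.vec b = 0 → Q.φ₁ (b <• (y + z)) = Q.φ₁ b <• ψ (y + z) := by
      intro y z hy hz b hb
      rw [rs_add, map_add, hy b hb, hz b hb, map_add, rs_add]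
    have hsub : ∀ y z : K, (∀ b, Ξ.f p.vec b = 0 → Q.φ₁ (b <• y) = Q.φ₁ b <• ψ y) →
        (∀ b, Ξ.f p.vec b = 0 → Q.φ₁ (b <• z) = Q.φ₁ b <• ψ z) →
        ∀ b, Ξ.f p.vec b = 0 → Q.φ₁ (b <• (y - z)) = Q.φ₁ b <• ψ (y - z) := by
      intro y z hy hz b hb
      rw [rs_sub, map_sub, hy b hb, hz b hb, map_sub, rs_sub]
    have hmul : ∀ y z : K, (∀ b, Ξ.f p.vec b = 0 → Q.φ₁ (b <• y) = Q.φ₁ b <• ψ y) →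
        (∀ b, Ξ.f p.vec b = 0 → Q.φ₁ (b <• z) = Q.φ₁ b <• ψ z) →
        ∀ b, Ξ.f p.vec b = 0 → Q.φ₁ (b <• (y * z)) = Q.φ₁ b <• ψ (y * z) := by
      intro y z hy hz b hb
      rw [rs_mul, hz _ (by rw [Ξ.f_smul_right, hb, zero_mul]), hy b hb, map_mul, rs_mul]
    have hgen : ∀ (r : Ξ.gen) b, Ξ.f p.vec b = 0 → Q.φ₁ (b <• (r : K)) = Q.φ₁ b <• ψ (r : K) := by
      intro r b _
      rw [hψr, Q.map_smul]
    have hinv : ∀ y : K, y ≠ 0 → (∀ b, Ξ.f p.vec b = 0 → Q.φ₁ (b <• y) = Q.φ₁ b <• ψ y) →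
        ∀ b, Ξ.f p.vec b = 0 → Q.φ₁ (b <• y⁻¹) = Q.φ₁ b <• ψ y⁻¹ := by
      intro y hy0 hy b hb
      have hy0' : ψ y ≠ 0 := by simpa using hy0
      refine rs_right_cancel hy0' ?_
      rw [← hy _ (by rw [Ξ.f_smul_right, hb, zero_mul]), ← rs_mul, ← rs_mul, inv_mul_cancel₀ hy0,
        ← map_mul, inv_mul_cancel₀ hy0, map_one, rs_one, rs_one]
    have hhua : ∀ x : K, ∀ b, Ξ.f p.vec b = 0 → Q.φ₁ (b <• (star x * star α * x)) =
        Q.φ₁ b <• ψ (star x * star α * x) := by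
      intro x b hb
      rcases eq_or_ne x 0 with rfl | hx
      · simp
      have hsc : (Q.γ (p.rsmul x)).scal = ψ (star x * α * x) := by
        have h₂ := Q.map_vec_scal (p.rsmul x)
        rw [T.vec_rsmul, ← rs_mul, hax, hax, T.scal_rsmul, map_mul, rs_mul] at h₂
        refine (rs_left_cancel ?_ h₂).symm
        exact fun h0 => (rs_eq_zero.1 h0).elim hp' (by simpa using hx)
      have hv : (Q.γ (p.rsmul x)).vec = Q.φ₁ p.vec <• ψ x := by rw [Q.vec_γ, T.vec_rsmul, hax]
      have hb' : Ξ'.f (Q.φ₁ p.vec) (Q.φ₁ b) = 0 := by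
        apply f_eq_zero_symm
        refine Q.proper'.eq_zero_of_forall_trace fun t => ?_
        obtain ⟨t, rfl⟩ := ψ.surjective t
        rw [← Ξ'.f_smul_right, ← hax, ← Q.map_tr_f, Ξ.f_smul_right, f_eq_zero_symm hb, zero_mul]
        have : Ξ.tr 0 = 0 := Subtype.ext (by simp)
        rw [this, map_zero]; rfl
      have h₂ := Q.map_huaVec (p.rsmul x) b
      rw [huaVec_of_f_eq_zero (by rw [T.vec_rsmul, Ξ.f_smul_left, hb, mul_zero]),
        huaVec_of_f_eq_zero (by rw [hv, Ξ'.f_smul_left, hb', mul_zero]), hsc, ← hψs,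
        T.scal_rsmul] at h₂
      simpa only [star_mul, star_star, mul_assoc] using h₂
    have hαs := hhua 1
    rw [star_one, one_mul, mul_one] at hαs
    have hαS : ∀ b, Ξ.f p.vec b = 0 → Q.φ₁ (b <• α) = Q.φ₁ b <• ψ α := by
      have := hsub _ _ (hgen (Ξ.tr α)) hαs
      rwa [coe_tr, add_sub_cancel_right] at this
    have hδe : ∀ b, Ξ.f p.vec b = 0 → Q.φ₁ (b <• ((α - star α) * e)) =
        Q.φ₁ b <• ψ ((α - star α) * e) := by
      have h₂ := hhua (1 + e)
      have e₁ : (α - star α) * e = star α + Ξ.nm e * α - star (1 + e) * star α * (1 + e) := by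
        rw [← he.star_mul_star_mul, star_add, star_one, he.star_e Q.central, add_mul, add_mul,
          mul_add, mul_add, neg_mul, he.e_star Q.central, one_mul, mul_one, mul_one, sub_mul]
        abel
      rw [e₁]
      exact hsub _ _ (hadd _ _ hαs (hmul _ _ (hgen _) hαS)) h₂
    have heS : ∀ b, Ξ.f p.vec b = 0 → Q.φ₁ (b <• e) = Q.φ₁ b <• ψ e := by
      have := hmul _ _ (hinv _ hδ (hsub _ _ hαS hαs)) hδe
      rwa [inv_mul_cancel_left₀ hδ] at this
    intro y
    obtain ⟨r, s, m, k, rfl⟩ := he.exists_decomp Q.proper Q.central y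
    exact hadd _ _ (hadd _ _ (hgen r) (hmul _ _ (hgen s) hαS))
      (hmul _ _ (hadd _ _ (hgen m) (hmul _ _ (hgen k) hαS)) heS)
  refine Q.caseI_of_semilinear ψ fun b x => ?_
  set y := (α - star α)⁻¹ * Ξ.f p.vec b with hy
  have hb : b = p.vec <• y + (b - p.vec <• y) := by abel
  have hb₀ : Ξ.f p.vec (b - p.vec <• y) = 0 := by
    rw [f_sub_right, Ξ.f_smul_right, hfa, hy, mul_inv_cancel_left₀ hδ, sub_self]
  rw [hb, add_rs, map_add, map_add, add_rs, hS x _ hb₀, ← rs_mul, hax, hax, map_mul, rs_mul]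

/-- The isomorphism of fields `E_a → K'` if `K'` is commutative. -/
theorem exists_E_equiv (hcomm : ∀ x y : K', x * y = y * x) (p : Ξ.T) (hp : p.vec ≠ 0) :
    ∃ θ : Ξ.E p.vec ≃+* K', (∀ x : Ξ.E p.vec, Q.φ₁ (p.vec <• (x : K)) = Q.φ₁ p.vec <• θ x) ∧
      ∀ r s : Ξ.gen, ∀ x : Ξ.E p.vec, (x : K) = r + s * p.scal →
        θ x = (Q.φ r : K') + Q.φ s * (Q.γ p).scal := by
  have hp' := Q.φ₁_ne_zero hp
  have hex : ∀ x : Ξ.E p.vec, ∃ y : K', Q.φ₁ (p.vec <• (x : K)) = Q.φ₁ p.vec <• y := by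
    rintro ⟨x, hx⟩
    obtain ⟨r, s, rfl⟩ := (Q.proper.mem_E_iff Q.central p).1 hx
    exact ⟨_, Q.map_vec_coe_add_mul p r s⟩
  choose θ hθ using hex
  have hθ' : ∀ r s : Ξ.gen, ∀ x : Ξ.E p.vec, (x : K) = r + s * p.scal →
      θ x = (Q.φ r : K') + Q.φ s * (Q.γ p).scal := by
    intro r s x hx
    refine rs_left_cancel hp' ?_
    rw [← hθ, hx, Q.map_vec_coe_add_mul]
  let θh : Ξ.E p.vec →+* K' :=
    { toFun := θ
      map_one' := by rw [hθ' 1 0 1 (by simp)]; simp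
      map_zero' := by rw [hθ' 0 0 0 (by simp)]; simp
      map_add' := fun x y => rs_left_cancel hp' (by
        rw [← hθ, rs_add, ← hθ, ← hθ, ← map_add, ← rs_add]; rfl)
      map_mul' := fun x y => by
        obtain ⟨r, s, hx⟩ := (Q.proper.mem_E_iff Q.central p).1 x.2
        obtain ⟨r', s', hy⟩ := (Q.proper.mem_E_iff Q.central p).1 y.2
        have hxy := Q.proper.coe_add_mul_mul Q.central p.scal r s r' s'
        rw [← hx, ← hy] at hxy
        rw [hθ' _ _ _ hxy, hθ' _ _ _ hx, hθ' _ _ _ hy,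
          Q.proper'.coe_add_mul_mul Q.central']
        simp only [map_add, map_sub, map_mul, Q.map_tr, Q.map_nm] }
  refine ⟨RingEquiv.ofBijective θh ⟨fun x y hxy => ?_, fun y => ?_⟩, hθ, hθ'⟩
  · have hxy' : θ x = θ y := hxy
    have h := hθ x
    rw [hxy', ← hθ] at h
    exact Subtype.ext (rs_left_cancel hp (Q.φ₁.injective h))
  · have hα' : (Q.γ p).scal ∉ Ξ'.K₀ := T.scal_not_mem (by rwa [Q.vec_γ])
    obtain ⟨r, s, rfl⟩ := Q.proper'.exists_add_mul_of_comm hcomm hα' y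
    obtain ⟨r, rfl⟩ := Q.φ.surjective r
    obtain ⟨s, rfl⟩ := Q.φ.surjective s
    exact ⟨⟨_, (Q.proper.mem_E_iff Q.central p).2 ⟨r, s, rfl⟩⟩, hθ' r s _ rfl⟩

/-- If both skew-fields are commutative, then `γ` is induced by an isomorphism of pseudo-quadratic
spaces. -/
theorem caseI_of_comm (hcomm : ∀ x y : K, x * y = y * x) (hcomm' : ∀ x y : K', x * y = y * x) :
    CaseI Q.γ := by
  have key : ∀ a : L, a ≠ 0 → ∃ ψ : K ≃+* K', ∀ x, Q.φ₁ (a <• x) = Q.φ₁ a <• ψ x := by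
    intro a ha
    obtain ⟨θ, hθ, -⟩ := Q.exists_E_equiv hcomm' (T.lift a) ha
    have htop : ∀ x, x ∈ Ξ.E (T.lift a : Ξ.T).vec := fun x =>
      (Q.proper.mem_E_iff Q.central _).2
        (Q.proper.exists_add_mul_of_comm hcomm (T.scal_not_mem (p := T.lift a) ha) x)
    let ι : Ξ.E (T.lift a : Ξ.T).vec ≃+* K := RingEquiv.ofBijective (Subring.subtype _)
      ⟨Subtype.val_injective, fun x => ⟨⟨x, htop x⟩, rfl⟩⟩
    refine ⟨ι.symm.trans θ, fun x => ?_⟩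
    obtain ⟨y, rfl⟩ := ι.surjective x
    rw [RingEquiv.trans_apply, RingEquiv.symm_apply_apply]
    exact hθ y
  obtain ⟨a, ha⟩ := Q.proper.2.1
  obtain ⟨ψ, hψ⟩ := key a ha
  refine Q.caseI_of_semilinear ψ fun b x => ?_
  by_cases hb : ∃ y : K, b = a <• y
  · obtain ⟨y, rfl⟩ := hb
    rw [← rs_mul, hψ, hψ, map_mul, rs_mul]
  push Not at hb
  have hb0 : b ≠ 0 := fun h => hb 0 (by rw [h, rs_zero])
  have hab : a + b ≠ 0 := fun h => hb (-1) (by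
    rw [rs_neg, rs_one, eq_neg_of_add_eq_zero_right h])
  obtain ⟨ψ₂, hψ₂⟩ := key b hb0
  obtain ⟨ψ₃, hψ₃⟩ := key (a + b) hab
  have h₁ := hψ₃ x
  rw [add_rs, map_add, map_add, add_rs, hψ, hψ₂] at h₁
  have h₂ : Q.φ₁ b <• (ψ₂ x - ψ₃ x) = Q.φ₁ a <• (ψ₃ x - ψ x) := by
    rw [rs_sub, rs_sub, sub_eq_sub_iff_add_eq_add, add_comm, h₁, add_comm]
  by_cases h0 : ψ₂ x - ψ₃ x = 0
  · rw [h0, rs_zero, eq_comm, rs_eq_zero] at h₂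
    have h₃ := h₂.resolve_left (Q.φ₁_ne_zero ha)
    rw [hψ₂, sub_eq_zero.1 h0, sub_eq_zero.1 h₃]
  · exfalso
    obtain ⟨y, hy⟩ := ψ.surjective ((ψ₃ x - ψ x) * (ψ₂ x - ψ₃ x)⁻¹)
    apply hb y
    apply Q.φ₁.injective
    rw [hψ, hy, rs_mul, ← h₂, ← rs_mul, mul_inv_cancel₀ h0, rs_one]

end QuadIso

end PseudoQuadraticSpace

namespace PseudoQuadraticSpace

section

variable {K L : Type*} [DivisionRing K] [StarRing K] [AddCommGroup L] [Module Kᵐᵒᵖ L]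
variable {Ξ : PseudoQuadraticSpace K L}

theorem finrank_eq_one_of_span {K L : Type*} [DivisionRing K] [AddCommGroup L] [Module Kᵐᵒᵖ L]
    {a : L} (ha : a ≠ 0) (h : ∀ b : L, ∃ x : K, b = a <• x) : Module.finrank Kᵐᵒᵖ L = 1 :=
  finrank_eq_one a ha fun b => by
    obtain ⟨x, hx⟩ := h b
    exact ⟨MulOpposite.op x, hx.symm⟩

theorem exists_eq_smul_of_finrank_eq_one {K L : Type*} [DivisionRing K] [AddCommGroup L]
    [Module Kᵐᵒᵖ L] (h : Module.finrank Kᵐᵒᵖ L = 1) {a : L} (ha : a ≠ 0) (b : L) :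
    ∃ x : K, b = a <• x := by
  obtain ⟨c, hc⟩ := (finrank_eq_one_iff_of_nonzero' a ha).1 h b
  exact ⟨c.unop, hc.symm⟩

theorem linearIndependent_pair {K L : Type*} [DivisionRing K] [AddCommGroup L]
    [Module Kᵐᵒᵖ L] {a c : L} (ha : a ≠ 0) (hc : ∀ x : K, c ≠ a <• x) :
    LinearIndependent Kᵐᵒᵖ ![a, c] :=
  (LinearIndependent.pair_iff' ha).2 fun x h => hc x.unop h.symm

theorem finrank_eq_two_of_span {K L : Type*} [DivisionRing K] [AddCommGroup L] [Module Kᵐᵒᵖ L]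
    {a c : L} (ha : a ≠ 0) (hc : ∀ x : K, c ≠ a <• x)
    (h : ∀ b : L, ∃ x y : K, b = a <• x + c <• y) : Module.finrank Kᵐᵒᵖ L = 2 := by
  have hspan : ⊤ ≤ Submodule.span Kᵐᵒᵖ (Set.range ![a, c]) := by
    intro b _
    obtain ⟨x, y, rfl⟩ := h b
    rw [Matrix.range_cons_cons_empty]
    exact Submodule.mem_span_pair.2 ⟨_, _, rfl⟩
  have := Module.finrank_eq_card_basis (Module.Basis.mk (linearIndependent_pair ha hc) hspan)
  rwa [Fintype.card_fin] at this

theorem exists_eq_add_of_finrank_eq_two {K L : Type*} [DivisionRing K] [AddCommGroup L]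
    [Module Kᵐᵒᵖ L] (h2 : Module.finrank Kᵐᵒᵖ L = 2) {a c : L} (ha : a ≠ 0)
    (hc : ∀ x : K, c ≠ a <• x) (b : L) : ∃ x y : K, b = a <• x + c <• y := by
  have hspan := (linearIndependent_pair ha hc).span_eq_top_of_card_eq_finrank
    (by rw [Fintype.card_fin, h2])
  have hb : b ∈ Submodule.span Kᵐᵒᵖ (Set.range ![a, c]) := hspan ▸ Submodule.mem_top
  rw [Matrix.range_cons_cons_empty, Submodule.mem_span_pair] at hb
  obtain ⟨x, y, rfl⟩ := hb
  exact ⟨x.unop, y.unop, rfl⟩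

/-- If `K₀ = {0, 1}`, then every element outside `K₀` has trace one. -/
theorem trace_eq_one (hF : ∀ u ∈ Ξ.K₀, u = 0 ∨ u = 1) {x : K}
    (hx : x ∉ Ξ.K₀) : star x * x = 1 ∧ x + star x = 1 := by
  have hN : ∀ y ∉ Ξ.K₀, star y * y = 1 := fun y hy => by
    have hy0 : y ≠ 0 := fun h => hy (h ▸ zero_mem _)
    exact (hF _ (star_mul_self_mem y)).resolve_left (mul_ne_zero (star_ne_zero.2 hy0) hy0)
  have h2 : (1 : K) + 1 = 0 := (hF _ (add_mem Ξ.one_mem Ξ.one_mem)).resolve_right fun h =>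
    one_ne_zero (left_eq_add.1 h.symm)
  refine ⟨hN x hx, ?_⟩
  have h₁ := hN (1 + x) fun h => hx (by simpa using sub_mem h Ξ.one_mem)
  rw [star_add, star_one, add_mul, one_mul, mul_add, mul_one, hN x hx] at h₁
  calc x + star x = (1 + x + (star x + 1)) - (1 + 1) := by abel
    _ = 1 := by rw [h₁, h2, sub_zero]

theorem add_mem_of_not_mem (hF : ∀ u ∈ Ξ.K₀, u = 0 ∨ u = 1) {x y : K}
    (hx : x ∉ Ξ.K₀) (hy : y ∉ Ξ.K₀) : x + y ∈ Ξ.K₀ := by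
  by_contra h
  have h2 : (1 : K) + 1 = 0 := (hF _ (add_mem Ξ.one_mem Ξ.one_mem)).resolve_right fun h =>
    one_ne_zero (left_eq_add.1 h.symm)
  have h₁ := (trace_eq_one hF h).2
  have h₂ : x + y + star (x + y) = (x + star x) + (y + star y) := by rw [star_add]; abel
  rw [h₂, (trace_eq_one hF hx).2, (trace_eq_one hF hy).2, h2] at h₁
  exact zero_ne_one h₁

theorem comm_of_forall_mem (hF : ∀ u ∈ Ξ.K₀, u = 0 ∨ u = 1) (x y : K) :
    x * y = y * x := by
  have h01 : ∀ u ∈ Ξ.K₀, ∀ x, u * x = x * u := fun u hu x => by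
    rcases hF u hu with rfl | rfl <;> simp
  by_cases hx : x ∈ Ξ.K₀
  · exact h01 x hx y
  by_cases hy : y ∈ Ξ.K₀
  · exact (h01 y hy x).symm
  have h := h01 _ (add_mem_of_not_mem hF hx hy) y
  rw [add_mul, mul_add] at h
  exact add_right_cancel h

theorem exists_ne_of_not_comm (Ξ : PseudoQuadraticSpace K L) (hn : ∃ x y : K, x * y ≠ y * x) :
    ∃ l ∈ Ξ.K₀, l ≠ 0 ∧ l ≠ 1 := by
  by_contra! h
  obtain ⟨x, y, hxy⟩ := hn
  exact hxy (comm_of_forall_mem (Ξ := Ξ) (fun u hu => or_iff_not_imp_left.2 (h u hu)) x y)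

end

variable {K L K' L' : Type*} [DivisionRing K] [StarRing K] [AddCommGroup L] [Module Kᵐᵒᵖ L]
  [DivisionRing K'] [StarRing K'] [AddCommGroup L'] [Module K'ᵐᵒᵖ L']
  {Ξ : PseudoQuadraticSpace K L} {Ξ' : PseudoQuadraticSpace K' L'}

namespace QuadIso

variable (Q : QuadIso Ξ Ξ')

/-- If `K'` is commutative but `K` is not, then `γ` is given by a split formula, for any choice
of `a` and `e`. -/
theorem splitFormula (hcomm' : ∀ x y : K', x * y = y * x) {a : L} {e : K} (ha : a ≠ 0)
    (he : Ξ.IsPerp a e) : Module.finrank Kᵐᵒᵖ L = 1 ∧ Module.finrank K'ᵐᵒᵖ L' = 2 ∧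
      SplitFormula Q.γ a e := by
  obtain ⟨p, rfl, hps⟩ : ∃ p : Ξ.T, p.vec = a ∧ p.scal = Ξ.q a := ⟨T.lift a, rfl, rfl⟩
  have hα' : (Q.γ p).scal ∉ Ξ'.K₀ :=
    T.scal_not_mem (by rw [Q.vec_γ]; exact Q.φ₁_ne_zero ha)
  have hα : star p.scal ≠ p.scal := by
    have := Q.symm.star_scal_ne (p := Q.γ p) fun h =>
      hα' ((Q.proper'.mem_K₀_iff Q.central').2 ⟨h, hcomm' _⟩)
    rwa [show Q.symm.γ (Q.γ p) = p from Q.symm_γ_γ p] at this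
  have he' : Ξ.IsQuatPair p.scal e := (Q.proper.isPerp_iff Q.central p hα).1 he
  obtain ⟨θ, hθ, hθ'⟩ := Q.exists_E_equiv hcomm' p ha
  have hEe : ∀ x : Ξ.E p.vec, (x : K) * e = e * star (x : K) := by
    intro x
    obtain ⟨r, s, hx⟩ := (Q.proper.mem_E_iff Q.central p).1 x.2
    rw [hx, star_add, star_mul, Q.star_coe, Q.star_coe, add_mul, mul_add, Q.coe_comm r, mul_assoc,
      ← Q.coe_comm s, ← mul_assoc e, ← Q.coe_comm s, mul_assoc, he'.e_star Q.central]
  have hθs : ∀ x y : Ξ.E p.vec, (y : K) = star (x : K) → θ y = star (θ x) := by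
    intro x y hxy
    obtain ⟨r, s, hx⟩ := (Q.proper.mem_E_iff Q.central p).1 x.2
    rw [hx, Q.proper.coe_add_mul_star Q.central] at hxy
    rw [hθ' _ _ _ hxy, hθ' _ _ _ hx, Q.proper'.coe_add_mul_star Q.central', map_add, map_mul,
      map_neg, Q.map_tr]
  have hcommE : ∀ x y : Ξ.E p.vec, (x : K) * y = y * x := by
    intro x y
    have : θ (x * y) = θ (y * x) := by rw [map_mul, map_mul, hcomm']
    exact congrArg Subtype.val (θ.injective this)
  have hn : ∀ x' : K', Q.φ₁ (p.vec <• e) ≠ Q.φ₁ p.vec <• x' := by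
    intro x' h
    obtain ⟨x, rfl⟩ := θ.surjective x'
    rw [← hθ] at h
    have h₁ := rs_left_cancel ha (Q.φ₁.injective h)
    apply he'.not_comm
    rw [h₁]
    exact hcommE x ⟨p.scal, (Q.proper.mem_E_iff Q.central p).2 ⟨0, 1, by simp⟩⟩
  obtain ⟨hf, h₁, h₂⟩ := Q.of_not_mem_span he' hn
  have hmap : ∀ s t : Ξ.E p.vec, Q.φ₁ (p.vec <• ((s : K) + e * t)) =
      Q.φ₁ p.vec <• θ s + Q.φ₁ (p.vec <• e) <• star (θ t) := by
    intro s t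
    obtain ⟨r, k, hx⟩ := (Q.proper.mem_E_iff Q.central p).1 t.2
    rw [rs_add, map_add, hθ, hθ' _ _ _ hx, hx, mul_add, rs_add, map_add, Q.map_smul_mul,
      ← mul_assoc, ← Q.coe_comm k, mul_assoc, Q.map_smul_mul' Q.central, h₁, star_add, star_mul,
      Q.star_coe', Q.star_coe', rs_add, rs_mul]
  refine ⟨finrank_eq_one_of_span ha fun b => ?_, ?_, ?_⟩
  · obtain ⟨x, y, hxy⟩ := Q.exists_eq_add_of_not_mem_span he' hn (Q.φ₁ b)
    obtain ⟨s, rfl⟩ := θ.surjective x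
    obtain ⟨t, ht⟩ := θ.surjective (star y)
    refine ⟨s + e * t, Q.φ₁.injective ?_⟩
    rw [hxy, hmap, ht, star_star]
  · exact finrank_eq_two_of_span (Q.φ₁_ne_zero ha) hn (Q.exists_eq_add_of_not_mem_span he' hn)
  · refine ⟨θ, Q.φ₁ p.vec, Q.φ₁ (p.vec <• e), hf, ?_⟩
    intro r x s t y u hu hx hrv hrs hy
    have hv : Q.φ₁ r.vec = Q.φ₁ p.vec <• θ s + Q.φ₁ (p.vec <• e) <• star (θ t) := by
      rw [hrv, hx, hmap]
    refine ⟨by rw [Q.vec_γ, hv], ?_⟩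
    by_cases hr0 : r.vec = 0
    · have hx0 : x = 0 := (rs_eq_zero.1 (hrv ▸ hr0)).resolve_left ha
      have hyu : (y : K) = u := by rw [hy, hx0]; simp
      have hru : r.scal = u := by rw [hrs, hx0]; simp
      have h₃ := hθ' ⟨u, mem_gen hu⟩ 0 y (by rw [hyu]; simp)
      rw [Q.scal_γ_of_vec_eq_zero r hr0, h₃]
      simp [hru]
    · refine (rs_left_cancel (Q.φ₁_ne_zero hr0) ?_).symm
      rw [← Q.map_vec_scal, hrv, hrs, ← rs_mul]
      have hys : star (y : K) ∈ Ξ.E p.vec := by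
        obtain ⟨r, s, hx⟩ := (Q.proper.mem_E_iff Q.central p).1 y.2
        exact (Q.proper.mem_E_iff Q.central p).2 ⟨_, _, by
          rw [hx]; exact Q.proper.coe_add_mul_star Q.central _ _ _⟩
      have e₁ : x * (star x * Ξ.q p.vec * x + u) = ((y * s : Ξ.E p.vec) : K) +
          e * ((⟨_, hys⟩ * t : Ξ.E p.vec) : K) := by
        have e₂ : x * (star x * Ξ.q p.vec * x + u) = y * x := by
          rw [hy, mul_add, ← Q.central u hu, add_mul, Q.central.star_mul_self]
          simp only [mul_assoc]
        rw [e₂, hx, mul_add, ← mul_assoc, hEe y]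
        push_cast
        simp only [mul_assoc]
      rw [e₁, hmap, map_mul, map_mul, hθs y ⟨_, hys⟩ rfl, hx, hmap, star_mul, star_star,
        add_rs, ← rs_mul, ← rs_mul, hcomm' (θ y)]

end QuadIso

end PseudoQuadraticSpace

namespace PseudoQuadraticSpace

/-- The images under `ι` of the elements of a commutative ring `R` with involution, together with
`e`, behave as in the Cayley–Dickson double of `R` with `e² = -ν`. -/
structure IsDouble {R A : Type*} [CommRing R] [StarRing R] [Ring A] [StarRing A] (ι : R →+* A)
    (e : A) (ν : R) : Prop where
  map_star : ∀ r, ι (star r) = star (ι r)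
  anti : ∀ r, e * ι r = ι (star r) * e
  star_e : star e = -e
  sq : e * e = -ι ν

theorem double_add {R A : Type*} [CommRing R] [Ring A] {ι : R →+* A} {e : A}
    {s w s' w' t v s₁ w₁ u u' u₁ : R} (h₁ : s + u + (s' + u') + t = s₁ + u₁)
    (h₂ : w + w' + v = w₁) :
    (ι s + ι w * e + ι u) + (ι s' + ι w' * e + ι u') + (ι t + ι v * e) =
      ι s₁ + ι w₁ * e + ι u₁ := by
  rw [add_right_comm (ι s₁), ← map_add, ← h₁, ← h₂]
  simp only [map_add, add_mul]
  abel

namespace IsDouble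

variable {R A : Type*} [CommRing R] [StarRing R] [Ring A] [StarRing A] {ι : R →+* A}
  {e : A} {ν : R}

theorem mul (h : IsDouble ι e ν) (s w s' w' : R) : (ι s + ι w * e) * (ι s' + ι w' * e) =
    ι (s * s' - ν * w * star w') + ι (s * w' + w * star s') * e := by
  have e₁ : ι w * e * (ι w' * e) = -ι (ν * w * star w') := by
    rw [mul_assoc, ← mul_assoc e, h.anti, mul_assoc, h.sq, mul_neg, mul_neg, ← map_mul, ← map_mul]
    congr 2; ring
  have e₂ : ι w * e * ι s' = ι (w * star s') * e := by
    rw [mul_assoc, h.anti, ← mul_assoc, ← map_mul]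
  rw [add_mul, mul_add, mul_add, e₁, e₂, map_sub, map_add, map_mul ι s s', add_mul, map_mul ι s w']
  simp only [mul_assoc]
  abel

theorem star_eq (h : IsDouble ι e ν) (s w : R) :
    star (ι s + ι w * e) = ι (star s) + ι (-w) * e := by
  rw [star_add, star_mul, h.star_e, ← h.map_star, ← h.map_star, neg_mul, h.anti, star_star,
    map_neg, neg_mul]

theorem conj (h : IsDouble ι e ν) (α s w s' w' : R) :
    star (ι s + ι w * e) * ι α * (ι s' + ι w' * e) =
    ι (star s * α * s' + ν * w * star α * star w') +
      ι (star s * α * w' - w * star α * star s') * e := by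
  have := h.mul (star s) (-w) α 0
  rw [map_zero, zero_mul, add_zero] at this
  rw [h.star_eq, this, h.mul]
  congr 2
  · simp only [star_zero]; ring
  · congr 1; simp only [star_zero]; ring

theorem norm (h : IsDouble ι e ν) (s w : R) : star (ι s + ι w * e) * (ι s + ι w * e) =
    ι (star s * s + ν * w * star w) := by
  have := h.conj 1 s w s w
  rw [map_one, mul_one, mul_one, star_one, mul_one, mul_one] at this
  rw [this]
  have e₁ : star s * w - w * star s = 0 := by ring
  rw [e₁, map_zero, zero_mul, add_zero]

end IsDouble

section

variable {K L : Type*} [DivisionRing K] [StarRing K] [AddCommGroup L] [Module Kᵐᵒᵖ L]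
variable {Ξ : PseudoQuadraticSpace K L}

theorem IsProper.star_mem_E (hΞ : Ξ.IsProper) (hc : Ξ.IsCentral) (p : Ξ.T) {z : K}
    (hz : z ∈ Ξ.E p.vec) : star z ∈ Ξ.E p.vec := by
  obtain ⟨r, s, hx⟩ := (hΞ.mem_E_iff hc p).1 hz
  exact (hΞ.mem_E_iff hc p).2 ⟨_, _, by rw [hx]; exact hΞ.coe_add_mul_star hc _ _ _⟩

theorem IsQuatPair.anti_of_mem_E (hΞ : Ξ.IsProper) (hc : Ξ.IsCentral) {p : Ξ.T} {e : K}
    (h : Ξ.IsQuatPair p.scal e) {z : K} (hz : z ∈ Ξ.E p.vec) : e * z = star z * e := by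
  obtain ⟨r, s, rfl⟩ := (hΞ.mem_E_iff hc p).1 hz
  rw [star_add, star_mul, hΞ.star_coe hc, hΞ.star_coe hc, mul_add, add_mul, hΞ.coe_comm hc r,
    ← mul_assoc, ← hΞ.coe_comm hc s e, mul_assoc, h.anti, ← hΞ.coe_comm hc s, mul_assoc]

theorem IsProper.mul_scal_of_mem_E (hΞ : Ξ.IsProper) (hc : Ξ.IsCentral) (p : Ξ.T) {z : K}
    (hz : z ∈ Ξ.E p.vec) : z * p.scal = p.scal * z := by
  obtain ⟨r, s, rfl⟩ := (hΞ.mem_E_iff hc p).1 hz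
  rw [add_mul, mul_add, hΞ.coe_comm hc r, ← mul_assoc, ← hΞ.coe_comm hc s]

theorem IsProper.mem_K₀_of_mem_E (hΞ : Ξ.IsProper) (hc : Ξ.IsCentral) {p : Ξ.T}
    (hp : star p.scal ≠ p.scal) {z : K} (hz : z ∈ Ξ.E p.vec) (hs : star z = z) : z ∈ Ξ.K₀ := by
  obtain ⟨r, s, rfl⟩ := (hΞ.mem_E_iff hc p).1 hz
  rw [star_add, star_mul, hΞ.star_coe hc, hΞ.star_coe hc, ← hΞ.coe_comm hc s,
    add_right_inj] at hs
  by_cases h0 : (s : K) = 0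
  · rw [h0, zero_mul, add_zero, ← hΞ.mem_gen_iff hc]
    exact r.2
  · exact absurd (mul_left_cancel₀ h0 hs) hp

/-- If `L` is one-dimensional, then `q(a)` is not fixed by `σ` for `a ≠ 0`. -/
theorem IsProper.star_scal_ne_of_span (hΞ : Ξ.IsProper) {p : Ξ.T} (hp : p.vec ≠ 0)
    (h : ∀ b, ∃ x : K, b = p.vec <• x) : star p.scal ≠ p.scal := by
  intro h'
  refine hp (hΞ.2.2 _ fun b => ?_)
  obtain ⟨x, rfl⟩ := h b
  rw [Ξ.f_smul_right, hΞ.f_self, h', sub_self, zero_mul]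

end

variable {K L K' L' : Type*} [DivisionRing K] [StarRing K] [AddCommGroup L] [Module Kᵐᵒᵖ L]
  [DivisionRing K'] [StarRing K'] [AddCommGroup L'] [Module K'ᵐᵒᵖ L']
  {Ξ : PseudoQuadraticSpace K L} {Ξ' : PseudoQuadraticSpace K' L'}

/-- An additive bijection of the vector spaces that is compatible with the forms gives rise to
a Jordan isomorphism. -/
theorem isJordanIso_of_mulEquiv (hΞ : Ξ.IsProper) (hΞ' : Ξ'.IsProper) (hc : Ξ.IsCentral)
    (hc' : Ξ'.IsCentral) (hl : ∃ l ∈ Ξ.K₀, l ≠ 0 ∧ l ≠ 1) {γ : Ξ.T → Ξ'.T}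
    (hbij : Function.Bijective γ) (hmul : ∀ p r, γ (p * r) = γ p * γ r)
    (hsmul : ∀ (u : K) (hu : u ∈ Ξ.K₀) (p r : Ξ.T), r.vec = p.vec <• u →
      (γ r).vec = (γ p).vec <• (γ (T.cen u hu)).scal)
    (hscal : ∀ p r : Ξ.T, r.vec = p.vec <• p.scal → (γ r).vec = (γ p).vec <• (γ p).scal) :
    IsJordanIso γ := by
  let γ' : Ξ.T ≃* Ξ'.T := { Equiv.ofBijective γ hbij with map_mul' := hmul }
  obtain ⟨G, hG⟩ := GroupIso.exists_of_smul hΞ hΞ' γ' hsmul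
  have hG' : ∀ p, G.γ p = γ p := fun p => by rw [hG]; rfl
  obtain ⟨l, hl, h0, h1⟩ := hl
  let Q : QuadIso Ξ Ξ' :=
    { toGroupIso := G
      central := hc
      central' := hc'
      exists_ne := ⟨⟨l, mem_gen hl⟩, fun h => h0 (congrArg Subtype.val h),
        fun h => h1 (congrArg Subtype.val h)⟩
      map_vec_scal := fun p => by
        have := hscal p (T.lift (p.vec <• p.scal)) rfl
        rwa [← hG', G.vec_γ, ← hG', G.vec_γ, T.vec_lift] at this }
  have hQ := Q.isJordanIso
  have : ⇑Q.γ = γ := funext hG'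
  rwa [this] at hQ

/-- The maps given by a split formula are Jordan isomorphisms. -/
theorem CaseIII.isJordanIso (hΞ : Ξ.IsProper) (hΞ' : Ξ'.IsProper) {γ : Ξ.T → Ξ'.T}
    (h : CaseIII γ) : IsJordanIso γ := by
  obtain ⟨hIV, hIII, h1, h2, a, e, ha, he, φ, a', b', hf, hγ⟩ := h
  obtain ⟨hc, hn⟩ := hΞ.isTypeIV_iff.1 hIV
  obtain ⟨hc', hcomm'⟩ := hΞ'.isTypeIII_iff.1 hIII
  obtain ⟨p, rfl, hps⟩ : ∃ p : Ξ.T, p.vec = a ∧ p.scal = Ξ.q a := ⟨T.lift a, rfl, rfl⟩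
  have hspan := exists_eq_smul_of_finrank_eq_one h1 ha
  have hα := hΞ.star_scal_ne_of_span ha hspan
  have he' : Ξ.IsQuatPair p.scal e := (hΞ.isPerp_iff hc p hα).1 he
  rw [← hps] at hγ
  have hfix : ∀ {y : K'}, star y = y → y ∈ Ξ'.K₀ := fun h => (hΞ'.mem_K₀_iff hc').2 ⟨h, hcomm' _⟩
  have hK₀E : ∀ u ∈ Ξ.K₀, u ∈ Ξ.E p.vec := fun u hu =>
    (hΞ.mem_E_iff hc p).2 ⟨⟨u, mem_gen hu⟩, 0, by simp⟩
  have hgE : ∀ r : Ξ.gen, (r : K) ∈ Ξ.E p.vec := fun r => hK₀E _ ((hΞ.mem_gen_iff hc).1 r.2)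
  have hαE : p.scal ∈ Ξ.E p.vec := (hΞ.mem_E_iff hc p).2 ⟨0, 1, by simp⟩
  -- `φ` maps `K₀` into `K₀'`
  have hφK₀ : ∀ u (hu : u ∈ Ξ.K₀), φ ⟨u, hK₀E u hu⟩ ∈ Ξ'.K₀ := by
    intro u hu
    obtain ⟨h₁, h₂⟩ := hγ (T.cen u hu) 0 0 0 ⟨u, hK₀E u hu⟩ u hu (by simp) (by simp) (by simp)
      (by simp)
    rw [← h₂, ← T.vec_eq_zero_iff, h₁]
    simp
  have hφg : ∀ r : Ξ.gen, φ ⟨r, hgE r⟩ ∈ Ξ'.K₀ := fun r => hφK₀ _ ((hΞ.mem_gen_iff hc).1 r.2)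
  obtain ⟨ha', hα'⟩ := hγ p 1 1 0 ⟨_, hαE⟩ 0 (zero_mem _) (by simp) (by simp) (by simp) (by simp)
  rw [map_one, map_zero, star_zero, rs_zero, add_zero, rs_one] at ha'
  set α' := φ ⟨_, hαE⟩ with hα'_def
  have hEφ : ∀ z : Ξ.E p.vec, ∃ r s : Ξ.gen, (z : K) = r + s * p.scal ∧
      φ z = φ ⟨r, hgE r⟩ + φ ⟨s, hgE s⟩ * α' := by
    intro z
    obtain ⟨r, s, hz⟩ := (hΞ.mem_E_iff hc p).1 z.2
    refine ⟨r, s, hz, ?_⟩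
    rw [hα'_def, ← map_mul, ← map_add]
    congr 1
    exact Subtype.ext hz
  have hα'K : α' ∉ Ξ'.K₀ := by
    intro hmem
    obtain ⟨y, hy⟩ := hΞ'.1
    apply hy
    apply Ξ'.star_eq
    obtain ⟨z, rfl⟩ := φ.surjective y
    obtain ⟨r, s, -, hz⟩ := hEφ z
    rw [hz]
    exact add_mem (hφg r) (hΞ'.mul_mem_K₀ hc' (hφg s) hmem)
  have hα's : star α' ≠ α' := fun h => hα'K (hfix h)
  have htr : φ ⟨_, hgE (Ξ.tr p.scal)⟩ = Ξ'.tr α' := by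
    have e₁ : (⟨_, hαE⟩ * ⟨_, hαE⟩ : Ξ.E p.vec) =
        ⟨_, hgE (Ξ.tr p.scal)⟩ * ⟨_, hαE⟩ - ⟨_, hgE (Ξ.nm p.scal)⟩ :=
      Subtype.ext (sq_eq_tr_nm (Ξ := Ξ) p.scal)
    have e₂ := congrArg φ e₁
    rw [map_mul, map_sub, map_mul, ← hα'_def, sq_eq_tr_nm (Ξ := Ξ') α'] at e₂
    have e₃ := (hΞ'.coe_add_coe_mul_eq_zero hc' hα'K
      (r := ⟨_, mem_gen (hφg (Ξ.nm p.scal))⟩ - Ξ'.nm α')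
      (s := Ξ'.tr α' - ⟨_, mem_gen (hφg (Ξ.tr p.scal))⟩) (by
        rw [AddSubgroupClass.coe_sub, AddSubgroupClass.coe_sub, sub_mul, ← sub_eq_zero.2 e₂]
        abel)).2
    exact (congrArg Subtype.val (sub_eq_zero.1 e₃)).symm
  have hφs : ∀ z : Ξ.E p.vec, φ ⟨_, hΞ.star_mem_E hc p z.2⟩ = star (φ z) := by
    intro z
    obtain ⟨r, s, hz, hz'⟩ := hEφ z
    have e₁ : (⟨_, hΞ.star_mem_E hc p z.2⟩ : Ξ.E p.vec) = ⟨r, hgE r⟩ +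
        ⟨s, hgE s⟩ * (⟨_, hgE (Ξ.tr p.scal)⟩ - ⟨_, hαE⟩) := Subtype.ext (by
      change star (z : K) = r + s * (Ξ.tr p.scal - p.scal)
      rw [hz, ← star_eq_tr_sub, star_add, star_mul, hΞ.star_coe hc, hΞ.star_coe hc,
        ← hΞ.coe_comm hc])
    rw [e₁, map_add, map_mul, map_sub, htr, hz', star_add, star_mul, Ξ'.star_eq _ (hφg r),
      Ξ'.star_eq _ (hφg s), ← hα'_def, ← star_eq_tr_sub, hcomm' (star α')]
  let _ : Field K' := { ‹DivisionRing K'› with mul_comm := hcomm' }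
  set ι : K' →+* K := (Ξ.E p.vec).subtype.comp (φ.symm : K' →+* Ξ.E p.vec) with hι
  have hιφ : ∀ z : Ξ.E p.vec, ι (φ z) = z := fun z =>
    congrArg Subtype.val (φ.symm_apply_apply z)
  have hιE : ∀ y, ι y ∈ Ξ.E p.vec := fun y => (φ.symm y).2
  have hιs : ∀ y, ι (star y) = star (ι y) := by
    intro y
    obtain ⟨z, rfl⟩ := φ.surjective y
    rw [← hφs, hιφ, hιφ]
  have hιinj : Function.Injective ι := ι.injective
  have hιK : ∀ y ∈ Ξ'.K₀, ι y ∈ Ξ.K₀ := fun y hy =>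
    hΞ.mem_K₀_of_mem_E hc hα (hιE y) (by rw [← hιs, Ξ'.star_eq y hy])
  have hKι : ∀ u ∈ Ξ.K₀, ∃ y ∈ Ξ'.K₀, ι y = u := fun u hu => ⟨_, hφK₀ u hu, hιφ _⟩
  have hιg : ∀ r : Ξ.gen, ∃ y ∈ Ξ'.K₀, ι y = r := fun r => hKι _ ((hΞ.mem_gen_iff hc).1 r.2)
  have hια : ι α' = p.scal := hιφ _
  obtain ⟨ν, hνK, hν⟩ := hιg (Ξ.nm e)
  have hν0 : ν ≠ 0 := by
    rintro rfl
    rw [map_zero] at hν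
    exact IsProper.nm_ne_zero _ he'.e_ne (Subtype.ext hν.symm)
  have hD : IsDouble ι e ν := by
    refine ⟨hιs, fun r => ?_, he'.star_e hc, ?_⟩
    · rw [he'.anti_of_mem_E hΞ hc (hιE r), hιs]
    · rw [hν, coe_nm, he'.star_e hc, neg_mul, neg_neg]
  have hdec : ∀ x : K, ∃ s w, x = ι s + ι w * e := by
    intro x
    obtain ⟨r, s, m, k, rfl⟩ := he'.exists_decomp hΞ hc x
    obtain ⟨r, -, hr⟩ := hιg r
    obtain ⟨s, -, hs⟩ := hιg s
    obtain ⟨m, -, hm⟩ := hιg m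
    obtain ⟨k, -, hk⟩ := hιg k
    refine ⟨r + s * α', m + k * α', ?_⟩
    rw [map_add, map_add, map_mul, map_mul, hια, hr, hs, hm, hk]
  -- the formula in terms of `ι`
  have hF : ∀ (r : Ξ.T) (s w u : K'), u ∈ Ξ'.K₀ → r.vec = p.vec <• (ι s + ι w * e) →
      r.scal = star (ι s + ι w * e) * ι α' * (ι s + ι w * e) + ι u →
      (γ r).vec = a' <• s + b' <• w ∧ (γ r).scal = (star s * s + ν * w * star w) * α' + u := by
    intro r s w u hu hrv hrs
    have e₁ : ι w * e = e * ι (star w) := by rw [hD.anti, star_star]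
    have := hγ r (ι s + ι w * e) (φ.symm s) (φ.symm (star w))
      (φ.symm ((star s * s + ν * w * star w) * α' + u)) (ι u) (hιK u hu)
      (by rw [e₁]; rfl) hrv (by rw [hrs, hια]) (by
        change ι _ = _
        rw [map_add, map_mul, hια, hD.norm])
    simpa only [RingEquiv.apply_symm_apply, star_star] using this
  have hT : ∀ r : Ξ.T, ∃ s w u : K', u ∈ Ξ'.K₀ ∧ r.vec = p.vec <• (ι s + ι w * e) ∧
      r.scal = star (ι s + ι w * e) * ι α' * (ι s + ι w * e) + ι u := by
    intro r
    obtain ⟨x, hx⟩ := hspan r.vec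
    obtain ⟨s, w, rfl⟩ := hdec x
    have hu := sub_mem (p.rsmul (ι s + ι w * e)).mem r.mem
    rw [T.vec_rsmul, ← hx, sub_sub_sub_cancel_left, T.scal_rsmul] at hu
    obtain ⟨u, hu', hu⟩ := hKι _ hu
    exact ⟨s, w, u, hu', hx, by rw [hu, hια]; abel⟩
  have hV : ∀ (r : Ξ.T) (s w : K'), r.vec = p.vec <• (ι s + ι w * e) →
      (γ r).vec = a' <• s + b' <• w := by
    intro r s w hr
    obtain ⟨s', w', u, hu, hv, hs⟩ := hT r
    rw [(hF r s' w' u hu hv hs).1]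
    rw [hr] at hv
    have h₁ := rs_left_cancel ha hv
    have h₂ : ι (s - s') + ι (w - w') * e = 0 := by
      rw [map_sub, map_sub, sub_mul, sub_add_sub_comm, h₁, sub_self]
    have hz : ∀ y, ι y * p.scal = p.scal * ι y := fun y => hΞ.mul_scal_of_mem_E hc p (hιE y)
    obtain ⟨h₃, h₄⟩ := even_odd hα (hz _) (by
      rw [mul_assoc, he'.anti, ← mul_assoc, ← hια, ← hιs, ← map_mul, mul_comm, map_mul,
        mul_assoc]) h₂
    have h₅ := (mul_eq_zero.1 h₄).resolve_right he'.e_ne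
    rw [map_eq_zero, sub_eq_zero] at h₃ h₅
    rw [h₃, h₅]
  obtain ⟨hb', hβ'⟩ := hF (p.rsmul e) 0 1 0 (zero_mem _) (by simp) (by simp [hια])
  rw [rs_zero, zero_add, rs_one] at hb'
  have hfa : Ξ'.f a' a' = α' - star α' := by rw [← ha', hΞ'.f_self, hα']
  have hfb : Ξ'.f b' b' = ν * (α' - star α') := by
    rw [← hb', hΞ'.f_self, hβ']
    simp only [star_add, star_mul, star_zero, star_one, Ξ'.star_eq ν hνK]
    ring
  have ha'0 : a' ≠ 0 := by
    rw [← ha', Ne, T.vec_eq_zero_iff, hα']; exact hα'K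
  have hb'0 : b' ≠ 0 := by
    rintro rfl
    rw [f_zero_left] at hfb
    exact (mul_ne_zero hν0 (sub_ne_zero.2 hα's.symm)) hfb.symm
  have hba' : ∀ x : K', b' ≠ a' <• x := by
    rintro x rfl
    rw [Ξ'.f_smul_right, hfa] at hf
    have := (mul_eq_zero.1 hf).resolve_left (sub_ne_zero.2 hα's.symm)
    rw [this, rs_zero] at hb'0
    exact hb'0 rfl
  have hspan' := exists_eq_add_of_finrank_eq_two h2 ha'0 hba'
  have hinj' : ∀ s w s' w' : K', a' <• s + b' <• w = a' <• s' + b' <• w' → s = s' ∧ w = w' := by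
    intro s w s' w' h
    have h₁ : b' <• (w - w') = a' <• (s' - s) := by
      rw [rs_sub, rs_sub, sub_eq_sub_iff_add_eq_add, add_comm, h, add_comm]
    have h₂ : w - w' = 0 := by
      by_contra h0
      apply hba' ((s' - s) * (w - w')⁻¹)
      rw [rs_mul, ← h₁, ← rs_mul, mul_inv_cancel₀ h0, rs_one]
    rw [h₂, rs_zero, eq_comm, rs_eq_zero] at h₁
    exact ⟨(sub_eq_zero.1 (h₁.resolve_left ha'0)).symm, sub_eq_zero.1 h₂⟩
  refine isJordanIso_of_mulEquiv hΞ hΞ' hc hc' (exists_ne_of_not_comm Ξ hn) ⟨?_, ?_⟩ ?_ ?_ ?_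
  · intro r r' hrr
    obtain ⟨s, w, u, hu, hv, hs⟩ := hT r
    obtain ⟨s', w', u', hu', hv', hs'⟩ := hT r'
    obtain ⟨h₁, h₂⟩ := hF r s w u hu hv hs
    obtain ⟨h₃, h₄⟩ := hF r' s' w' u' hu' hv' hs'
    rw [hrr, h₃] at h₁
    rw [hrr, h₄] at h₂
    obtain ⟨rfl, rfl⟩ := hinj' _ _ _ _ h₁
    have h₅ := add_left_cancel h₂
    exact T.ext' (by rw [hv, hv']) (by rw [hs, hs', h₅])
  · intro r'
    obtain ⟨s, w, hsw⟩ := hspan' r'.vec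
    set r := p.rsmul (ι s + ι w * e) with hr
    obtain ⟨h₁, h₂⟩ := hF r s w 0 (zero_mem _) rfl (by rw [hr, T.scal_rsmul, hια]; simp)
    have hu := sub_mem (γ r).mem r'.mem
    rw [h₁, ← hsw, sub_sub_sub_cancel_left] at hu
    obtain ⟨h₃, h₄⟩ := hF (r * T.cen _ (hιK _ hu)) s w _ hu (T.vec_mul_cen _ _ _)
      (by rw [T.scal_mul_cen, hr, T.scal_rsmul, hια])
    refine ⟨_, T.ext' (h₃.trans hsw.symm) ?_⟩
    rw [h₄, h₂]; ring
  · intro r r'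
    obtain ⟨s, w, u, hu, hv, hs⟩ := hT r
    obtain ⟨s', w', u', hu', hv', hs'⟩ := hT r'
    obtain ⟨h₁, h₂⟩ := hF r s w u hu hv hs
    obtain ⟨h₃, h₄⟩ := hF r' s' w' u' hu' hv' hs'
    set z := star s * α' * s' + ν * w * star α' * star w' with hz
    have hsz : star (u + u' - (z + star z)) = u + u' - (z + star z) := by
      rw [star_sub, star_add, star_add, star_star, Ξ'.star_eq u hu, Ξ'.star_eq u' hu',
        add_comm (star z)]
    have hvv : (r * r').vec = p.vec <• (ι (s + s') + ι (w + w') * e) := by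
      rw [T.vec_mul, hv, hv', ← rs_add, map_add, map_add, add_mul]
      congr 2; abel
    have hν' : star ν = ν := Ξ'.star_eq ν hνK
    have hss : (r * r').scal = star (ι (s + s') + ι (w + w') * e) * ι α' *
        (ι (s + s') + ι (w + w') * e) + ι (u + u' - (z + star z)) := by
      rw [T.scal_mul, hs, hs', hv, hv', Ξ.f_smul_left, Ξ.f_smul_right, hΞ.f_self, ← hια, ← hιs,
        ← map_sub, ← mul_assoc, hD.conj, hD.conj, hD.conj, hD.conj]
      refine double_add ?_ ?_
      · simp only [hz, star_add, star_mul, star_star, star_sub, hν']; ring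
      · simp only [star_add, star_star, star_sub]; ring
    obtain ⟨h₅, h₆⟩ := hF _ _ _ _ (hfix hsz) hvv hss
    refine T.ext' ?_ ?_
    · rw [h₅, T.vec_mul, h₁, h₃, rs_add, rs_add]; abel
    · rw [h₆, T.scal_mul, h₂, h₄, h₁, h₃, Ξ'.f_add_left, Ξ'.f_add_right, Ξ'.f_add_right]
      simp only [Ξ'.f_smul_left, Ξ'.f_smul_right, hf, f_eq_zero_symm hf, hfa, hfb, hz, star_add,
        star_mul, star_star, hν']
      ring
  · intro u hu r r' hr
    obtain ⟨y, hy, rfl⟩ := hKι u hu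
    obtain ⟨s, w, v, hv, hrv, -⟩ := hT r
    rw [hV r s w hrv]
    obtain ⟨-, h₂⟩ := hF (T.cen (ι y) hu) 0 0 y hy (by simp) (by simp)
    rw [h₂, hV r' (s * y) (w * y) (by
      rw [hr, hrv, ← rs_mul, add_mul, mul_assoc, hD.anti, Ξ'.star_eq y hy, ← mul_assoc, map_mul,
        map_mul])]
    rw [add_rs, ← rs_mul, ← rs_mul]
    simp
  · intro r r' hr
    obtain ⟨s, w, u, hu, hv, hs⟩ := hT r
    obtain ⟨h₁, h₂⟩ := hF r s w u hu hv hs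
    rw [h₁, h₂]
    have hν' : star ν = ν := Ξ'.star_eq ν hνK
    have hu' : star u = u := Ξ'.star_eq u hu
    set z := (star s * s + ν * w * star w) * α' + u with hz
    rw [hV r' (s * z) (w * z), add_rs, ← rs_mul, ← rs_mul]
    rw [hr, hv, hs, ← rs_mul, hD.conj, add_right_comm, ← map_add, hD.mul]
    congr 2
    congr 1
    · congr 1
      simp only [hz, star_mul, star_star, star_sub]; ring
    · congr 2
      simp only [hz, star_add, star_mul, star_star, hν', hu']; ring

end PseudoQuadraticSpace

namespace PseudoQuadraticSpace

section

variable {K L : Type*} [DivisionRing K] [StarRing K] [AddCommGroup L] [Module Kᵐᵒᵖ L]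
variable {Ξ : PseudoQuadraticSpace K L}

theorem one_add_one_eq_zero (hF : ∀ u ∈ Ξ.K₀, u = 0 ∨ u = 1) : (1 : K) + 1 = 0 :=
  (hF _ (add_mem Ξ.one_mem Ξ.one_mem)).resolve_right fun h => one_ne_zero (left_eq_add.1 h.symm)

theorem neg_eq_self (hF : ∀ u ∈ Ξ.K₀, u = 0 ∨ u = 1) (x : K) : -x = x := by
  have : x + x = 0 := by rw [← mul_one x, ← mul_add, one_add_one_eq_zero hF, mul_zero]
  exact neg_eq_of_add_eq_zero_right this

theorem f_not_mem (hF : ∀ u ∈ Ξ.K₀, u = 0 ∨ u = 1) {a b : L} (ha : a ≠ 0) (hb : b ≠ 0)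
    (hab : a ≠ b) : Ξ.f b a ∉ Ξ.K₀ := by
  have hbb : b = -b := by
    rw [← rs_one (K := K) b, ← rs_neg, neg_eq_self hF]
  have h : (T.lift a * T.lift b : Ξ.T).vec ≠ 0 := fun h => by
    rw [T.vec_mul, T.vec_lift, T.vec_lift] at h
    exact hab ((eq_neg_of_add_eq_zero_left h).trans hbb.symm)
  intro hf
  apply T.scal_not_mem h
  rw [T.scal_mul]
  exact add_mem (add_mem_of_not_mem hF (T.scal_not_mem (p := T.lift a) ha)
    (T.scal_not_mem (p := T.lift b) hb)) hf

/-- If `K₀ = {0, 1}`, then `L` has dimension at most one. -/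
theorem exists_eq_smul (hF : ∀ u ∈ Ξ.K₀, u = 0 ∨ u = 1) {a : L} (ha : a ≠ 0) (b : L) :
    ∃ x : K, b = a <• x := by
  by_contra! h
  have hb : b ≠ 0 := fun h0 => h 0 (by rw [h0, rs_zero])
  have hf : Ξ.f b a ≠ 0 := fun h0 =>
    f_not_mem hF ha hb (fun hab => h 1 (by rw [rs_one, hab])) (by rw [h0]; exact zero_mem _)
  have := f_not_mem hF (a := a <• (Ξ.f b a)⁻¹)
    (fun h0 => (rs_eq_zero.1 h0).elim ha (inv_ne_zero hf)) hb (fun hab => h _ hab.symm)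
  rw [Ξ.f_smul_right, mul_inv_cancel₀ hf] at this
  exact this Ξ.one_mem

theorem IsProper.hua_eq_self (hΞ : Ξ.IsProper) (hF : ∀ u ∈ Ξ.K₀, u = 0 ∨ u = 1) {p : Ξ.T}
    (hp : p ≠ 1) (r : Ξ.T) : hua p r = r := by
  have hcomm := comm_of_forall_mem hF
  by_cases hv : p.vec = 0
  · have hs : p.scal = 1 := (hF _ (p.vec_eq_zero_iff.1 hv)).resolve_left fun h0 =>
      hp (T.ext' hv h0)
    refine T.ext' ?_ ?_
    · rw [T.vec_hua, hv, hs, zero_rs, sub_zero, star_one, rs_one]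
    · rw [T.scal_hua, hs, star_one, one_mul, mul_one]
  · obtain ⟨h₁, h₂⟩ := trace_eq_one hF (T.scal_not_mem hv)
    have h₁' : p.scal * star p.scal = 1 := by rw [hcomm, h₁]
    have hinv : p.scal⁻¹ = star p.scal := inv_eq_of_mul_eq_one_right h₁'
    refine T.ext' ?_ ?_
    · obtain ⟨y, hy⟩ := exists_eq_smul hF hv r.vec
      have e₁ : y * star p.scal - star p.scal * y * star p.scal = y := by
        have e₂ : 1 - star p.scal = p.scal := by rw [← h₂]; abel
        rw [← sub_mul, ← one_sub_mul, e₂, hcomm p.scal, mul_assoc, h₁', mul_one]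
      rw [T.vec_hua, hy, Ξ.f_smul_right, hΞ.f_self, ← rs_mul, ← rs_sub, sub_eq_add_neg p.scal,
        neg_eq_self hF, h₂, one_mul, hinv, e₁]
    · rw [T.scal_hua, hcomm p.scal, mul_assoc, h₁', mul_one]

/-- If `K₀ = {0, 1}`, then `K` is the field with four elements. -/
theorem IsProper.nonempty_equiv_galoisField (hΞ : Ξ.IsProper)
    (hF : ∀ u ∈ Ξ.K₀, u = 0 ∨ u = 1) : Nonempty (K ≃+* GaloisField 2 2) := by
  let _ : Field K := { ‹DivisionRing K› with mul_comm := comm_of_forall_mem hF }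
  obtain ⟨x, hx⟩ := hΞ.1
  have hx' : x ∉ Ξ.K₀ := fun h => hx (Ξ.star_eq x h)
  have hx0 : x ≠ 0 := fun h => hx' (h ▸ zero_mem _)
  have hx1 : x ≠ 1 := fun h => hx' (h ▸ Ξ.one_mem)
  have hx2 : x + 1 ≠ 0 := fun h => hx1 (by rw [eq_neg_of_add_eq_zero_left h, neg_eq_self hF])
  classical
  let _ : Fintype K := ⟨{0, 1, x, x + 1}, fun y => by
    by_cases hy : y ∈ Ξ.K₀
    · rcases hF y hy with rfl | rfl <;> simp
    · have hxx : y = x + (x + y) := by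
        have := neg_eq_self hF x
        nth_rw 1 [← this]; abel
      rcases hF _ (add_mem_of_not_mem hF hx' hy) with h | h
      · rw [h, add_zero] at hxx; simp [hxx]
      · rw [h] at hxx; simp [hxx]⟩
  have hcard : Fintype.card K = 4 := by
    change Finset.card {0, 1, x, x + 1} = 4
    rw [Finset.card_insert_of_notMem, Finset.card_insert_of_notMem, Finset.card_insert_of_notMem,
      Finset.card_singleton]
    · simp
    · simp [hx1.symm, hx0]
    · simp [hx0.symm, hx2.symm]
  let _ : Fintype (GaloisField 2 2) := Fintype.ofFinite _
  exact ⟨FiniteField.ringEquivOfCardEq (by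
    rw [hcard, ← Nat.card_eq_fintype_card, GaloisField.card 2 2 two_ne_zero]; norm_num)⟩

theorem IsProper.forall_mem_of_equiv_galoisField (hΞ : Ξ.IsProper) (χ : K ≃+* GaloisField 2 2) :
    ∀ u ∈ Ξ.K₀, u = 0 ∨ u = 1 := by
  by_contra! h
  obtain ⟨u, hu, hu0, hu1⟩ := h
  obtain ⟨x, hx⟩ := hΞ.1
  have hx' : x ∉ Ξ.K₀ := fun h => hx (Ξ.star_eq x h)
  have hx1 : x + 1 ∉ Ξ.K₀ := fun h => hx' (by simpa using sub_mem h Ξ.one_mem)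
  have hne : ∀ {y z : K}, y ∈ Ξ.K₀ → z ∉ Ξ.K₀ → y ≠ z := fun hy hz h => hz (h ▸ hy)
  classical
  let _ : Fintype (GaloisField 2 2) := Fintype.ofFinite _
  let _ : Fintype K := Fintype.ofEquiv _ χ.toEquiv.symm
  have hcard : Fintype.card K = 4 := by
    rw [Fintype.card_congr χ.toEquiv, ← Nat.card_eq_fintype_card, GaloisField.card 2 2 two_ne_zero]
    norm_num
  have h5 : Finset.card {0, 1, u, x, x + 1} = 5 := by
    rw [Finset.card_insert_of_notMem, Finset.card_insert_of_notMem, Finset.card_insert_of_notMem,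
      Finset.card_insert_of_notMem, Finset.card_singleton]
    · simp
    · simp [hne hu hx', hne hu hx1]
    · simp [hu1.symm, hne Ξ.one_mem hx', hne Ξ.one_mem hx1]
    · simp [hu0.symm, hne (zero_mem _) hx', hne (zero_mem _) hx1]
  have := Finset.card_le_univ ({0, 1, u, x, x + 1} : Finset K)
  omega

theorem T.conj_eq (g r : Ξ.T) : (MulAut.conj g r).vec = r.vec ∧
    (MulAut.conj g r).scal = r.scal + (Ξ.f r.vec g.vec + star (Ξ.f r.vec g.vec)) := by
  have h : MulAut.conj g r = r * T.cen _ (Ξ.trace_mem (Ξ.f r.vec g.vec)) := by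
    rw [MulAut.conj_apply, mul_inv_eq_iff_eq_mul]
    refine T.ext' ?_ ?_
    · rw [T.vec_mul, T.vec_mul, T.vec_mul_cen, add_comm]
    · rw [T.scal_mul, T.scal_mul, T.scal_mul_cen, T.vec_mul_cen, star_f]; abel
  rw [h]
  exact ⟨T.vec_mul_cen _ _ _, T.scal_mul_cen _ _ _⟩

/-- If `K₀ = {0, 1}`, then inner automorphisms are Jordan automorphisms. -/
theorem IsProper.isJordanIso_conj (hΞ : Ξ.IsProper) (hF : ∀ u ∈ Ξ.K₀, u = 0 ∨ u = 1) (g : Ξ.T) :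
    IsJordanIso (Ξ := Ξ) (Ξ' := Ξ) (MulAut.conj g) := by
  refine ⟨(MulAut.conj g).bijective, map_mul _, ?_, fun p r => ?_⟩
  · obtain ⟨h₁, h₂⟩ := T.conj_eq g (unit Ξ)
    refine T.ext' h₁ ?_
    rw [h₂, T.vec_unit, f_zero_left, star_zero, add_zero, add_zero]
  · by_cases hp : p = 1
    · rw [hp, one_hua, map_one, one_hua]
    · rw [hΞ.hua_eq_self hF hp, hΞ.hua_eq_self hF (by simpa using hp)]

/-- A quadratic extension is generated by any element outside `K₀`, and determined by its trace
and its norm. -/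
theorem exists_ringEquiv_of_comm {K' L' : Type*} [DivisionRing K'] [StarRing K']
    [AddCommGroup L'] [Module K'ᵐᵒᵖ L'] {Ξ' : PseudoQuadraticSpace K' L'} (hΞ : Ξ.IsProper)
    (hΞ' : Ξ'.IsProper) (hcomm : ∀ x y : K, x * y = y * x) (hcomm' : ∀ x y : K', x * y = y * x)
    {α : K} {α' : K'} (hα : α ∉ Ξ.K₀) (hα' : α' ∉ Ξ'.K₀) (φ : Ξ.gen ≃+* Ξ'.gen)
    (htr : φ (Ξ.tr α) = Ξ'.tr α') (hnm : φ (Ξ.nm α) = Ξ'.nm α') :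
    ∃ χ : K ≃+* K', (∀ x, χ (star x) = star (χ x)) ∧
      ∀ r s : Ξ.gen, χ (r + s * α) = (φ r : K') + φ s * α' := by
  have hc : Ξ.IsCentral := fun u _ x => hcomm u x
  have hc' : Ξ'.IsCentral := fun u _ x => hcomm' u x
  choose r s hrs using hΞ.exists_add_mul_of_comm hcomm hα
  have huniq : ∀ x (r' s' : Ξ.gen), x = r' + s' * α → r x = r' ∧ s x = s' := by
    intro x r' s' hx
    have h₁ : ((r x - r' : Ξ.gen) : K) + ((s x - s' : Ξ.gen) : K) * α = 0 := by
      rw [AddSubgroupClass.coe_sub, AddSubgroupClass.coe_sub, sub_mul, sub_add_sub_comm, ← hrs,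
        ← hx, sub_self]
    obtain ⟨h₂, h₃⟩ := hΞ.coe_add_coe_mul_eq_zero hc hα h₁
    exact ⟨sub_eq_zero.1 h₂, sub_eq_zero.1 h₃⟩
  set χ : K → K' := fun x => (φ (r x) : K') + φ (s x) * α' with hχ
  have hχ' : ∀ r' s' : Ξ.gen, χ (r' + s' * α) = (φ r' : K') + φ s' * α' := by
    intro r' s'
    obtain ⟨h₁, h₂⟩ := huniq _ r' s' rfl
    rw [hχ]; simp only [h₁, h₂]
  let χh : K →+* K' :=
    { toFun := χ
      map_one' := by have := hχ' 1 0; simpa using this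
      map_zero' := by have := hχ' 0 0; simpa using this
      map_add' := fun x y => by
        have e₁ : x + y = ((r x + r y : Ξ.gen) : K) + ((s x + s y : Ξ.gen) : K) * α := by
          push_cast
          rw [add_mul, add_add_add_comm, ← hrs, ← hrs]
        rw [e₁, hχ', hχ, map_add, map_add]
        push_cast
        rw [add_mul, add_add_add_comm]
      map_mul' := fun x y => by
        have e₁ := hΞ.coe_add_mul_mul hc α (r x) (s x) (r y) (s y)
        rw [← hrs, ← hrs] at e₁
        rw [e₁, hχ', hχ, hΞ'.coe_add_mul_mul hc']
        simp only [map_add, map_sub, map_mul, htr, hnm] }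
  refine ⟨RingEquiv.ofBijective χh ⟨χh.injective, fun y => ?_⟩, fun x => ?_, hχ'⟩
  · obtain ⟨r', s', rfl⟩ := hΞ'.exists_add_mul_of_comm hcomm' hα' y
    obtain ⟨r', rfl⟩ := φ.surjective r'
    obtain ⟨s', rfl⟩ := φ.surjective s'
    exact ⟨_, hχ' r' s'⟩
  · change χ (star x) = star (χ x)
    have e₁ := hΞ.coe_add_mul_star hc α (r x) (s x)
    rw [← hrs] at e₁
    rw [e₁, hχ', hχ, hΞ'.coe_add_mul_star hc', map_add, map_mul, htr, map_neg]

end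

variable {K L K' L' : Type*} [DivisionRing K] [StarRing K] [AddCommGroup L] [Module Kᵐᵒᵖ L]
  [DivisionRing K'] [StarRing K'] [AddCommGroup L'] [Module K'ᵐᵒᵖ L']
  {Ξ : PseudoQuadraticSpace K L} {Ξ' : PseudoQuadraticSpace K' L'}

theorem IsJordanIso.comp {K'' L'' : Type*} [DivisionRing K''] [StarRing K''] [AddCommGroup L'']
    [Module K''ᵐᵒᵖ L''] {Ξ'' : PseudoQuadraticSpace K'' L''} {δ : Ξ'.T → Ξ''.T} {γ : Ξ.T → Ξ'.T}
    (hδ : IsJordanIso δ) (hγ : IsJordanIso γ) : IsJordanIso (δ ∘ γ) :=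
  ⟨hδ.1.comp hγ.1, fun p r => by simp only [Function.comp, hγ.2.1, hδ.2.1],
    by simp only [Function.comp, hγ.2.2.1, hδ.2.2.1],
    fun p r => by simp only [Function.comp, hγ.2.2.2, hδ.2.2.2]⟩

theorem CaseIV.isJordanIso (hΞ' : Ξ'.IsProper) {γ : Ξ.T → Ξ'.T} (h : CaseIV γ) :
    IsJordanIso γ := by
  obtain ⟨-, ⟨χ⟩, -, Φ, γ₀, g, hγ₀, -, hγ⟩ := h
  have := (hΞ'.isJordanIso_conj (hΞ'.forall_mem_of_equiv_galoisField χ) g).comp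
    (isJordanIso_of_inducedBy hΞ' Φ hγ₀)
  convert this using 1
  exact funext hγ

/-- The map of groups induced by an isomorphism of pseudo-quadratic spaces. -/
def mapT (Φ : PseudoQuadraticIso Ξ.K₀ Ξ.q Ξ'.K₀ Ξ'.q) (p : Ξ.T) : Ξ'.T :=
  T.mk (Φ.φ₁ p.vec) (Φ.φ p.scal) (by
    have h₁ := (Φ.map_mem _).2 p.mem
    rw [map_sub] at h₁
    have := sub_mem h₁ (Φ.map_q p.vec)
    rwa [sub_sub_sub_cancel_left, ← neg_mem_iff, neg_sub, ← neg_mem_iff, neg_sub] at this)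

/-- The Jordan isomorphisms in the case `K₀ = {0, 1}`. -/
theorem IsJordanIso.caseI_or_caseIV (hΞ : Ξ.IsProper) (hΞ' : Ξ'.IsProper) {γ : Ξ.T → Ξ'.T}
    (h : IsJordanIso γ) (hF : ∀ u ∈ Ξ.K₀, u = 0 ∨ u = 1) : CaseI γ ∨ CaseIV γ := by
  obtain ⟨G, rfl⟩ := h.exists_groupIso hΞ hΞ'
  have hcomm := comm_of_forall_mem hF
  have hc : Ξ.IsCentral := fun u _ x => hcomm u x
  have hc' := G.isCentral_iff.1 hc
  have hF' : ∀ u ∈ Ξ'.K₀, u = 0 ∨ u = 1 := by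
    intro u hu
    have h₁ := G.φ_symm_φ ⟨u, mem_gen hu⟩
    have h₂ := hF _ ((hΞ.mem_gen_iff hc).1 (G.symm.φ ⟨u, mem_gen hu⟩).2)
    rcases h₂ with h₂ | h₂
    · left
      rw [show G.symm.φ ⟨u, mem_gen hu⟩ = 0 from Subtype.ext h₂, map_zero] at h₁
      exact (congrArg Subtype.val h₁).symm
    · right
      rw [show G.symm.φ ⟨u, mem_gen hu⟩ = 1 from Subtype.ext h₂, map_one] at h₁
      exact (congrArg Subtype.val h₁).symm
  have hcomm' := comm_of_forall_mem hF'
  obtain ⟨a, ha⟩ := hΞ.2.1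
  set α := Ξ.q a with hα
  have hαK : α ∉ Ξ.K₀ := T.scal_not_mem (p := T.lift a) ha
  have ha' := G.φ₁_ne_zero ha
  have hspan := exists_eq_smul hF ha
  obtain ⟨β, hβ⟩ := exists_eq_smul hF' ha' (G.φ₁ (a <• α))
  have hβK : β ∉ Ξ'.K₀ := by
    intro hβK
    have h₁ := G.map_smul a (G.symm.φ ⟨β, mem_gen hβK⟩)
    rw [G.φ_symm_φ, ← hβ] at h₁
    have h₂ := rs_left_cancel ha (G.φ₁.injective h₁)
    apply hαK
    rw [← h₂, ← hΞ.mem_gen_iff hc]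
    exact Subtype.property _
  have ht : ∀ x ∉ Ξ.K₀, Ξ.tr x = 1 ∧ Ξ.nm x = 1 := fun x hx =>
    ⟨Subtype.ext (trace_eq_one hF hx).2, Subtype.ext (trace_eq_one hF hx).1⟩
  have ht' : ∀ x ∉ Ξ'.K₀, Ξ'.tr x = 1 ∧ Ξ'.nm x = 1 := fun x hx =>
    ⟨Subtype.ext (trace_eq_one hF' hx).2, Subtype.ext (trace_eq_one hF' hx).1⟩
  obtain ⟨χ, hχs, hχ⟩ := exists_ringEquiv_of_comm hΞ hΞ' hcomm hcomm' hαK hβK G.φ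
    (by rw [(ht α hαK).1, (ht' β hβK).1, map_one]) (by rw [(ht α hαK).2, (ht' β hβK).2, map_one])
  have hχg : ∀ r : Ξ.gen, χ r = G.φ r := fun r => by simpa using hχ r 0
  have hax : ∀ x, G.φ₁ (a <• x) = G.φ₁ a <• χ x := by
    intro x
    obtain ⟨r, s, rfl⟩ := hΞ.exists_add_mul_of_comm hcomm hαK x
    rw [hχ, rs_add, map_add, G.map_smul, G.map_smul_mul' hc, hβ, ← rs_mul, ← rs_add,
      hcomm' β]
  have hχK : ∀ x, χ x ∈ Ξ'.K₀ ↔ x ∈ Ξ.K₀ := by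
    intro x
    rw [hΞ'.mem_K₀_iff hc', hΞ.mem_K₀_iff hc, ← hχs, χ.injective.eq_iff]
    exact and_congr_right fun _ => ⟨fun _ => hcomm x, fun _ => hcomm' _⟩
  have hmapq : ∀ b, χ (Ξ.q b) - Ξ'.q (G.φ₁ b) ∈ Ξ'.K₀ := by
    intro b
    by_cases hb : b = 0
    · subst hb
      rw [map_zero]
      exact sub_mem ((hχK _).2 q_zero_mem) q_zero_mem
    · rw [sub_eq_add_neg, neg_eq_self hF']
      refine add_mem_of_not_mem hF' ?_ ?_
      · rw [hχK]; exact T.scal_not_mem (p := T.lift b) hb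
      · exact T.scal_not_mem (p := T.lift (G.φ₁ b)) (G.φ₁_ne_zero hb)
  have hsemi : ∀ b x, G.φ₁ (b <• x) = G.φ₁ b <• χ x := by
    intro b x
    obtain ⟨y, rfl⟩ := hspan b
    rw [← rs_mul, hax, hax, map_mul, rs_mul]
  set Φ : PseudoQuadraticIso Ξ.K₀ Ξ.q Ξ'.K₀ Ξ'.q := ⟨χ, G.φ₁, hsemi, hχs, hχK, hmapq⟩ with hΦ
  have hΦi : InducedBy Φ (mapT Φ : Ξ.T → Ξ'.T) := fun p => ⟨rfl, rfl⟩
  have hJ := isJordanIso_of_inducedBy hΞ' Φ hΦi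
  -- the inner automorphism
  have hd : ∀ p : Ξ.T, ∃ d ∈ Ξ'.K₀, (G.γ p).scal = χ p.scal + d := by
    intro p
    refine ⟨(G.γ p).scal - χ p.scal, ?_, by abel⟩
    have h₁ := sub_mem (mapT Φ p).mem (G.γ_mem p)
    change Ξ'.q (G.φ₁ p.vec) - χ p.scal - _ ∈ _ at h₁
    rwa [sub_sub_sub_cancel_left] at h₁
  obtain ⟨d₁, hd₁, hda⟩ := hd (T.lift a)
  obtain ⟨d₂, hd₂, hdα⟩ := hd (T.lift (a <• α))
  set z : K' := d₂ + d₁ * β with hz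
  obtain ⟨g, hg⟩ : ∃ g : Ξ'.T, g.vec = G.φ₁ a <• z := ⟨T.lift _, rfl⟩
  have hβt := (trace_eq_one hF' hβK)
  have hfz : Ξ'.f (G.φ₁ a) g.vec = z := by
    have h₁ := hΞ'.f_self (T.lift (G.φ₁ a))
    rw [T.vec_lift, T.scal_lift] at h₁
    have h₂ := (trace_eq_one hF' (T.scal_not_mem (p := T.lift (G.φ₁ a)) ha')).2
    rw [T.scal_lift] at h₂
    rw [hg, Ξ'.f_smul_right, h₁, sub_eq_add_neg, neg_eq_self hF', h₂, one_mul]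
  have h2 : ∀ x : K', x + x = 0 := fun x => by
    nth_rw 1 [← neg_eq_self hF' x]; exact neg_add_cancel x
  have hK₀s : ∀ u ∈ Ξ'.K₀, ∀ x : K', u * x + star (u * x) = u * (x + star x) := fun u hu x => by
    rw [star_mul, Ξ'.star_eq u hu, mul_add, hcomm' (star x)]
  have e₁ : z + star z = d₁ := by
    have : z + star z = (d₂ + d₂) + (d₁ * β + star (d₁ * β)) := by
      rw [hz, star_add, Ξ'.star_eq d₂ hd₂]; abel
    rw [this, h2, hK₀s _ hd₁, hβt.2, mul_one, zero_add]
  have e₂ : star β * z + star (star β * z) = d₂ := by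
    have : star β * z = d₂ * star β + d₁ := by
      rw [hz, mul_add, hcomm' d₁, ← mul_assoc, hβt.1, one_mul, hcomm' d₂]
    have h₃ := hK₀s _ hd₂ (star β)
    rw [star_star, add_comm (star β), hβt.2, mul_one] at h₃
    rw [this, star_add, Ξ'.star_eq d₁ hd₁, add_add_add_comm, h₃, h2, add_zero]
  have hgoal : ∀ p, G.γ p = MulAut.conj g (mapT Φ p) := by
    let S : Subgroup Ξ.T :=
      { carrier := {p | G.γ p = MulAut.conj g (mapT Φ p)}
        one_mem' := by
          have h₁ : mapT Φ (1 : Ξ.T) = 1 := T.ext' (map_zero _) (map_zero _)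
          simp [h₁]
        mul_mem' := fun {p r} hp hr => by
          have hp' : G.γ p = MulAut.conj g (mapT Φ p) := hp
          have hr' : G.γ r = MulAut.conj g (mapT Φ r) := hr
          change G.γ (p * r) = MulAut.conj g (mapT Φ (p * r))
          rw [map_mul, hJ.2.1, map_mul, hp', hr']
        inv_mem' := fun {p} hp => by
          have hp' : G.γ p = MulAut.conj g (mapT Φ p) := hp
          change G.γ p⁻¹ = MulAut.conj g (mapT Φ p⁻¹)
          have h₁ : mapT Φ p⁻¹ = (mapT Φ p)⁻¹ := by
            have := hJ.toMulEquiv.map_inv p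
            exact this
          rw [map_inv, h₁, map_inv, hp'] }
    have hcen : ∀ u hu, T.cen u hu ∈ S := by
      intro u hu
      change G.γ _ = _
      obtain ⟨h₁, h₂⟩ := T.conj_eq g (mapT Φ (T.cen u hu))
      refine T.ext' ?_ ?_
      · rw [h₁, G.vec_γ]; rfl
      · rw [h₂, G.scal_γ_cen]
        change _ = χ u + (Ξ'.f (G.φ₁ 0) _ + star (Ξ'.f (G.φ₁ 0) _))
        rw [map_zero, f_zero_left, star_zero, add_zero, add_zero]
        exact (hχg ⟨u, mem_gen hu⟩).symm
    have hl₁ : T.lift a ∈ S := by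
      change G.γ _ = _
      obtain ⟨h₁, h₂⟩ := T.conj_eq g (mapT Φ (T.lift a))
      refine T.ext' ?_ ?_
      · rw [h₁, G.vec_γ]; rfl
      · rw [h₂, hda]
        change _ = χ _ + (Ξ'.f (G.φ₁ a) _ + star (Ξ'.f (G.φ₁ a) _))
        rw [hfz, e₁]
    have hl₂ : T.lift (a <• α) ∈ S := by
      change G.γ _ = _
      obtain ⟨h₁, h₂⟩ := T.conj_eq g (mapT Φ (T.lift (a <• α)))
      refine T.ext' ?_ ?_
      · rw [h₁, G.vec_γ]; rfl
      · rw [h₂, hdα]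
        change _ = χ _ + (Ξ'.f (G.φ₁ (a <• α)) _ + star (Ξ'.f (G.φ₁ (a <• α)) _))
        rw [hβ, Ξ'.f_smul_left, hfz, e₂]
    intro p
    have hS : ∃ r ∈ S, r.vec = p.vec := by
      obtain ⟨x, hx⟩ := hspan p.vec
      obtain ⟨r, s, rfl⟩ := hΞ.exists_add_mul_of_comm hcomm hαK x
      have h01 : ∀ r : Ξ.gen, (r : K) = 0 ∨ (r : K) = 1 := fun r =>
        hF _ ((hΞ.mem_gen_iff hc).1 r.2)
      rcases h01 r with hr | hr <;> rcases h01 s with hs | hs <;> rw [hr, hs] at hx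
      · exact ⟨1, S.one_mem, by rw [hx, T.vec_one]; simp⟩
      · exact ⟨_, hl₂, by rw [hx, T.vec_lift]; simp⟩
      · exact ⟨_, hl₁, by rw [hx, T.vec_lift]; simp⟩
      · exact ⟨_, S.mul_mem hl₁ hl₂, by
          rw [hx, T.vec_mul, T.vec_lift, T.vec_lift, one_mul, rs_add, rs_one]⟩
    obtain ⟨r, hr, hrp⟩ := hS
    obtain ⟨u, hu, rfl⟩ := T.exists_cen_of_vec_eq hrp
    exact S.mul_mem hr (hcen u hu)
  by_cases hg1 : MulAut.conj g = 1
  · left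
    refine ⟨Φ, fun p => ?_⟩
    rw [hgoal, hg1]
    exact ⟨rfl, rfl⟩
  · right
    exact ⟨hΞ.nonempty_equiv_galoisField hF, hΞ'.nonempty_equiv_galoisField hF',
      finrank_eq_one_of_span ha hspan, Φ, mapT Φ, g, hΦi, hg1, hgoal⟩

end PseudoQuadraticSpace

namespace PseudoQuadraticSpace

/-- Coordinates on a two-dimensional space of type (iv): `K = ι(R) + ι(R) e` with `e² = -c`, and
`L = a K + b K` for orthogonal vectors `a`, `b` with `q(a) ≡ ω` and `q(b) ≡ m ω`. -/
structure Chart {K L R : Type*} [DivisionRing K] [StarRing K] [AddCommGroup L] [Module Kᵐᵒᵖ L]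
    [CommRing R] [StarRing R] (Ξ : PseudoQuadraticSpace K L) (ω c m : R) where
  ι : R →+* K
  e : K
  a : L
  b : L
  double : IsDouble ι e c
  star_c : star c = c
  star_m : star m = m
  mem_a : Ξ.q a - ι ω ∈ Ξ.K₀
  mem_b : Ξ.q b - ι (m * ω) ∈ Ξ.K₀
  orth : Ξ.f a b = 0
  map_mem : ∀ r, star r = r → ι r ∈ Ξ.K₀
  exists_of_mem : ∀ u ∈ Ξ.K₀, ∃ r, star r = r ∧ ι r = u
  exists_coord : ∀ x : K, ∃ s w, x = ι s + ι w * e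
  coord_eq_zero : ∀ s w, ι s + ι w * e = 0 → s = 0 ∧ w = 0
  exists_vec : ∀ v : L, ∃ x y : K, v = a <• x + b <• y
  vec_eq_zero : ∀ x y : K, a <• x + b <• y = 0 → x = 0 ∧ y = 0

namespace Chart

section

variable {R : Type*} [CommRing R] [StarRing R]

/-- The first coordinate of the pseudo-quadratic form. -/
def even (ω c m x₁ x₂ y₁ y₂ : R) : R :=
  star x₁ * ω * x₁ + c * x₂ * star ω * star x₂ +
    m * (star y₁ * ω * y₁ + c * y₂ * star ω * star y₂)

/-- The second coordinate of the pseudo-quadratic form. -/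
def odd (ω m x₁ x₂ y₁ y₂ : R) : R :=
  star x₁ * ω * x₂ - x₂ * star ω * star x₁ + m * (star y₁ * ω * y₂ - y₂ * star ω * star y₁)

/-- Half of the polar form of the norm. -/
def polar (ω c m x₁ x₂ y₁ y₂ x₁' x₂' y₁' y₂' : R) : R :=
  star x₁ * ω * x₁' + c * star x₂ * ω * x₂' + m * (star y₁ * ω * y₁' + c * star y₂ * ω * y₂')

end

variable {K L R : Type*} [DivisionRing K] [StarRing K] [AddCommGroup L] [Module Kᵐᵒᵖ L]
    [CommRing R] [StarRing R] {Ξ : PseudoQuadraticSpace K L} {ω c m : R} (C : Chart Ξ ω c m)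

/-- The element of `K` with the given coordinates. -/
def coord (s w : R) : K := C.ι s + C.ι w * C.e

/-- The vector with the given coordinates. -/
def vec (x₁ x₂ y₁ y₂ : R) : L := C.a <• C.coord x₁ x₂ + C.b <• C.coord y₁ y₂

/-- An element of `T` has the given coordinates. -/
structure Rep (p : Ξ.T) (x₁ x₂ y₁ y₂ u : R) : Prop where
  star_u : star u = u
  vec_eq : p.vec = C.vec x₁ x₂ y₁ y₂
  scal_eq : p.scal = C.coord (even ω c m x₁ x₂ y₁ y₂ + u) (odd ω m x₁ x₂ y₁ y₂)

theorem coord_mul (s w s' w' : R) : C.coord s w * C.coord s' w' =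
    C.coord (s * s' - c * w * star w') (s * w' + w * star s') := C.double.mul s w s' w'

theorem coord_add (s w s' w' : R) : C.coord s w + C.coord s' w' = C.coord (s + s') (w + w') := by
  simp only [coord, map_add, add_mul]; abel

theorem coord_zero_right (s : R) : C.coord s 0 = C.ι s := by simp [coord]

theorem coord_inj {s w s' w' : R} (h : C.coord s w = C.coord s' w') : s = s' ∧ w = w' := by
  have h₁ := C.coord_eq_zero (s - s') (w - w') (by
    rw [map_sub, map_sub, sub_mul, sub_add_sub_comm]
    exact sub_eq_zero.2 h)
  exact ⟨sub_eq_zero.1 h₁.1, sub_eq_zero.1 h₁.2⟩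

theorem coord_conj (r s w s' w' : R) : star (C.coord s w) * C.ι r * C.coord s' w' =
    C.coord (star s * r * s' + c * w * star r * star w')
      (star s * r * w' - w * star r * star s') := C.double.conj r s w s' w'

theorem vec_add (x₁ x₂ y₁ y₂ x₁' x₂' y₁' y₂' : R) :
    C.vec x₁ x₂ y₁ y₂ + C.vec x₁' x₂' y₁' y₂' =
      C.vec (x₁ + x₁') (x₂ + x₂') (y₁ + y₁') (y₂ + y₂') := by
  simp only [vec, ← coord_add, rs_add]; abel

theorem vec_inj {x₁ x₂ y₁ y₂ x₁' x₂' y₁' y₂' : R}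
    (h : C.vec x₁ x₂ y₁ y₂ = C.vec x₁' x₂' y₁' y₂') :
    x₁ = x₁' ∧ x₂ = x₂' ∧ y₁ = y₁' ∧ y₂ = y₂' := by
  obtain ⟨h₁, h₂⟩ := C.vec_eq_zero (C.coord x₁ x₂ - C.coord x₁' x₂')
    (C.coord y₁ y₂ - C.coord y₁' y₂') (by
      rw [rs_sub, rs_sub, sub_add_sub_comm]; exact sub_eq_zero.2 h)
  obtain ⟨h₃, h₄⟩ := C.coord_inj (sub_eq_zero.1 h₁)
  obtain ⟨h₅, h₆⟩ := C.coord_inj (sub_eq_zero.1 h₂)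
  exact ⟨h₃, h₄, h₅, h₆⟩

theorem vec_zero : C.vec 0 0 0 0 = 0 := by simp [vec, coord]

theorem exists_eq_vec (v : L) : ∃ x₁ x₂ y₁ y₂, v = C.vec x₁ x₂ y₁ y₂ := by
  obtain ⟨x, y, rfl⟩ := C.exists_vec v
  obtain ⟨x₁, x₂, rfl⟩ := C.exists_coord x
  obtain ⟨y₁, y₂, rfl⟩ := C.exists_coord y
  exact ⟨x₁, x₂, y₁, y₂, rfl⟩

theorem vec_smul (x₁ x₂ y₁ y₂ s w : R) : C.vec x₁ x₂ y₁ y₂ <• C.coord s w =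
    C.vec (x₁ * s - c * x₂ * star w) (x₁ * w + x₂ * star s)
      (y₁ * s - c * y₂ * star w) (y₁ * w + y₂ * star s) := by
  rw [vec, add_rs, ← rs_mul, ← rs_mul, coord_mul, coord_mul]; rfl

theorem form_eq (x₁ x₂ y₁ y₂ u : R) :
    star (C.coord x₁ x₂) * C.ι ω * C.coord x₁ x₂ +
      star (C.coord y₁ y₂) * C.ι (m * ω) * C.coord y₁ y₂ + C.ι u =
    C.coord (even ω c m x₁ x₂ y₁ y₂ + u) (odd ω m x₁ x₂ y₁ y₂) := by
  rw [coord_conj, coord_conj, ← C.coord_zero_right u, coord_add, coord_add, even, odd]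
  congr 1
  · simp only [star_mul, C.star_m]; ring
  · simp only [star_mul, C.star_m]; ring

/-- The element of `T` with the given coordinates and `u = 0`. -/
theorem exists_rep_zero (x₁ x₂ y₁ y₂ : R) : ∃ p, C.Rep p x₁ x₂ y₁ y₂ 0 := by
  refine ⟨(T.mk C.a _ C.mem_a).rsmul (C.coord x₁ x₂) * (T.mk C.b _ C.mem_b).rsmul (C.coord y₁ y₂),
    star_zero _, rfl, ?_⟩
  rw [T.scal_mul, T.vec_rsmul, T.vec_rsmul, Ξ.f_smul_left, Ξ.f_smul_right, T.vec_mk, T.vec_mk,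
    f_eq_zero_symm C.orth, zero_mul, mul_zero, add_zero, T.scal_rsmul, T.scal_rsmul, T.scal_mk,
    T.scal_mk, ← C.form_eq, map_zero, add_zero]

theorem Rep.mul_cen {p : Ξ.T} {x₁ x₂ y₁ y₂ u v : R} (h : C.Rep p x₁ x₂ y₁ y₂ u)
    (hv : star v = v) : C.Rep (p * T.cen _ (C.map_mem v hv)) x₁ x₂ y₁ y₂ (u + v) := by
  refine ⟨by rw [star_add, h.star_u, hv], by rw [T.vec_mul_cen, h.vec_eq], ?_⟩
  rw [T.scal_mul_cen, h.scal_eq, ← C.coord_zero_right v, coord_add, add_zero, add_assoc]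

theorem exists_rep_of_vec {p : Ξ.T} {x₁ x₂ y₁ y₂ : R} (h : p.vec = C.vec x₁ x₂ y₁ y₂) :
    ∃ u, C.Rep p x₁ x₂ y₁ y₂ u := by
  obtain ⟨r, hr⟩ := C.exists_rep_zero x₁ x₂ y₁ y₂
  obtain ⟨v, hv, rfl⟩ := T.exists_cen_of_vec_eq (hr.vec_eq.trans h.symm)
  obtain ⟨u, hu, rfl⟩ := C.exists_of_mem v hv
  exact ⟨_, hr.mul_cen C hu⟩

theorem exists_rep (p : Ξ.T) : ∃ x₁ x₂ y₁ y₂ u, C.Rep p x₁ x₂ y₁ y₂ u := by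
  obtain ⟨x₁, x₂, y₁, y₂, h⟩ := C.exists_eq_vec p.vec
  exact ⟨x₁, x₂, y₁, y₂, C.exists_rep_of_vec h⟩

theorem Rep.ext {p r : Ξ.T} {x₁ x₂ y₁ y₂ u : R} (hp : C.Rep p x₁ x₂ y₁ y₂ u)
    (hr : C.Rep r x₁ x₂ y₁ y₂ u) : p = r :=
  T.ext' (hp.vec_eq.trans hr.vec_eq.symm) (hp.scal_eq.trans hr.scal_eq.symm)

theorem Rep.unique {p : Ξ.T} {x₁ x₂ y₁ y₂ u x₁' x₂' y₁' y₂' u' : R}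
    (h : C.Rep p x₁ x₂ y₁ y₂ u) (h' : C.Rep p x₁' x₂' y₁' y₂' u') :
    x₁ = x₁' ∧ x₂ = x₂' ∧ y₁ = y₁' ∧ y₂ = y₂' ∧ u = u' := by
  obtain ⟨rfl, rfl, rfl, rfl⟩ := C.vec_inj (h.vec_eq.symm.trans h'.vec_eq)
  have := (C.coord_inj (h.scal_eq.symm.trans h'.scal_eq)).1
  exact ⟨rfl, rfl, rfl, rfl, add_left_cancel this⟩

theorem Rep.mul (hΞ : Ξ.IsProper) {p p' : Ξ.T} {x₁ x₂ y₁ y₂ u x₁' x₂' y₁' y₂' u' : R}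
    (h : C.Rep p x₁ x₂ y₁ y₂ u) (h' : C.Rep p' x₁' x₂' y₁' y₂' u') :
    C.Rep (p * p') (x₁ + x₁') (x₂ + x₂') (y₁ + y₁') (y₂ + y₂')
      (u + u' - (polar ω c m x₁ x₂ y₁ y₂ x₁' x₂' y₁' y₂' +
        star (polar ω c m x₁ x₂ y₁ y₂ x₁' x₂' y₁' y₂'))) := by
  refine ⟨?_, by rw [T.vec_mul, h.vec_eq, h'.vec_eq, vec_add], ?_⟩
  · rw [star_sub, star_add, star_add, star_star, h.star_u, h'.star_u, add_comm (star _)]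
  · have hfa : Ξ.f C.a C.a = C.ι (ω - star ω) := by
      have := hΞ.f_self (T.mk C.a _ C.mem_a)
      rwa [T.vec_mk, T.scal_mk, ← C.double.map_star, ← map_sub] at this
    have hfb : Ξ.f C.b C.b = C.ι (m * (ω - star ω)) := by
      have := hΞ.f_self (T.mk C.b _ C.mem_b)
      rwa [T.vec_mk, T.scal_mk, ← C.double.map_star, ← map_sub, star_mul, C.star_m,
        mul_comm (star ω), ← mul_sub] at this
    have hf : Ξ.f p'.vec p.vec = star (C.coord x₁' x₂') * C.ι (ω - star ω) * C.coord x₁ x₂ +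
        star (C.coord y₁' y₂') * C.ι (m * (ω - star ω)) * C.coord y₁ y₂ := by
      rw [h.vec_eq, h'.vec_eq, vec, vec, Ξ.f_add_left, Ξ.f_add_right, Ξ.f_add_right]
      simp only [Ξ.f_smul_left, Ξ.f_smul_right, C.orth, f_eq_zero_symm C.orth, hfa, hfb, zero_mul,
        mul_zero, add_zero, zero_add, mul_assoc]
    rw [T.scal_mul, h.scal_eq, h'.scal_eq, hf, coord_conj, coord_conj, coord_add, coord_add,
      coord_add]
    congr 1
    · simp only [even, polar, star_add, star_sub, star_mul, star_star, C.star_m, C.star_c]; ring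
    · simp only [odd, star_add, star_sub, star_mul, star_star, C.star_m]; ring

theorem Rep.vec_smul_scal {p : Ξ.T} {x₁ x₂ y₁ y₂ u : R} (h : C.Rep p x₁ x₂ y₁ y₂ u) :
    p.vec <• p.scal = C.vec
      (x₁ * (even ω c m x₁ x₂ y₁ y₂ + u) - c * x₂ * star (odd ω m x₁ x₂ y₁ y₂))
      (x₁ * odd ω m x₁ x₂ y₁ y₂ + x₂ * star (even ω c m x₁ x₂ y₁ y₂ + u))
      (y₁ * (even ω c m x₁ x₂ y₁ y₂ + u) - c * y₂ * star (odd ω m x₁ x₂ y₁ y₂))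
      (y₁ * odd ω m x₁ x₂ y₁ y₂ + y₂ * star (even ω c m x₁ x₂ y₁ y₂ + u)) := by
  rw [h.scal_eq, h.vec_eq, vec_smul]

/-- The product of a vector and its scalar in the coordinates of the other parametrization. -/
theorem Rep.vec_smul_scal_swap {K' L' : Type*} [DivisionRing K'] [StarRing K'] [AddCommGroup L']
    [Module K'ᵐᵒᵖ L'] {Ξ' : PseudoQuadraticSpace K' L'} (C' : Chart Ξ' ω m c)
    {x₁ x₂ y₁ y₂ u : R} (hu : star u = u) (hc : star c = c) (hm : star m = m) :
    C'.vec
      (x₁ * (even ω c m x₁ x₂ y₁ y₂ + u) - c * x₂ * star (odd ω m x₁ x₂ y₁ y₂))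
      (y₁ * (even ω c m x₁ x₂ y₁ y₂ + u) - c * y₂ * star (odd ω m x₁ x₂ y₁ y₂))
      (x₁ * odd ω m x₁ x₂ y₁ y₂ + x₂ * star (even ω c m x₁ x₂ y₁ y₂ + u))
      (y₁ * odd ω m x₁ x₂ y₁ y₂ + y₂ * star (even ω c m x₁ x₂ y₁ y₂ + u)) =
    C'.vec x₁ y₁ x₂ y₂ <•
      C'.coord (even ω m c x₁ y₁ x₂ y₂ + u) (odd ω c x₁ y₁ x₂ y₂) := by
  rw [vec_smul]
  congr 1 <;>
  · simp only [even, odd, star_add, star_sub, star_mul, star_star, hu, hc, hm]; ring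

variable {K' L' : Type*} [DivisionRing K'] [StarRing K'] [AddCommGroup L'] [Module K'ᵐᵒᵖ L']
  {Ξ' : PseudoQuadraticSpace K' L'} (C' : Chart Ξ' ω m c)

theorem isJordanIso (hΞ : Ξ.IsProper) (hΞ' : Ξ'.IsProper) (hc : Ξ.IsCentral)
    (hc' : Ξ'.IsCentral) (hl : ∃ l ∈ Ξ.K₀, l ≠ 0 ∧ l ≠ 1) {γ : Ξ.T → Ξ'.T}
    (h : ∀ p x₁ x₂ y₁ y₂ u, C.Rep p x₁ x₂ y₁ y₂ u → C'.Rep (γ p) x₁ y₁ x₂ y₂ u) :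
    IsJordanIso γ := by
  have hvec : ∀ p x₁ x₂ y₁ y₂, p.vec = C.vec x₁ x₂ y₁ y₂ → (γ p).vec = C'.vec x₁ y₁ x₂ y₂ := by
    intro p x₁ x₂ y₁ y₂ hp
    obtain ⟨u, hu⟩ := C.exists_rep_of_vec hp
    exact (h _ _ _ _ _ _ hu).vec_eq
  refine isJordanIso_of_mulEquiv hΞ hΞ' hc hc' hl ⟨fun p r hpr => ?_, fun p' => ?_⟩
    (fun p r => ?_) (fun u hu p r hr => ?_) (fun p r hr => ?_)
  · obtain ⟨x₁, x₂, y₁, y₂, u, hp⟩ := C.exists_rep p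
    obtain ⟨x₁', x₂', y₁', y₂', u', hr⟩ := C.exists_rep r
    have hp' := h _ _ _ _ _ _ hp
    have hr' := h _ _ _ _ _ _ hr
    rw [hpr] at hp'
    obtain ⟨rfl, rfl, rfl, rfl, rfl⟩ := hp'.unique C' hr'
    exact hp.ext C hr
  · obtain ⟨x₁, y₁, x₂, y₂, u, hp'⟩ := C'.exists_rep p'
    obtain ⟨r, hr⟩ := C.exists_rep_zero x₁ x₂ y₁ y₂
    have h₁ := hr.mul_cen C hp'.star_u
    rw [zero_add] at h₁
    exact ⟨_, (h _ _ _ _ _ _ h₁).ext C' hp'⟩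
  · obtain ⟨x₁, x₂, y₁, y₂, u, hp⟩ := C.exists_rep p
    obtain ⟨x₁', x₂', y₁', y₂', u', hr⟩ := C.exists_rep r
    have h₁ := h _ _ _ _ _ _ (hp.mul C hΞ hr)
    have h₂ := (h _ _ _ _ _ _ hp).mul C' hΞ' (h _ _ _ _ _ _ hr)
    have e₁ : polar ω m c x₁ y₁ x₂ y₂ x₁' y₁' x₂' y₂' =
        polar ω c m x₁ x₂ y₁ y₂ x₁' x₂' y₁' y₂' := by
      simp only [polar]; ring
    rw [e₁] at h₂
    exact h₁.ext C' h₂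
  · obtain ⟨x₁, x₂, y₁, y₂, v, hp⟩ := C.exists_rep p
    obtain ⟨u, hus, rfl⟩ := C.exists_of_mem u hu
    have h₀ : C.Rep (T.cen (C.ι u) hu) 0 0 0 0 u := ⟨hus, by rw [T.vec_cen, vec_zero], by
      rw [T.scal_cen, ← C.coord_zero_right]; simp [even, odd]⟩
    have h₁ := (h _ _ _ _ _ _ h₀).scal_eq
    have e₁ : even ω m c (0 : R) 0 0 0 = 0 := by simp [even]
    have e₂ : odd ω c (0 : R) 0 0 0 = 0 := by simp [odd]
    rw [e₁, e₂, zero_add] at h₁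
    rw [hp.vec_eq, ← C.coord_zero_right, vec_smul, hus] at hr
    rw [hvec _ _ _ _ _ hr, (h _ _ _ _ _ _ hp).vec_eq, h₁, vec_smul, hus]
    congr 1 <;> simp
  · obtain ⟨x₁, x₂, y₁, y₂, v, hp⟩ := C.exists_rep p
    rw [hp.vec_smul_scal] at hr
    have hp' := h _ _ _ _ _ _ hp
    rw [hvec _ _ _ _ _ hr, hp'.scal_eq, hp'.vec_eq,
      Rep.vec_smul_scal_swap C' hp.star_u C.star_c C.star_m]

theorem rep_γ (Q : QuadIso Ξ Ξ')
    (hvec : ∀ x₁ x₂ y₁ y₂, Q.φ₁ (C.vec x₁ x₂ y₁ y₂) = C'.vec x₁ y₁ x₂ y₂)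
    (hι : ∀ (u : R) (hu : star u = u), (Q.φ ⟨_, mem_gen (C.map_mem u hu)⟩ : K') = C'.ι u)
    {p : Ξ.T} {x₁ x₂ y₁ y₂ u : R} (h : C.Rep p x₁ x₂ y₁ y₂ u) :
    C'.Rep (Q.γ p) x₁ y₁ x₂ y₂ u := by
  refine ⟨h.star_u, by rw [Q.vec_γ, h.vec_eq, hvec], ?_⟩
  by_cases hp : p.vec = 0
  · obtain ⟨rfl, rfl, rfl, rfl⟩ := C.vec_inj (h.vec_eq.symm.trans (hp.trans C.vec_zero.symm))
    have h₁ := h.scal_eq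
    have e₁ : even ω c m (0 : R) 0 0 0 = 0 := by simp [even]
    have e₂ : odd ω m (0 : R) 0 0 0 = 0 := by simp [odd]
    have e₁' : even ω m c (0 : R) 0 0 0 = 0 := by simp [even]
    have e₂' : odd ω c (0 : R) 0 0 0 = 0 := by simp [odd]
    rw [e₁, e₂, zero_add, coord_zero_right] at h₁
    rw [Q.scal_γ_of_vec_eq_zero p hp, e₁', e₂', zero_add, coord_zero_right, ← hι u h.star_u]
    simp only [h₁]
  · refine rs_left_cancel (Q.φ₁_ne_zero hp) ?_
    rw [← Q.map_vec_scal, h.vec_smul_scal, hvec,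
      Rep.vec_smul_scal_swap C' h.star_u C.star_c C.star_m, h.vec_eq, hvec]

end Chart

end PseudoQuadraticSpace

namespace PseudoQuadraticSpace

/-- The homomorphism from the quadratic algebra with trace `τ` and norm `n` that is given by an
element `α` with `α² = τ α - n`. -/
def quadHom {F K : Type*} [CommRing F] [Ring K] {n τ : F} (κ : F →+* K) (α : K)
    (hκ : ∀ c x, κ c * x = x * κ c) (h : α * α = κ τ * α - κ n) :
    QuadraticAlgebra F (-n) τ →+* K where
  toFun z := κ z.re + κ z.im * α
  map_zero' := by simp
  map_one' := by simp [QuadraticAlgebra.re_one, QuadraticAlgebra.im_one]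
  map_add' x y := by
    simp only [QuadraticAlgebra.re_add, QuadraticAlgebra.im_add, map_add, add_mul]; abel
  map_mul' x y := by
    have e₁ : κ x.im * α * (κ y.im * α) = κ x.im * κ y.im * (α * α) := by
      rw [mul_assoc, ← mul_assoc α, ← hκ, mul_assoc, mul_assoc]
    have e₂ : κ x.im * α * κ y.re = κ x.im * κ y.re * α := by
      rw [mul_assoc, ← hκ, mul_assoc]
    have e₃ : κ x.im * κ y.im * (κ τ * α) = κ (τ * x.im * y.im) * α := by
      rw [← mul_assoc, ← map_mul, ← map_mul, mul_comm (x.im * y.im), mul_assoc τ]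
    have e₄ : κ x.im * κ y.im * κ n = κ (n * x.im * y.im) := by
      rw [← map_mul, ← map_mul, mul_comm (x.im * y.im), mul_assoc n]
    rw [add_mul, mul_add, mul_add, e₁, e₂, h, mul_sub, e₃, e₄]
    simp only [QuadraticAlgebra.re_mul, QuadraticAlgebra.im_mul, map_add, map_mul, map_neg,
      add_mul, neg_mul, mul_assoc]
    abel

variable {K L : Type*} [DivisionRing K] [StarRing K] [AddCommGroup L] [Module Kᵐᵒᵖ L]
variable {Ξ : PseudoQuadraticSpace K L}

/-- The coordinates on a two-dimensional space of type (iv) that are given by orthogonal elements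
`(a, α)` and `(b, m α)` of `T` and an element `e` of `K` with `e α = α^σ e`. -/
structure ChartData {F : Type*} [Field F] (Ξ : PseudoQuadraticSpace K L) (τ n c m : F) where
  proper : Ξ.IsProper
  central : Ξ.IsCentral
  κ : F →+* K
  κ_mem : ∀ c, κ c ∈ Ξ.K₀
  exists_κ : ∀ u ∈ Ξ.K₀, ∃ c, κ c = u
  a : Ξ.T
  b : Ξ.T
  e : K
  pair : Ξ.IsQuatPair a.scal e
  κ_τ : κ τ = a.scal + star a.scal
  κ_n : κ n = star a.scal * a.scal
  κ_c : κ c = star e * e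
  b_ne : b.vec ≠ 0
  scal_b : b.scal = κ m * a.scal
  orth : Ξ.f a.vec b.vec = 0
  exists_vec : ∀ v : L, ∃ x y : K, v = a.vec <• x + b.vec <• y

namespace ChartData

variable {F : Type*} [Field F] {τ n c m : F} (D : ChartData Ξ τ n c m)

theorem κ_comm (r : F) (x : K) : D.κ r * x = x * D.κ r := D.central _ (D.κ_mem r) x

theorem sq_eq : D.a.scal * D.a.scal = D.κ τ * D.a.scal - D.κ n := by
  rw [D.κ_τ, D.κ_n, sq_eq_tr_nm (Ξ := Ξ), coe_tr, coe_nm]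

theorem star_κ (r : F) : star (D.κ r) = D.κ r := Ξ.star_eq _ (D.κ_mem r)

/-- The embedding of the quadratic algebra. -/
def ι : QuadraticAlgebra F (-n) τ →+* K := quadHom D.κ D.a.scal D.κ_comm D.sq_eq

theorem ι_apply (z : QuadraticAlgebra F (-n) τ) : D.ι z = D.κ z.re + D.κ z.im * D.a.scal := rfl

theorem ι_algebraMap (r : F) : D.ι (algebraMap _ _ r) = D.κ r := by
  simp [ι_apply, QuadraticAlgebra.algebraMap_re, QuadraticAlgebra.algebraMap_im]

theorem ι_omega : D.ι (⟨0, 1⟩ : QuadraticAlgebra F (-n) τ) = D.a.scal := by simp [ι_apply]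

theorem ι_star (z : QuadraticAlgebra F (-n) τ) : D.ι (star z) = star (D.ι z) := by
  rw [ι_apply, ι_apply, QuadraticAlgebra.re_star, QuadraticAlgebra.im_star, star_add, star_mul,
    D.star_κ, D.star_κ, map_add, map_mul, map_neg, D.κ_τ, ← D.κ_comm z.im,
    ← D.κ_comm z.im]
  noncomm_ring

theorem ι_injective : Function.Injective D.ι := by
  rw [injective_iff_map_eq_zero]
  intro z hz
  have hα : D.a.scal ∉ Ξ.K₀ := fun h => D.pair.ne (Ξ.star_eq _ h)
  obtain ⟨h₁, h₂⟩ := D.proper.coe_add_coe_mul_eq_zero D.central hα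
    (r := ⟨_, mem_gen (D.κ_mem z.re)⟩) (s := ⟨_, mem_gen (D.κ_mem z.im)⟩) hz
  ext
  · exact (map_eq_zero D.κ).1 (congrArg Subtype.val h₁)
  · exact (map_eq_zero D.κ).1 (congrArg Subtype.val h₂)

theorem ι_comm (z : QuadraticAlgebra F (-n) τ) : D.ι z * D.a.scal = D.a.scal * D.ι z := by
  rw [← D.ι_omega, ← map_mul, ← map_mul, mul_comm]

theorem anti (z : QuadraticAlgebra F (-n) τ) : D.e * D.ι z = D.ι (star z) * D.e := by
  rw [D.ι_star, ι_apply, star_add, star_mul, D.star_κ, D.star_κ, mul_add, add_mul, D.κ_comm z.re,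
    D.κ_comm z.im, ← mul_assoc, D.pair.anti, mul_assoc, mul_assoc, D.κ_comm z.im]

theorem im_eq_zero_of_star (D : ChartData Ξ τ n c m) {z : QuadraticAlgebra F (-n) τ}
    (hz : star z = z) : z.im = 0 := by
  have h := D.ι_star z
  rw [hz, ι_apply, star_add, star_mul, D.star_κ, D.star_κ, add_right_inj, ← D.κ_comm] at h
  by_contra h0
  exact D.pair.ne (mul_left_cancel₀ ((map_ne_zero D.κ).2 h0) h).symm

/-- The coordinates that are given by the data. -/
def chart : Chart Ξ (⟨0, 1⟩ : QuadraticAlgebra F (-n) τ) (algebraMap _ _ c) (algebraMap _ _ m) where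
  ι := D.ι
  e := D.e
  a := D.a.vec
  b := D.b.vec
  double := by
    refine ⟨D.ι_star, D.anti, D.pair.star_e D.central, ?_⟩
    rw [D.ι_algebraMap, D.κ_c, D.pair.star_e D.central, neg_mul, neg_neg]
  star_c := by ext <;> simp [QuadraticAlgebra.algebraMap_re, QuadraticAlgebra.algebraMap_im]
  star_m := by ext <;> simp [QuadraticAlgebra.algebraMap_re, QuadraticAlgebra.algebraMap_im]
  mem_a := by rw [D.ι_omega]; exact D.a.mem
  mem_b := by rw [map_mul, D.ι_omega, D.ι_algebraMap, ← D.scal_b]; exact D.b.mem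
  orth := D.orth
  map_mem z hz := by
    rw [ι_apply, D.im_eq_zero_of_star hz, map_zero, zero_mul, add_zero]; exact D.κ_mem _
  exists_of_mem u hu := by
    obtain ⟨r, rfl⟩ := D.exists_κ u hu
    exact ⟨algebraMap _ _ r,
      by ext <;> simp [QuadraticAlgebra.algebraMap_re, QuadraticAlgebra.algebraMap_im],
      D.ι_algebraMap r⟩
  exists_coord x := by
    have hg : ∀ r : Ξ.gen, ∃ c, D.κ c = r := fun r =>
      D.exists_κ _ ((D.proper.mem_gen_iff D.central).1 r.2)
    obtain ⟨r, s, m, k, rfl⟩ := D.pair.exists_decomp D.proper D.central x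
    obtain ⟨r', hr⟩ := hg r
    obtain ⟨s', hs⟩ := hg s
    obtain ⟨m', hm⟩ := hg m
    obtain ⟨k', hk⟩ := hg k
    exact ⟨⟨r', s'⟩, ⟨m', k'⟩, by simp only [ι_apply, hr, hs, hm, hk]⟩
  coord_eq_zero s w h := by
    have hodd : D.ι w * D.e * D.a.scal = star D.a.scal * (D.ι w * D.e) := by
      have := D.anti ⟨0, 1⟩
      rw [D.ι_omega] at this
      rw [mul_assoc, this, ← mul_assoc, ← map_mul, mul_comm, map_mul, D.ι_star, D.ι_omega,
        mul_assoc]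
    obtain ⟨h₁, h₂⟩ := even_odd D.pair.ne (D.ι_comm s) hodd h
    exact ⟨D.ι_injective (by rw [h₁, map_zero]), D.ι_injective (by
      rw [(mul_eq_zero.1 h₂).resolve_right D.pair.e_ne, map_zero])⟩
  exists_vec := D.exists_vec
  vec_eq_zero x y h := by
    have hfa : Ξ.f D.a.vec D.a.vec ≠ 0 := by
      rw [D.proper.f_self]; exact sub_ne_zero.2 D.pair.ne.symm
    have h₁ := congrArg (Ξ.f D.a.vec) h
    rw [Ξ.f_add_right, Ξ.f_smul_right, Ξ.f_smul_right, D.orth, zero_mul, add_zero, f_zero_right]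
      at h₁
    have hx := (mul_eq_zero.1 h₁).resolve_left hfa
    rw [hx, rs_zero, zero_add, rs_eq_zero] at h
    exact ⟨hx, h.resolve_left D.b_ne⟩

end ChartData

end PseudoQuadraticSpace

namespace PseudoQuadraticSpace

variable {K L : Type*} [DivisionRing K] [StarRing K] [AddCommGroup L] [Module Kᵐᵒᵖ L]
variable {Ξ : PseudoQuadraticSpace K L}

namespace Frame

variable (fr : Frame Ξ)

theorem star_q_ne (hΞ : Ξ.IsProper) : star (Ξ.q fr.a) ≠ Ξ.q fr.a := fun h => fr.f_self (by
  have := hΞ.f_self (T.lift fr.a)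
  rwa [T.vec_lift, T.scal_lift, h, sub_self] at this)

theorem pair (hΞ : Ξ.IsProper) (hc : Ξ.IsCentral) : Ξ.IsQuatPair (Ξ.q fr.a) fr.e :=
  (hΞ.isPerp_iff hc (T.lift fr.a) (fr.star_q_ne hΞ)).1 fr.perp

theorem f_vec (third : Bool) : Ξ.f fr.a (fr.vec third) = 0 := by
  cases third
  · exact fr.f_orth
  · exact (Ξ.f_smul_right _ _ _).trans (by rw [fr.f_orth, zero_mul])

theorem vec_ne (third : Bool) : fr.vec third ≠ 0 := by
  cases third
  · exact fr.b_ne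
  · exact fun h => (rs_eq_zero.1 h).elim fr.b_ne fr.perp.1

theorem vec_ne_smul (third : Bool) (x : K) : fr.vec third ≠ fr.a <• x := by
  intro h
  have h₁ := fr.f_vec third
  rw [h, Ξ.f_smul_right] at h₁
  exact fr.vec_ne third (by rw [h, (mul_eq_zero.1 h₁).resolve_left fr.f_self, rs_zero])

theorem q_vec (hΞ : Ξ.IsProper) (hc : Ξ.IsCentral) (hn : ∃ x y : K, x * y ≠ y * x)
    (third : Bool) : Ξ.q (fr.vec third) - fr.coeff third * Ξ.q fr.a ∈ Ξ.K₀ := by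
  have hK : ∀ z : Subring.center K, (z : K) ∈ Ξ.K₀ := fun z =>
    (hΞ.mem_K₀_iff_mem_center hc hn).2 z.2
  cases third
  · exact fr.q_b
  · have h₁ := Ξ.q_smul fr.b fr.e
    have h₂ := Ξ.conj_mem fr.e _ fr.q_b
    have h₃ := hΞ.mul_mem_K₀ hc (hΞ.mul_mem_K₀ hc (hK fr.μ) (hK fr.ν)) (Ξ.trace_mem (Ξ.q fr.a))
    have h₄ : star fr.e * (fr.μ * Ξ.q fr.a) * fr.e = fr.μ * fr.ν * star (Ξ.q fr.a) := by
      have := (fr.pair hΞ hc).star_mul_mul hc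
      rw [coe_nm, fr.norm_e] at this
      rw [← mul_assoc, ← hc _ (hK fr.μ), mul_assoc, mul_assoc, ← mul_assoc (star fr.e), this,
        mul_assoc]
    have h := add_mem (add_mem h₁ h₂) h₃
    convert h using 1
    change Ξ.q (fr.b <• fr.e) - ((-(fr.μ * fr.ν) : Subring.center K) : K) * Ξ.q fr.a = _
    rw [mul_sub, sub_mul, h₄]
    push_cast
    noncomm_ring

/-- The coordinates that are given by a frame. -/
def chartData (hΞ : Ξ.IsProper) (hc : Ξ.IsCentral) (hn : ∃ x y : K, x * y ≠ y * x)
    (h2 : Module.finrank Kᵐᵒᵖ L = 2) (third : Bool) :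
    ChartData Ξ fr.τ fr.n fr.ν (fr.coeff third) where
  proper := hΞ
  central := hc
  κ := (Subring.center K).subtype
  κ_mem z := (hΞ.mem_K₀_iff_mem_center hc hn).2 z.2
  exists_κ u hu := ⟨⟨u, (hΞ.mem_K₀_iff_mem_center hc hn).1 hu⟩, rfl⟩
  a := T.lift fr.a
  b := T.mk (fr.vec third) (fr.coeff third * Ξ.q fr.a) (fr.q_vec hΞ hc hn third)
  e := fr.e
  pair := fr.pair hΞ hc
  κ_τ := fr.trace_eq.symm
  κ_n := fr.norm_eq.symm
  κ_c := fr.norm_e.symm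
  b_ne := fr.vec_ne third
  scal_b := rfl
  orth := fr.f_vec third
  exists_vec := exists_eq_add_of_finrank_eq_two h2
    (fun h => fr.f_self (by rw [T.vec_lift] at h; rw [h, f_zero_left])) (fr.vec_ne_smul third)

end Frame

/-- The element `s + w j` of a quaternion algebra. -/
def quat {F : Type*} [CommRing F] {n τ c : F} (s w : QuadraticAlgebra F (-n) τ) :
    ℍ[F, -n, τ, -c] := ⟨s.re, s.im, w.re, w.im⟩

section Iso

variable {K' L' : Type*} [DivisionRing K'] [StarRing K'] [AddCommGroup L'] [Module K'ᵐᵒᵖ L']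
  {Ξ' : PseudoQuadraticSpace K' L'} {fr : Frame Ξ'} {third : Bool}

/-- The isomorphism `Φ` is given in coordinates by the identity. -/
structure ChartData.Compatible (D : ChartData Ξ fr.τ fr.n (fr.coeff third) fr.ν)
    (Φ : PseudoQuadraticIso Ξ.K₀ Ξ.q (fr.center₀ third) (fr.form third)) : Prop where
  φ_coord : ∀ s w, Φ.φ (D.chart.coord s w) = quat s w
  φ₁_add : ∀ x y, Φ.φ₁ (D.a.vec <• x + D.b.vec <• y) = (Φ.φ x, Φ.φ y)

theorem ChartData.Compatible.switch_eq {D : ChartData Ξ fr.τ fr.n (fr.coeff third) fr.ν}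
    {Φ : PseudoQuadraticIso Ξ.K₀ Ξ.q (fr.center₀ third) (fr.form third)} (h : D.Compatible Φ)
    (hΞ' : Ξ'.IsProper) (hc' : Ξ'.IsCentral) (hn' : ∃ x y : K', x * y ≠ y * x)
    (h2 : Module.finrank K'ᵐᵒᵖ L' = 2) {p : Ξ.T} {x₁ x₂ y₁ y₂ u} (hp : D.chart.Rep p x₁ x₂ y₁ y₂ u)
    (p' : Ξ'.T) : (p'.vec, p'.scal) = fr.switch third (Φ.φ₁ p.vec, Φ.φ p.scal) ↔
      (fr.chartData hΞ' hc' hn' h2 third).chart.Rep p' x₁ y₁ x₂ y₂ u := by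
  set D' := fr.chartData hΞ' hc' hn' h2 third with hD'
  have hvec : Φ.φ₁ p.vec = (quat x₁ x₂, quat y₁ y₂) := by
    rw [hp.vec_eq, ← h.φ_coord, ← h.φ_coord, ← h.φ₁_add]; rfl
  have hu : u.im = 0 := D.im_eq_zero_of_star hp.star_u
  have hι : ∀ r, Φ.φ (D.ι r) = quat r 0 := fun r => by
    rw [← h.φ_coord, Chart.coord_zero_right]; rfl
  have hscal : Φ.φ p.scal = fr.form third (quat x₁ x₂, quat y₁ y₂) + quat u 0 := by
    rw [hp.scal_eq, ← D.chart.form_eq, map_add, map_add, map_mul, map_mul, map_mul, map_mul,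
      Φ.map_star, Φ.map_star, h.φ_coord, h.φ_coord, ← hι u, Frame.form]
    congr 2
    · congr 2
      exact hι _
    · have : Φ.φ (D.chart.ι (algebraMap _ _ fr.ν * ⟨0, 1⟩)) =
          fr.ν • (⟨0, 1, 0, 0⟩ : fr.Alg third) := by
        refine (hι _).trans ?_
        ext <;> simp [quat, QuadraticAlgebra.algebraMap_re, QuadraticAlgebra.algebraMap_im]
      rw [this, mul_smul_comm, smul_mul_assoc]
  have hsw : fr.switch third (Φ.φ₁ p.vec, Φ.φ p.scal) = (D'.chart.vec x₁ y₁ x₂ y₂,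
      D'.chart.coord (Chart.even ⟨0, 1⟩ (algebraMap _ _ fr.ν) (algebraMap _ _ (fr.coeff third))
        x₁ y₁ x₂ y₂ + u) (Chart.odd ⟨0, 1⟩ (algebraMap _ _ (fr.coeff third)) x₁ y₁ x₂ y₂)) := by
    have hX : fr.coordA third (quat x₁ x₂, quat y₁ y₂) = D'.chart.coord x₁ y₁ := rfl
    have hY : fr.coordB third (quat x₁ x₂, quat y₁ y₂) = D'.chart.coord x₂ y₂ := rfl
    have hω : D'.chart.ι ⟨0, 1⟩ = Ξ'.q fr.a := D'.ι_omega
    have hmω : D'.chart.ι (algebraMap _ _ (fr.coeff third) * ⟨0, 1⟩) =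
        fr.coeff third * Ξ'.q fr.a := by
      rw [map_mul, hω]
      congr 1
      exact D'.ι_algebraMap _
    have hιu : D'.chart.ι u = u.re := by
      refine (D'.ι_apply u).trans ?_
      rw [hu, map_zero, zero_mul, add_zero]; rfl
    rw [hvec, hscal, ← D'.chart.form_eq, hω, hmω, hιu, Frame.switch]
    simp only [add_sub_cancel_left]
    rw [hX, hY]
    refine Prod.ext rfl ?_
    have hcf : ∀ x : K', (fr.coeff third : K') * x = x * fr.coeff third :=
      fun x => hc' _ ((hΞ'.mem_K₀_iff_mem_center hc' hn').2 (fr.coeff third).2) x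
    change _ + _ + _ = _ + _ + _
    congr 2
    rw [← mul_assoc, ← mul_assoc, ← mul_assoc, hcf]
  rw [hsw]
  constructor
  · intro h'
    exact ⟨hp.star_u, (Prod.ext_iff.1 h').1, (Prod.ext_iff.1 h').2⟩
  · intro h'
    exact Prod.ext h'.vec_eq h'.scal_eq

end Iso

end PseudoQuadraticSpace

namespace PseudoQuadraticSpace

variable {K L : Type*} [DivisionRing K] [StarRing K] [AddCommGroup L] [Module Kᵐᵒᵖ L]
  {Ξ : PseudoQuadraticSpace K L}
  {K' L' : Type*} [DivisionRing K'] [StarRing K'] [AddCommGroup L'] [Module K'ᵐᵒᵖ L']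
  {Ξ' : PseudoQuadraticSpace K' L'} {fr : Frame Ξ'} {third : Bool}

/-- An isomorphism onto another parametrization provides coordinates. -/
theorem exists_compatible_chartData (hΞ : Ξ.IsProper) (hc : Ξ.IsCentral) (hΞ' : Ξ'.IsProper)
    (Φ : PseudoQuadraticIso Ξ.K₀ Ξ.q (fr.center₀ third) (fr.form third)) :
    ∃ D : ChartData Ξ fr.τ fr.n (fr.coeff third) fr.ν, D.Compatible Φ := by
  set i : fr.Alg third := ⟨0, 1, 0, 0⟩ with hi
  set j : fr.Alg third := ⟨0, 0, 1, 0⟩ with hj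
  have hsym : ∀ x, Φ.φ (star (Φ.φ.symm x)) = star x := fun x => by
    rw [Φ.map_star, RingEquiv.apply_symm_apply]
  have hsum : ∀ x y, Φ.φ₁.symm (1, 0) <• x + Φ.φ₁.symm (0, 1) <• y =
      Φ.φ₁.symm (Φ.φ x, Φ.φ y) := fun x y => by
    apply Φ.φ₁.injective
    rw [map_add, Φ.map_smul, Φ.map_smul, AddEquiv.apply_symm_apply, AddEquiv.apply_symm_apply,
      AddEquiv.apply_symm_apply]
    ext <;> simp
  have hq : ∀ X Y, Ξ.q (Φ.φ₁.symm (X, Y)) -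
      Φ.φ.symm (star X * i * X + fr.ν • (star Y * i * Y)) ∈ Ξ.K₀ := fun X Y => by
    have := Φ.map_q (Φ.φ₁.symm (X, Y))
    rw [AddEquiv.apply_symm_apply] at this
    rw [← Φ.map_mem, map_sub, RingEquiv.apply_symm_apply]
    exact this
  let κ : Subring.center K' →+* K := (Φ.φ.symm : fr.Alg third →+* K).comp (algebraMap _ _)
  have hκ : ∀ c, Φ.φ (κ c) = algebraMap _ _ c := fun c => Φ.φ.apply_symm_apply _
  have hsmul : ∀ (c : Subring.center K') (x : fr.Alg third), Φ.φ.symm (c • x) =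
      κ c * Φ.φ.symm x := fun c x => by rw [Algebra.smul_def, map_mul]; rfl
  have hsi : Φ.φ (star (Φ.φ.symm i)) = ⟨fr.τ, -1, 0, 0⟩ := by
    rw [hsym]; ext <;> simp [hi]
  have hne : star (Φ.φ.symm i) ≠ Φ.φ.symm i := by
    intro h
    have h₁ := congrArg Φ.φ h
    rw [hsi, RingEquiv.apply_symm_apply] at h₁
    have h₂ : fr.τ = 0 := congrArg QuaternionAlgebra.re h₁
    have h₃ : (-1 : Subring.center K') = 1 := congrArg QuaternionAlgebra.imI h₁
    apply fr.star_q_ne hΞ'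
    have h₄ := fr.trace_eq
    have h₅ : (-1 : K') = 1 := congrArg Subtype.val h₃
    rw [h₂, ZeroMemClass.coe_zero] at h₄
    rw [eq_neg_of_add_eq_zero_right h₄, neg_eq_neg_one_mul, h₅, one_mul]
  have horth : Ξ.f (Φ.φ₁.symm (1, 0)) (Φ.φ₁.symm (0, 1)) = 0 := by
    refine hΞ.f_eq fun t => ?_
    have h₁ := hsum 1 t
    have h₂ := hsum 0 t
    rw [rs_one, map_one] at h₁
    rw [rs_zero, zero_add, map_zero] at h₂
    have h := sub_mem (sub_mem (hq 1 (Φ.φ t)) (hq 1 0)) (hq 0 (Φ.φ t))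
    rw [h₁, h₂]
    convert h using 1
    simp only [star_zero, zero_mul, mul_zero, smul_zero, add_zero, zero_add, map_add]
    abel
  refine ⟨⟨hΞ, hc, κ, fun c => ?_, fun u hu => ?_, T.mk (Φ.φ₁.symm (1, 0)) (Φ.φ.symm i) ?_,
    T.mk (Φ.φ₁.symm (0, 1)) (κ fr.ν * Φ.φ.symm i) ?_, Φ.φ.symm j, ⟨hne, ?_, ?_⟩, ?_, ?_, ?_, ?_,
    rfl, horth, fun v => ?_⟩, ⟨fun s w => ?_, fun x y => ?_⟩⟩
  · rw [← Φ.map_mem, hκ]; exact ⟨c, rfl⟩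
  · rw [← Φ.map_mem] at hu
    obtain ⟨c, hc⟩ := hu
    exact ⟨c, Φ.φ.injective ((hκ c).trans hc)⟩
  · simpa using hq 1 0
  · rw [← hsmul]; simpa using hq 0 1
  · intro h
    have h₁ := (map_eq_zero_iff Φ.φ.symm Φ.φ.symm.injective).1 h
    have h₂ : (1 : Subring.center K') = 0 := congrArg QuaternionAlgebra.imJ h₁
    exact one_ne_zero h₂
  · apply Φ.φ.injective
    rw [T.scal_mk, map_mul, map_mul, hsi, RingEquiv.apply_symm_apply, RingEquiv.apply_symm_apply]
    ext <;> simp [hi, hj]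
  · apply Φ.φ.injective
    rw [T.scal_mk, hκ, map_add, hsi, RingEquiv.apply_symm_apply]
    ext <;> simp [hi]
  · apply Φ.φ.injective
    rw [T.scal_mk, hκ, map_mul, hsi, RingEquiv.apply_symm_apply]
    ext <;> simp [hi]
  · apply Φ.φ.injective
    rw [hκ, map_mul, hsym, RingEquiv.apply_symm_apply]
    ext <;> simp [hj]
  · intro h
    have h₁ := (map_eq_zero_iff Φ.φ₁.symm Φ.φ₁.symm.injective).1 h
    exact one_ne_zero (Prod.ext_iff.1 h₁).2
  · obtain ⟨⟨X, Y⟩, rfl⟩ := Φ.φ₁.symm.surjective v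
    exact ⟨Φ.φ.symm X, Φ.φ.symm Y, by
      rw [T.vec_mk, T.vec_mk, hsum, RingEquiv.apply_symm_apply, RingEquiv.apply_symm_apply]⟩
  · change Φ.φ ((κ s.re + κ s.im * Φ.φ.symm i) + (κ w.re + κ w.im * Φ.φ.symm i) * Φ.φ.symm j) = _
    simp only [map_add, map_mul, hκ, RingEquiv.apply_symm_apply]
    ext <;> simp [hi, hj, quat]
  · exact (congrArg Φ.φ₁ (hsum x y)).trans (Φ.φ₁.apply_symm_apply _)

/-- Coordinates provide an isomorphism onto another parametrization. -/
theorem exists_compatible_iso (D : ChartData Ξ fr.τ fr.n (fr.coeff third) fr.ν) :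
    ∃ Φ : PseudoQuadraticIso Ξ.K₀ Ξ.q (fr.center₀ third) (fr.form third), D.Compatible Φ := by
  obtain ⟨g, hg₁, hg₂⟩ := D.pair.exists_equiv D.proper D.central D.κ D.κ_mem D.exists_κ
    (c₁ := -fr.n) (c₂ := fr.τ) (c₃ := -fr.coeff third) (by rw [map_neg, D.κ_n]) D.κ_τ
    (by rw [map_neg, D.κ_c, D.pair.star_e D.central, neg_mul, neg_neg])
  have hcoord : ∀ s w, g (quat s w) = D.chart.coord s w := fun s w => hg₂ _
  let ψ : fr.Alg third × fr.Alg third ≃+ L := AddEquiv.ofBijective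
    (AddMonoidHom.mk' (fun v => D.a.vec <• g v.1 + D.b.vec <• g v.2) fun v w => by
      simp only [Prod.fst_add, Prod.snd_add, map_add, rs_add]; abel) ⟨by
        rw [injective_iff_map_eq_zero]
        intro v hv
        obtain ⟨h₁, h₂⟩ := D.chart.vec_eq_zero _ _ hv
        exact Prod.ext ((map_eq_zero_iff g g.injective).1 h₁)
          ((map_eq_zero_iff g g.injective).1 h₂), fun v => by
        obtain ⟨x, y, rfl⟩ := D.exists_vec v
        exact ⟨(g.symm x, g.symm y), by simp⟩⟩
  have hψ : ∀ v, ψ v = D.a.vec <• g v.1 + D.b.vec <• g v.2 := fun v => rfl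
  have hκ : ∀ c, g (algebraMap _ _ c) = D.κ c := fun c => by rw [hg₂]; simp
  have hi : g ⟨0, 1, 0, 0⟩ = D.a.scal := by rw [hg₂]; simp
  have hmem : ∀ x, x ∈ fr.center₀ third ↔ g x ∈ Ξ.K₀ := by
    intro x
    constructor
    · rintro ⟨c, rfl⟩
      change g (algebraMap _ _ c) ∈ _
      rw [hκ]; exact D.κ_mem c
    · intro h
      obtain ⟨c, hc⟩ := D.exists_κ _ h
      exact ⟨c, g.injective ((hκ c).trans hc)⟩
  have hq : ∀ v, Ξ.q (ψ v) - g (fr.form third v) ∈ Ξ.K₀ := by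
    intro v
    have := (D.a.rsmul (g v.1) * D.b.rsmul (g v.2)).mem
    rw [T.vec_mul, T.scal_mul, T.vec_rsmul, T.vec_rsmul, Ξ.f_smul_left, Ξ.f_smul_right,
      f_eq_zero_symm D.orth, zero_mul, mul_zero, add_zero, T.scal_rsmul, T.scal_rsmul, ← hψ,
      D.scal_b] at this
    rw [Frame.form, Algebra.smul_def, map_add, map_mul, map_mul, map_mul, map_mul, map_mul, hg₁,
      hg₁, hκ, hi]
    convert this using 3
    rw [← mul_assoc, ← mul_assoc, ← mul_assoc, D.κ_comm]
  refine ⟨⟨g.symm, ψ.symm, fun v t => ?_, fun x => ?_, fun x => ?_, fun v => ?_⟩,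
    ⟨fun s w => ?_, fun x y => ?_⟩⟩
  · obtain ⟨v, rfl⟩ := ψ.surjective v
    apply ψ.injective
    rw [AddEquiv.apply_symm_apply, AddEquiv.symm_apply_apply, hψ, hψ, add_rs, ← rs_mul, ← rs_mul]
    simp
  · apply g.injective
    rw [hg₁, RingEquiv.apply_symm_apply, RingEquiv.apply_symm_apply]
  · rw [hmem, RingEquiv.apply_symm_apply]
  · obtain ⟨v, rfl⟩ := ψ.surjective v
    rw [hmem, map_sub, RingEquiv.apply_symm_apply, AddEquiv.symm_apply_apply]
    exact hq v
  · change g.symm _ = _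
    rw [← hcoord, RingEquiv.symm_apply_apply]
  · change ψ.symm _ = (g.symm x, g.symm y)
    rw [AddEquiv.symm_apply_eq, hψ]
    simp

theorem CaseII.isJordanIso {γ : Ξ.T → Ξ'.T} (hΞ : Ξ.IsProper) (hΞ' : Ξ'.IsProper)
    (h : CaseII γ) : IsJordanIso γ := by
  obtain ⟨h₁, h₂, -, h2, -, fr, third, Φ, hΦ⟩ := h
  obtain ⟨hc, hn⟩ := hΞ.isTypeIV_iff.1 h₁
  obtain ⟨hc', hn'⟩ := hΞ'.isTypeIV_iff.1 h₂
  obtain ⟨D, hD⟩ := exists_compatible_chartData hΞ hc hΞ' Φ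
  refine Chart.isJordanIso D.chart (fr.chartData hΞ' hc' hn' h2 third).chart hΞ hΞ' hc hc'
    (exists_ne_of_not_comm Ξ hn) fun p x₁ x₂ y₁ y₂ u hp => ?_
  exact (hD.switch_eq hΞ' hc' hn' h2 hp _).1 (hΦ p)

theorem inducedViaFrame_of_chartData {γ : Ξ.T → Ξ'.T} (hΞ' : Ξ'.IsProper) (hc' : Ξ'.IsCentral)
    (hn' : ∃ x y : K', x * y ≠ y * x) (h2 : Module.finrank K'ᵐᵒᵖ L' = 2)
    (D : ChartData Ξ fr.τ fr.n (fr.coeff third) fr.ν)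
    (h : ∀ p x₁ x₂ y₁ y₂ u, D.chart.Rep p x₁ x₂ y₁ y₂ u →
      (fr.chartData hΞ' hc' hn' h2 third).chart.Rep (γ p) x₁ y₁ x₂ y₂ u) :
    InducedViaFrame fr γ := by
  obtain ⟨Φ, hΦ⟩ := exists_compatible_iso D
  refine ⟨third, Φ, fun p => ?_⟩
  obtain ⟨x₁, x₂, y₁, y₂, u, hp⟩ := D.chart.exists_rep p
  exact (hΦ.switch_eq hΞ' hc' hn' h2 hp _).2 (h _ _ _ _ _ _ hp)

end PseudoQuadraticSpace

namespace PseudoQuadraticSpace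

section

variable {K L : Type*} [DivisionRing K] [StarRing K] [AddCommGroup L] [Module Kᵐᵒᵖ L]
  {Ξ : PseudoQuadraticSpace K L}

/-- If the conjugate of `α` by `y` commutes with `α`, then it is `α` or `α^σ`. -/
theorem comm_or_anti (hc : Ξ.IsCentral) {α y : K} (hy : y ≠ 0)
    (h : star y * α * y * α = α * (star y * α * y)) : y * α = α * y ∨ y * α = star α * y := by
  have hN : star y * y ∈ Ξ.K₀ := star_mul_self_mem y
  have hN0 : star y * y ≠ 0 := mul_ne_zero (star_ne_zero.2 hy) hy
  set z := y⁻¹ * α * y with hz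
  have hyz : star y * α * y = star y * y * z := by
    rw [hz]; simp only [mul_assoc]; rw [mul_inv_cancel_left₀ hy]
  have hzα : z * α = α * z := by
    rw [hyz, mul_assoc, ← mul_assoc α, ← hc _ hN α, mul_assoc (star y * y)] at h
    exact mul_left_cancel₀ hN0 h
  have hconj : ∀ u ∈ Ξ.K₀, y⁻¹ * u * y = u := fun u hu => by
    rw [mul_assoc, hc u hu, inv_mul_cancel_left₀ hy]
  have hsq : z * z = (α + star α) * z - star α * α := by
    have e₁ : z * z = y⁻¹ * (α * α) * y := by
      rw [hz]; simp only [mul_assoc]; rw [mul_inv_cancel_left₀ hy]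
    rw [e₁, sq_eq_tr_nm (Ξ := Ξ) α, coe_tr, coe_nm, mul_sub, sub_mul,
      hconj _ (star_mul_self_mem α), hc _ (Ξ.trace_mem α) α, ← mul_assoc, mul_assoc,
      hc _ (Ξ.trace_mem α) y, ← mul_assoc, ← hc _ (Ξ.trace_mem α)]
  have hprod : (z - α) * (z - star α) = 0 := by
    have e₁ : z * star α = (α + star α) * z - α * z := by
      rw [hc _ (Ξ.trace_mem α), ← hzα, ← mul_sub]; congr 1; abel
    rw [sub_mul, mul_sub, mul_sub, hsq, e₁, hc.star_mul_self]
    abel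
  rcases mul_eq_zero.1 hprod with h₁ | h₁
  · left
    have : y * z = α * y := by rw [hz, ← mul_assoc, mul_inv_cancel_left₀ hy]
    rw [← this, sub_eq_zero.1 h₁]
  · right
    have : y * z = α * y := by rw [hz, ← mul_assoc, mul_inv_cancel_left₀ hy]
    rw [sub_eq_zero.1 h₁] at this
    have h₂ := anti_star_of_anti Ξ hc (α := star α) (z := y) (by rw [star_star]; exact this)
    rwa [star_star] at h₂

theorem IsProper.exists_star_scal_ne (hΞ : Ξ.IsProper) : ∃ p : Ξ.T, star p.scal ≠ p.scal := by
  by_contra! h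
  have hf : ∀ a, Ξ.f a a = 0 := fun a => by
    have := hΞ.f_self (T.lift a)
    rwa [h, sub_self] at this
  obtain ⟨x, hx⟩ := hΞ.1
  obtain ⟨a, ha⟩ := hΞ.2.1
  refine ha (hΞ.2.2 a fun b => ?_)
  by_contra hd
  have hs : ∀ c, star (Ξ.f a c) = Ξ.f a c := fun c => by
    have h₁ := hf (a + c)
    rw [Ξ.f_add_left, Ξ.f_add_right, Ξ.f_add_right, hf, hf, zero_add, add_zero] at h₁
    rw [star_f, eq_neg_of_add_eq_zero_left h₁]
  have h₁ := hs (b <• ((Ξ.f a b)⁻¹ * x))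
  rw [Ξ.f_smul_right, mul_inv_cancel_left₀ hd] at h₁
  exact hx h₁

theorem exists_eq_smul_of_f_eq_zero {a b c : L} (ha : Ξ.f a a ≠ 0) (hab : Ξ.f a b = 0)
    (hac : Ξ.f a c = 0) (h : ∃ x y : K, c = a <• x + b <• y) : ∃ y : K, c = b <• y := by
  obtain ⟨x, y, rfl⟩ := h
  rw [Ξ.f_add_right, Ξ.f_smul_right, Ξ.f_smul_right, hab, zero_mul, add_zero] at hac
  exact ⟨y, by rw [(mul_eq_zero.1 hac).resolve_left ha, rs_zero, zero_add]⟩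

theorem IsCentral.eq_of_mul_sub_mem (hc : Ξ.IsCentral) {α x y : K}
    (hα : star α ≠ α) (hx : x ∈ Ξ.K₀) (hy : y ∈ Ξ.K₀) (h : x * α - y * α ∈ Ξ.K₀) : x = y := by
  have h₁ := Ξ.star_eq _ h
  rw [← sub_mul, star_mul, Ξ.star_eq _ (sub_mem hx hy), ← hc _ (sub_mem hx hy)] at h₁
  by_contra hne
  exact hα (mul_left_cancel₀ (sub_ne_zero.2 hne) h₁)

end

variable {K L K' L' : Type*} [DivisionRing K] [StarRing K] [AddCommGroup L] [Module Kᵐᵒᵖ L]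
  [DivisionRing K'] [StarRing K'] [AddCommGroup L'] [Module K'ᵐᵒᵖ L']
  {Ξ : PseudoQuadraticSpace K L} {Ξ' : PseudoQuadraticSpace K' L'}

theorem Chart.eq_e_of_eq {R : Type*} [CommRing R] [StarRing R] {ω c m : R} (C : Chart Ξ ω c m)
    {y : K} (hω : star (C.ι ω) ≠ C.ι ω) (h0 : 1 + C.ι c ≠ 0)
    (h : (star (C.ι ω) + y * C.ι ω) * (1 + C.ι c) =
      (1 + y) * (star (C.ι ω) + C.ι c * C.ι ω + (star (C.ι ω) - C.ι ω) * C.e)) :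
    y = C.e := by
  obtain ⟨s, t, rfl⟩ : ∃ s t, y = C.coord s t := C.exists_coord y
  have hinj : ∀ x, C.ι x = 0 → x = 0 := fun x hx =>
    (C.coord_eq_zero x 0 (by rw [hx, map_zero, zero_mul, add_zero])).1
  have hdom : ∀ x y : R, x * y = 0 → x = 0 ∨ y = 0 := fun x y hxy => by
    have h₁ := congrArg C.ι hxy
    rw [map_mul, map_zero] at h₁
    exact (mul_eq_zero.1 h₁).imp (hinj x) (hinj y)
  have e₅ : C.e = C.coord 0 1 := by rw [Chart.coord, map_zero, map_one, zero_add, one_mul]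
  rw [← C.double.map_star] at h hω
  have hω0 : star ω - ω ≠ 0 := fun h => hω (by rw [sub_eq_zero.1 h])
  have hc0 : 1 + c ≠ 0 := fun h => h0 (by rw [← map_one C.ι, ← map_add, h, map_zero])
  rw [← map_one C.ι, ← map_mul, ← map_add, ← map_add, ← map_sub, ← C.coord_zero_right ω,
    ← C.coord_zero_right 1, ← C.coord_zero_right (star ω), ← C.coord_zero_right (1 + c)] at h
  change _ = _ * C.coord (star ω + c * ω) (star ω - ω) at h
  rw [C.coord_mul, C.coord_add, C.coord_add, C.coord_mul, C.coord_mul] at h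
  obtain ⟨h₁, h₂⟩ := C.coord_inj h
  simp only [star_add, star_sub, star_mul, star_star, star_zero, C.star_c, mul_zero,
    zero_add, sub_zero, star_one] at h₁ h₂
  have h₃ : t = 1 + s := by
    refine sub_eq_zero.1 ((hdom _ _ ?_).resolve_right hω0)
    linear_combination h₂
  have h₄ : s = 0 := by
    refine ((hdom _ _ ?_).resolve_right hc0)
    refine ((hdom _ _ ?_).resolve_right hω0)
    rw [h₃] at h₁
    linear_combination -h₁
  rw [h₃, h₄, add_zero, e₅]

namespace QuadIso

/-- For a quaternion pair, `φ₁(a e)` never lies in `φ₁(a) K'`. -/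
def IsSwitching (Q : QuadIso Ξ Ξ') : Prop := ∀ (p : Ξ.T) (e : K), Ξ.IsQuatPair p.scal e →
  ∀ x' : K', Q.φ₁ (p.vec <• e) ≠ Q.φ₁ p.vec <• x'

variable (Q : QuadIso Ξ Ξ')

theorem isSwitching_of_not_exists
    (h : ¬ ∃ g : K ≃+* K', ∀ p : Ξ.T, p.vec = 0 → (Q.γ p).scal = g p.scal) : Q.IsSwitching := by
  intro p e he x' hx
  obtain ⟨Φ, hΦ⟩ := Q.caseI_of_mem_span he hx
  exact h ⟨Φ.φ, fun p _ => (hΦ p).2⟩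

theorem isSwitching_symm_of_not_exists
    (h : ¬ ∃ g : K ≃+* K', ∀ p : Ξ.T, p.vec = 0 → (Q.γ p).scal = g p.scal) :
    Q.symm.IsSwitching := by
  intro p e he x' hx
  obtain ⟨Φ, hΦ⟩ := Q.symm.caseI_of_mem_span he hx
  refine h ⟨Φ.φ.symm, fun p _ => ?_⟩
  have := (hΦ (Q.γ p)).2
  rw [RingEquiv.eq_symm_apply, ← this]
  exact congrArg T.scal (Q.symm_γ_γ p)

theorem not_exists_of_isSwitching (hQ : Q.IsSwitching) (hn : ∃ x y : K, x * y ≠ y * x) :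
    ¬ ∃ g : K ≃+* K', ∀ p : Ξ.T, p.vec = 0 → (Q.γ p).scal = g p.scal := by
  rintro ⟨g, hg⟩
  obtain ⟨p, hp⟩ := Q.proper.exists_star_scal_ne
  obtain ⟨e, he⟩ := exists_quatPair Q.proper Q.central hn hp
  refine Q.not_exists_ringEquiv he (hQ p e he) g fun r => ?_
  have hr := (Q.proper.mem_gen_iff Q.central).1 r.2
  rw [← T.scal_cen (Ξ := Ξ) r hr, ← hg _ (T.vec_cen _ hr), Q.scal_γ_cen]

/-- A vector of the frame is of the form `φ₁(a e)`. -/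
theorem exists_map_smul_eq_vec (hQ : Q.IsSwitching) (hn : ∃ x y : K, x * y ≠ y * x)
    (hn' : ∃ x y : K', x * y ≠ y * x) (h2 : Module.finrank K'ᵐᵒᵖ L' = 2) (fr : Frame Ξ')
    {p : Ξ.T} (hp : Q.γ p = T.lift fr.a) :
    ∃ third e, Ξ.IsQuatPair p.scal e ∧ Q.φ₁ (p.vec <• e) = fr.vec third ∧
      (Q.φ (Ξ.nm e) : K') = fr.coeff third := by
  have hΞ' := Q.proper'
  have hc' := Q.central'
  have hK : ∀ z : Subring.center K', (z : K') ∈ Ξ'.K₀ := fun z =>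
    (hΞ'.mem_K₀_iff_mem_center hc' hn').2 z.2
  have hφK : ∀ r : Ξ.gen, (Q.φ r : K') ∈ Ξ'.K₀ := fun r => (hΞ'.mem_gen_iff hc').1 (Q.φ r).2
  have hα₁ := fr.star_q_ne hΞ'
  have hpair := fr.pair hΞ' hc'
  have hvec : Q.φ₁ p.vec = fr.a := by rw [← Q.vec_γ, hp]; rfl
  have hscal : (Q.γ p).scal = Ξ'.q fr.a := by rw [hp]; rfl
  have hα : star p.scal ≠ p.scal := by
    have := Q.symm.star_scal_ne (p := Q.γ p) (by rw [hscal]; exact hα₁)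
    have e₁ : Q.symm.γ (Q.γ p) = p := Q.symm_γ_γ p
    rwa [e₁] at this
  have hspan : ∀ c, Ξ'.f fr.a c = 0 → ∃ y : K', c = fr.b <• y := fun c hc =>
    exists_eq_smul_of_f_eq_zero fr.f_self fr.f_orth hc
      ((fr.chartData hΞ' hc' hn' h2 false).exists_vec c)
  obtain ⟨e₀, he₀⟩ := exists_quatPair Q.proper Q.central hn hα
  obtain ⟨h₁, -, h₃⟩ := Q.of_not_mem_span he₀ (hQ _ _ he₀)
  rw [hvec] at h₁
  rw [hscal] at h₃
  have hc0 : Q.φ₁ (p.vec <• e₀) ≠ 0 := fun h => hQ _ _ he₀ 0 (by rw [h, rs_zero])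
  obtain ⟨y, hy⟩ := hspan _ h₁
  have hy0 : y ≠ 0 := by rintro rfl; exact hc0 (by rw [hy, rs_zero])
  have hμ0 : (fr.μ : K') ≠ 0 := fun h => fr.b_ne ((Ξ'.q_aniso _).1 (by
    have := fr.q_b
    rwa [h, zero_mul, sub_zero] at this))
  have hcomm : star y * Ξ'.q fr.a * y * Ξ'.q fr.a = Ξ'.q fr.a * (star y * Ξ'.q fr.a * y) := by
    have k₁ := (Q.γ (p.rsmul e₀)).mem
    have k₂ := ((T.mk fr.b _ fr.q_b).rsmul y).mem
    rw [Q.vec_γ, T.vec_rsmul, h₃] at k₁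
    rw [T.vec_rsmul, T.vec_mk, ← hy, T.scal_rsmul, T.scal_mk] at k₂
    have k₃ := hc' _ (sub_mem k₁ k₂) (Ξ'.q fr.a)
    rw [sub_sub_sub_cancel_left, sub_mul, mul_sub] at k₃
    rw [mul_assoc (Q.φ _ : K'), ← mul_assoc _ (Q.φ _ : K'), ← hc' _ (hφK _) (Ξ'.q fr.a),
      mul_assoc (Q.φ _ : K'), sub_left_inj] at k₃
    have k₄ : star y * (fr.μ * Ξ'.q fr.a) * y = fr.μ * (star y * Ξ'.q fr.a * y) := by
      rw [← mul_assoc, ← hc' _ (hK fr.μ)]; simp only [mul_assoc]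
    rw [k₄, mul_assoc, ← mul_assoc _ (fr.μ : K'), ← hc' _ (hK fr.μ) (Ξ'.q fr.a), mul_assoc,
      mul_assoc (fr.μ : K')] at k₃
    rw [mul_assoc _ y]
    exact mul_left_cancel₀ hμ0 k₃
  obtain ⟨third, z, hz, hcz⟩ : ∃ (third : Bool) (z : K'), z * Ξ'.q fr.a = Ξ'.q fr.a * z ∧
      Q.φ₁ (p.vec <• e₀) <• z = fr.vec third := by
    rcases comm_or_anti hc' hy0 hcomm with h | h
    · refine ⟨false, y⁻¹, ?_, ?_⟩
      · rw [inv_mul_eq_iff_eq_mul₀ hy0, ← mul_assoc, h, mul_assoc, mul_inv_cancel₀ hy0, mul_one]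
      · rw [hy, ← rs_mul, mul_inv_cancel₀ hy0, rs_one]; rfl
    · refine ⟨true, y⁻¹ * fr.e, ?_, ?_⟩
      · rw [mul_assoc, inv_mul_eq_iff_eq_mul₀ hy0, ← mul_assoc, ← mul_assoc, h, mul_assoc (star _),
          mul_inv_cancel₀ hy0, mul_one, hpair.anti]
      · rw [hy, ← rs_mul, mul_inv_cancel_left₀ hy0]; rfl
  obtain ⟨r', s', rfl⟩ := hpair.exists_of_commute hΞ' hc' hz
  obtain ⟨m, rfl⟩ := Q.φ.surjective r'
  obtain ⟨k, rfl⟩ := Q.φ.surjective s'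
  have hmap : Q.φ₁ (p.vec <• ((m + k * p.scal) * e₀)) = fr.vec third := by
    have := Q.map_decomp he₀ (hQ _ _ he₀) 0 0 m k
    rw [hscal, hcz] at this
    simpa [rs_zero] using this
  have he : Ξ.IsQuatPair p.scal ((m + k * p.scal) * e₀) := by
    refine ⟨hα, fun h => fr.vec_ne third (by rw [← hmap, h, rs_zero, map_zero]), ?_⟩
    rw [mul_assoc, he₀.anti, ← mul_assoc, ← mul_assoc, add_mul, mul_add, Q.coe_comm m,
      mul_assoc, ← Q.central.star_mul_self, ← mul_assoc, Q.coe_comm k, mul_assoc _ (k : K) p.scal]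
  refine ⟨third, _, he, hmap, ?_⟩
  have h₄ := (Q.of_not_mem_span he (hQ _ _ he)).2.2
  have h₅ := (Q.γ (p.rsmul ((m + k * p.scal) * e₀))).mem
  rw [h₄, Q.vec_γ, T.vec_rsmul, hmap, hscal] at h₅
  refine hc'.eq_of_mul_sub_mem hα₁ (hφK _) (hK _) ?_
  have h₆ := sub_mem (fr.q_vec hΞ' hc' hn' third) h₅
  rwa [sub_sub_sub_cancel_left] at h₆

/-- The images of the second basis vector and its multiples. -/
theorem map_second_vec (hQ : Q.IsSwitching) (hQ' : Q.symm.IsSwitching)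
    (hn' : ∃ x y : K', x * y ≠ y * x) (h2 : Module.finrank K'ᵐᵒᵖ L' = 2) (fr : Frame Ξ')
    {p r : Ξ.T} {e : K} {third : Bool} (hp : Q.γ p = T.lift fr.a)
    (hr : Q.γ r = (T.lift fr.a).rsmul fr.e) (he : Ξ.IsQuatPair p.scal e)
    (hpe : Q.φ₁ (p.vec <• e) = fr.vec third) :
    Ξ.f p.vec r.vec = 0 ∧ r.scal = Q.symm.φ (Ξ'.nm fr.e) * p.scal ∧
    Q.φ₁ (r.vec <• p.scal) = fr.a <• (Ξ'.q fr.a * fr.e) ∧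
    Q.φ₁ (r.vec <• e) = fr.vec third <• fr.e ∧
    Q.φ₁ (r.vec <• (e * p.scal)) = fr.vec third <• (fr.e * Ξ'.q fr.a) := by
  have hΞ' := Q.proper'
  have hc' := Q.central'
  have hpair := fr.pair hΞ' hc'
  set α₁ := Ξ'.q fr.a with hα₁_def
  set e₁ := fr.e with he₁_def
  set ν := Ξ'.nm e₁ with hν_def
  have hvec : Q.φ₁ p.vec = fr.a := by rw [← Q.vec_γ, hp]; rfl
  have hscal : (Q.γ p).scal = α₁ := by rw [hp]; rfl
  have hrvec : Q.φ₁ r.vec = fr.a <• e₁ := by rw [← Q.vec_γ, hr]; rfl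
  have hrscal : (Q.γ r).scal = ν * star α₁ := by rw [hr]; exact hpair.star_mul_mul hc'
  have hνc : ∀ x : K', (ν : K') * x = x * ν := Q.coe_comm' ν
  have hν0 : (ν : K') ≠ 0 := coe_ne_zero (IsProper.nm_ne_zero _ hpair.e_ne)
  have hν₀ : Q.φ (Q.symm.φ ν) = ν := Q.φ_symm_φ ν
  have hv' : Q.symm.φ₁ (fr.a <• e₁) = r.vec := by
    rw [← hrvec]; exact Q.symm_φ₁_φ₁ _
  have hv : Q.symm.φ₁ fr.a = p.vec := by rw [← hvec]; exact Q.symm_φ₁_φ₁ _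
  have hγp : Q.symm.γ (T.lift fr.a) = p := by rw [← hp]; exact Q.symm_γ_γ p
  have hγr : Q.symm.γ ((T.lift fr.a).rsmul e₁) = r := by rw [← hr]; exact Q.symm_γ_γ r
  obtain ⟨h₁, -, h₃⟩ := Q.symm.of_not_mem_span (p := T.lift fr.a) hpair (hQ' _ _ hpair)
  rw [T.vec_lift, hv, hv'] at h₁
  rw [hγr, hγp] at h₃
  have hrα : Q.φ₁ (r.vec <• p.scal) = fr.a <• (α₁ * e₁) := by
    have := Q.map_vec_scal r
    rw [h₃, Q.map_smul_mul' Q.central, hν₀, hrvec, hrscal, hνc, ← rs_mul, ← mul_assoc, rs_mul]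
      at this
    rw [rs_right_cancel hν0 this, hpair.e_star hc']
  have hαr : star r.scal ≠ r.scal := by
    intro h
    rw [h₃, star_mul, Q.star_coe, ← Q.coe_comm] at h
    refine he.ne (mul_left_cancel₀ (fun h0 => ?_) h)
    have h0' : Q.symm.φ ν = 0 := Subtype.ext h0
    exact hν0 (by rw [← hν₀, h0', map_zero]; rfl)
  have her : Ξ.IsQuatPair r.scal e := by
    refine ⟨hαr, he.e_ne, ?_⟩
    rw [h₃, star_mul, Q.star_coe, ← mul_assoc, ← Q.coe_comm, mul_assoc, he.anti, ← Q.coe_comm,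
      mul_assoc]
  obtain ⟨k₁, k₂, -⟩ := Q.of_not_mem_span her (hQ _ _ her)
  rw [hrvec, Ξ'.f_smul_left] at k₁
  have k₁' := (mul_eq_zero.1 k₁).resolve_left (star_ne_zero.2 hpair.e_ne)
  obtain ⟨y, hy⟩ := exists_eq_smul_of_f_eq_zero fr.f_self (fr.f_vec third) k₁'
    ((fr.chartData hΞ' hc' hn' h2 third).exists_vec _)
  have hreα : Q.φ₁ (r.vec <• (e * p.scal)) = fr.vec third <• (y * α₁) := by
    rw [h₃, ← mul_assoc, ← Q.coe_comm, mul_assoc, Q.map_smul_mul' Q.central, hν₀, hrscal, hy,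
      star_mul, star_star, Q.star_coe', rs_mul _ α₁] at k₂
    rw [rs_right_cancel hν0 k₂, rs_mul]
  set w := 1 + Q.symm.φ ν with hw_def
  have hfdp : Ξ.f r.vec p.vec = 0 := f_eq_zero_symm h₁
  have hts : (p * r).scal = w * p.scal := by
    rw [T.scal_mul, hfdp, add_zero, h₃, hw_def, Subring.coe_add, Subring.coe_one, add_mul, one_mul]
  have hw0 : (w : K) ≠ 0 := by
    intro h
    have h₄ : (p * r).vec = 0 := by
      by_contra h'
      exact T.scal_ne_zero h' (by rw [hts, h, zero_mul])
    have h₅ := congrArg (Ξ.f p.vec) h₄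
    rw [T.vec_mul, Ξ.f_add_right, h₁, add_zero, f_zero_right, Q.proper.f_self] at h₅
    exact he.ne (sub_eq_zero.1 h₅).symm
  have hwφ : (Q.φ w : K') = 1 + ν := by rw [hw_def, map_add, hν₀, map_one]; rfl
  have hw0' : (1 + ν : K') ≠ 0 := by
    rw [← hwφ]; exact Q.φ_ne_zero fun h => hw0 (by rw [h]; rfl)
  have het : Ξ.IsQuatPair (p * r).scal e := by
    refine ⟨fun h => ?_, he.e_ne, ?_⟩
    · rw [hts, star_mul, Q.star_coe, ← Q.coe_comm] at h
      exact he.ne (mul_left_cancel₀ hw0 h)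
    · rw [hts, star_mul, Q.star_coe, ← mul_assoc, ← Q.coe_comm, mul_assoc, he.anti, ← Q.coe_comm,
        mul_assoc]
  have l₁ := (Q.of_not_mem_span het (hQ _ _ het)).2.1
  have l₂ := (Q.of_not_mem_span he (hQ _ _ he)).2.1
  rw [hscal, hpe] at l₂
  have hfa : Ξ'.f fr.a fr.a = α₁ - star α₁ := hΞ'.f_self (T.lift fr.a)
  have l₃ : star (Q.γ (p * r)).scal = star α₁ + ν * α₁ + (star α₁ - α₁) * e₁ := by
    rw [map_mul, T.scal_mul, hscal, hrscal, Q.vec_γ, Q.vec_γ, hrvec, hvec, Ξ'.f_smul_left, hfa,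
      star_add, star_add, star_mul, star_mul, star_star, star_star, star_sub, star_star,
      Q.star_coe', hνc]
  have key : (star α₁ + y * α₁) * (1 + ν) =
      (1 + y) * (star α₁ + ν * α₁ + (star α₁ - α₁) * e₁) := by
    refine rs_left_cancel (fr.vec_ne third) ?_
    rw [l₃, hts, ← mul_assoc, ← Q.coe_comm, mul_assoc, Q.map_smul_mul' Q.central, hwφ, T.vec_mul,
      add_rs, add_rs, map_add, map_add, hpe, hy, l₂, hreα] at l₁
    rw [rs_mul _ _ (1 + (ν : K')), rs_mul, rs_add _ (star α₁),
      rs_add (fr.vec third) 1, rs_one, l₁]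
  have hye : y = e₁ := by
    set D := fr.chartData hΞ' hc' hn' h2 third with hD
    have k₃ : D.chart.ι ⟨0, 1⟩ = α₁ := D.ι_omega
    have k₄ : D.chart.ι (algebraMap _ _ fr.ν) = ν := (D.ι_algebraMap _).trans fr.norm_e.symm
    refine D.chart.eq_e_of_eq ?_ ?_ ?_
    · rw [k₃]; exact hpair.ne
    · rw [k₄]; exact hw0'
    · rw [k₃, k₄]; exact key
  subst hye
  exact ⟨h₁, h₃, hrα, hy, hreα⟩

end QuadIso

end PseudoQuadraticSpace

namespace PseudoQuadraticSpace

variable {K L K' L' : Type*} [DivisionRing K] [StarRing K] [AddCommGroup L] [Module Kᵐᵒᵖ L]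
  [DivisionRing K'] [StarRing K'] [AddCommGroup L'] [Module K'ᵐᵒᵖ L']
  {Ξ : PseudoQuadraticSpace K L} {Ξ' : PseudoQuadraticSpace K' L'}

namespace QuadIso

variable (Q : QuadIso Ξ Ξ')

/-- Every frame can be used to describe a switching isomorphism. -/
theorem IsSwitching.inducedViaFrame (hQ : Q.IsSwitching) (hQ' : Q.symm.IsSwitching)
    (hn : ∃ x y : K, x * y ≠ y * x) (hn' : ∃ x y : K', x * y ≠ y * x)
    (h2 : Module.finrank K'ᵐᵒᵖ L' = 2) (fr : Frame Ξ') : InducedViaFrame fr Q.γ := by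
  have hΞ' := Q.proper'
  have hc' := Q.central'
  have hpair := fr.pair hΞ' hc'
  have hK : ∀ z : Subring.center K', (z : K') ∈ Ξ'.K₀ := fun z =>
    (hΞ'.mem_K₀_iff_mem_center hc' hn').2 z.2
  obtain ⟨p, hp⟩ := Q.γ.surjective (T.lift fr.a)
  obtain ⟨r, hr⟩ := Q.γ.surjective ((T.lift fr.a).rsmul fr.e)
  obtain ⟨third, e, he, hpe, hnm⟩ := Q.exists_map_smul_eq_vec hQ hn hn' h2 fr hp
  obtain ⟨h₁, h₂, h₃, h₄, h₅⟩ := Q.map_second_vec hQ hQ' hn' h2 fr hp hr he hpe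
  have hvec : Q.φ₁ p.vec = fr.a := by rw [← Q.vec_γ, hp]; rfl
  have hscal : (Q.γ p).scal = Ξ'.q fr.a := by rw [hp]; rfl
  have hrvec : Q.φ₁ r.vec = fr.a <• fr.e := by rw [← Q.vec_γ, hr]; rfl
  have hγp : Q.symm.γ (T.lift fr.a) = p := by rw [← hp]; exact Q.symm_γ_γ p
  let θ : Subring.center K' →+* Ξ'.gen := centerToGen fun z hz => hK ⟨z, hz⟩
  let κ : Subring.center K' →+* K := Ξ.gen.subtype.comp ((Q.symm.φ : Ξ'.gen →+* Ξ.gen).comp θ)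
  have hκ : ∀ z, κ z = Q.symm.φ (θ z) := fun z => rfl
  have hθ' : ∀ (z : Subring.center K') (g : Ξ'.gen), (g : K') = z → θ z = g := fun z g h =>
    Subtype.ext h.symm
  let D : ChartData Ξ fr.τ fr.n (fr.coeff third) fr.ν :=
    { proper := Q.proper
      central := Q.central
      κ := κ
      κ_mem := fun z => (Q.proper.mem_gen_iff Q.central).1 (Q.symm.φ (θ z)).2
      exists_κ := fun u hu => by
        have hm : (Q.φ ⟨u, mem_gen hu⟩ : K') ∈ Subring.center K' :=
          (hΞ'.mem_K₀_iff_mem_center hc' hn').1 ((hΞ'.mem_gen_iff hc').1 (Subtype.property _))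
        refine ⟨⟨_, hm⟩, ?_⟩
        rw [hκ, hθ' _ (Q.φ ⟨u, mem_gen hu⟩) rfl]
        exact congrArg Subtype.val (Q.symm_φ_φ _)
      a := p
      b := r
      e := e
      pair := he
      κ_τ := by
        rw [hκ, hθ' _ (Ξ'.tr (T.lift fr.a).scal) fr.trace_eq, Q.symm.map_tr, hγp]; rfl
      κ_n := by
        rw [hκ, hθ' _ (Ξ'.nm (T.lift fr.a).scal) fr.norm_eq, Q.symm.map_nm, hγp]; rfl
      κ_c := by
        rw [hκ, hθ' _ _ hnm]
        exact congrArg Subtype.val (Q.symm_φ_φ _)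
      b_ne := fun h => by
        rw [h, map_zero] at hrvec
        rcases rs_eq_zero.1 hrvec.symm with h | h
        · exact fr.f_self (by rw [h, f_zero_left])
        · exact hpair.e_ne h
      scal_b := by rw [h₂, hκ, hθ' _ (Ξ'.nm fr.e) fr.norm_e]
      orth := h₁
      exists_vec := fun v => by
        have := Q.symm.exists_eq_add_of_not_mem_span (p := T.lift fr.a) hpair (hQ' _ _ hpair) v
        rw [T.vec_lift, ← hrvec, ← hvec] at this
        have k₁ : ∀ v, Q.symm.φ₁ (Q.φ₁ v) = v := Q.symm_φ₁_φ₁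
        rwa [k₁, k₁] at this }
  have hφκ : ∀ z, (Q.φ (Q.symm.φ (θ z)) : K') = z := fun z =>
    congrArg Subtype.val (Q.φ_symm_φ (θ z))
  have hDκ : ∀ z, D.κ z = Q.symm.φ (θ z) := fun z => rfl
  refine inducedViaFrame_of_chartData (third := third) hΞ' hc' hn' h2 D
    fun t x₁ x₂ y₁ y₂ u ht => Chart.rep_γ _ _ Q (fun x₁ x₂ y₁ y₂ => ?_) (fun u hu => ?_) ht
  · change Q.φ₁ (p.vec <• ((D.κ x₁.re + D.κ x₁.im * p.scal) + (D.κ x₂.re + D.κ x₂.im * p.scal) * e)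
      + r.vec <• ((D.κ y₁.re + D.κ y₁.im * p.scal) + (D.κ y₂.re + D.κ y₂.im * p.scal) * e)) =
      fr.a <• ((x₁.re + x₁.im * Ξ'.q fr.a) + (y₁.re + y₁.im * Ξ'.q fr.a) * fr.e) +
      fr.vec third <• ((x₂.re + x₂.im * Ξ'.q fr.a) + (y₂.re + y₂.im * Ξ'.q fr.a) * fr.e)
    have hrαe : Q.φ₁ (r.vec <• (p.scal * e)) = fr.vec third <• (Ξ'.q fr.a * fr.e) := by
      have k₁ : p.scal * e = Ξ.tr p.scal * e - e * p.scal := by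
        rw [← he.e_star Q.central, star_eq_tr_sub (Ξ := Ξ), mul_sub, Q.coe_comm]
      rw [k₁, rs_sub, map_sub, Q.map_smul_mul' Q.central, h₄, h₅, Q.map_tr, hscal, ← rs_mul,
        ← rs_sub, ← mul_sub, ← star_eq_tr_sub, hpair.e_star hc']
    have hcm : ∀ (v : L') (x : K') (z : Subring.center K'), (v <• x) <• (z : K') = v <• (z * x) :=
      fun v x z => by rw [← rs_mul, hc' _ (hK z)]
    have hr' : Q.φ₁ (r.vec <• ((D.κ y₁.re + D.κ y₁.im * p.scal) +
        (D.κ y₂.re + D.κ y₂.im * p.scal) * e)) =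
        fr.a <• ((y₁.re + y₁.im * Ξ'.q fr.a) * fr.e) +
          fr.vec third <• ((y₂.re + y₂.im * Ξ'.q fr.a) * fr.e) := by
      simp only [hDκ]
      rw [rs_add, rs_add, add_mul (Q.symm.φ (θ y₂.re) : K), rs_add, mul_assoc _ _ e, map_add,
        map_add, map_add, Q.map_smul, Q.map_smul_mul' Q.central, Q.map_smul_mul' Q.central,
        Q.map_smul_mul' Q.central, h₃, h₄, hrαe, hrvec, hφκ, hφκ, hφκ, hφκ, hcm, hcm, hcm, hcm,
        add_mul, add_mul, rs_add, rs_add, mul_assoc, mul_assoc]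
    rw [map_add, hr']
    simp only [hDκ]
    rw [Q.map_decomp he (hQ _ _ he), hvec, hpe, hscal, hφκ, hφκ, hφκ, hφκ,
      rs_add fr.a ((x₁.re : K') + x₁.im * Ξ'.q fr.a),
      rs_add (fr.vec third) ((x₂.re : K') + x₂.im * Ξ'.q fr.a)]
    abel
  · have hu0 : u.im = 0 := D.im_eq_zero_of_star hu
    have k₁ : (⟨_, mem_gen (D.chart.map_mem u hu)⟩ : Ξ.gen) = Q.symm.φ (θ u.re) := Subtype.ext (by
      refine (D.ι_apply u).trans ?_
      rw [hu0, map_zero, zero_mul, add_zero, hDκ])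
    rw [k₁, hφκ]
    refine (Eq.trans ?_ (ChartData.ι_apply _ u).symm)
    rw [hu0, map_zero, zero_mul, add_zero]
    rfl

theorem IsSwitching.finrank_eq_two (hQ : Q.IsSwitching) (hn : ∃ x y : K, x * y ≠ y * x) :
    Module.finrank K'ᵐᵒᵖ L' = 2 := by
  obtain ⟨p, hp⟩ := Q.proper.exists_star_scal_ne
  obtain ⟨e, he⟩ := exists_quatPair Q.proper Q.central hn hp
  exact finrank_eq_two_of_span (Q.φ₁_ne_zero (T.vec_ne_zero_of_star_ne hp)) (hQ p e he)
    (Q.exists_eq_add_of_not_mem_span he (hQ p e he))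

theorem IsSwitching.exists_frame (hQ : Q.IsSwitching) (hn : ∃ x y : K, x * y ≠ y * x)
    (hn' : ∃ x y : K', x * y ≠ y * x) : Nonempty (Frame Ξ') := by
  have hΞ' := Q.proper'
  have hc' := Q.central'
  have hK : ∀ {z : K'}, z ∈ Ξ'.K₀ → z ∈ Subring.center K' := fun h =>
    (hΞ'.mem_K₀_iff_mem_center hc' hn').1 h
  obtain ⟨p', hp'⟩ := hΞ'.exists_star_scal_ne
  have hfa : Ξ'.f p'.vec p'.vec ≠ 0 := by
    rw [hΞ'.f_self]; exact sub_ne_zero.2 hp'.symm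
  have hq : star (T.lift p'.vec : Ξ'.T).scal ≠ (T.lift p'.vec : Ξ'.T).scal := fun h => hfa (by
    have := hΞ'.f_self (T.lift p'.vec)
    rwa [h, sub_self] at this)
  obtain ⟨e', he'⟩ := exists_quatPair hΞ' hc' hn' hq
  obtain ⟨p, hp⟩ := Q.γ.surjective (T.lift p'.vec)
  have hps : star p.scal ≠ p.scal := by
    have := Q.symm.star_scal_ne hq
    rw [← hp] at this
    have e₁ : Q.symm.γ (Q.γ p) = p := Q.symm_γ_γ p
    rwa [e₁] at this
  obtain ⟨e, he⟩ := exists_quatPair Q.proper Q.central hn hps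
  obtain ⟨h₁, -, h₃⟩ := Q.of_not_mem_span he (hQ p e he)
  have hvec : Q.φ₁ p.vec = p'.vec := by rw [← Q.vec_γ, hp]; rfl
  have hmem := (Q.γ (p.rsmul e)).mem
  rw [h₃, Q.vec_γ, T.vec_rsmul, hp, T.scal_lift] at hmem
  exact ⟨{ a := p'.vec
           b := Q.φ₁ (p.vec <• e)
           e := e'
           τ := ⟨_, hK (Ξ'.trace_mem (Ξ'.q p'.vec))⟩
           n := ⟨_, hK (star_mul_self_mem (Ξ'.q p'.vec))⟩
           ν := ⟨_, hK (star_mul_self_mem e')⟩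
           μ := ⟨_, hK ((hΞ'.mem_gen_iff hc').1 (Q.φ (Ξ.nm e)).2)⟩
           f_self := hfa
           f_orth := by rw [← hvec]; exact h₁
           b_ne := fun h => hQ p e he 0 (by rw [h, rs_zero])
           perp := (hΞ'.isPerp_iff hc' (T.lift p'.vec) hq).2 he'
           trace_eq := rfl
           norm_eq := rfl
           norm_e := rfl
           q_b := hmem }⟩

end QuadIso

end PseudoQuadraticSpace

namespace PseudoQuadraticSpace

variable {K L K' L' : Type*} [DivisionRing K] [StarRing K] [AddCommGroup L] [Module Kᵐᵒᵖ L]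
  [DivisionRing K'] [StarRing K'] [AddCommGroup L'] [Module K'ᵐᵒᵖ L']
  {Ξ : PseudoQuadraticSpace K L} {Ξ' : PseudoQuadraticSpace K' L'}

theorem QuadIso.caseIII (Q : QuadIso Ξ Ξ') (hn : ∃ x y : K, x * y ≠ y * x)
    (hcomm' : ∀ x y : K', x * y = y * x) : CaseIII Q.γ := by
  obtain ⟨p, hp⟩ := Q.proper.exists_star_scal_ne
  obtain ⟨e, he⟩ := exists_quatPair Q.proper Q.central hn hp
  have hperp := (Q.proper.isPerp_iff Q.central p hp).2 he
  have ha := T.vec_ne_zero_of_star_ne hp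
  obtain ⟨h₁, h₂, h₃⟩ := Q.splitFormula hcomm' ha hperp
  exact ⟨Q.proper.isTypeIV_iff.2 ⟨Q.central, hn⟩, Q.proper'.isTypeIII_iff.2 ⟨Q.central', hcomm'⟩,
    h₁, h₂, p.vec, e, ha, hperp, h₃⟩

theorem QuadIso.caseI_or_caseII (Q : QuadIso Ξ Ξ') (hn : ∃ x y : K, x * y ≠ y * x)
    (hn' : ∃ x y : K', x * y ≠ y * x) : CaseI Q.γ ∨ CaseII Q.γ := by
  by_cases h : CaseI Q.γ
  · exact Or.inl h
  have hQ : Q.IsSwitching := fun p e he x' hx => h (Q.caseI_of_mem_span he hx)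
  have hg := Q.not_exists_of_isSwitching hQ hn
  have hQ' := Q.isSwitching_symm_of_not_exists hg
  have h2 := hQ.finrank_eq_two Q hn
  obtain ⟨fr⟩ := hQ.exists_frame Q hn hn'
  exact Or.inr ⟨Q.proper.isTypeIV_iff.2 ⟨Q.central, hn⟩,
    Q.proper'.isTypeIV_iff.2 ⟨Q.central', hn'⟩, hQ'.finrank_eq_two Q.symm hn', h2, hg, fr,
    hQ.inducedViaFrame Q hQ' hn hn' h2 fr⟩

theorem IsJordanIso.cases (hΞ : Ξ.IsProper) (hΞ' : Ξ'.IsProper) {γ : Ξ.T → Ξ'.T}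
    (h : IsJordanIso γ) : CaseI γ ∨ CaseII γ ∨ (CaseIII γ ∨ CaseIIIInv γ) ∨ CaseIV γ := by
  by_cases hc : Ξ.IsCentral
  swap
  · exact Or.inl (h.caseI_of_not_isCentral hΞ hΞ' hc)
  by_cases hF : ∀ u ∈ Ξ.K₀, u = 0 ∨ u = 1
  · exact (h.caseI_or_caseIV hΞ hΞ' hF).imp_right fun h => Or.inr (Or.inr h)
  push Not at hF
  obtain ⟨Q, rfl⟩ := h.exists_quadIso hΞ hΞ' hc hF
  by_cases hn : ∀ x y : K, x * y = y * x <;> by_cases hn' : ∀ x y : K', x * y = y * x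
  · exact Or.inl (Q.caseI_of_comm hn hn')
  · push Not at hn'
    exact Or.inr (Or.inr (Or.inl (Or.inr
      ⟨Q.symm.γ, Q.symm_γ_γ, Q.γ_symm_γ, Q.symm.caseIII hn' hn⟩)))
  · push Not at hn
    exact Or.inr (Or.inr (Or.inl (Or.inl (Q.caseIII hn hn'))))
  · push Not at hn hn'
    exact (Q.caseI_or_caseII hn hn').imp_right Or.inl

end PseudoQuadraticSpace

theorem mainTheorem5 {K L K' L' : Type*}
    [DivisionRing K] [StarRing K] [AddCommGroup L] [Module Kᵐᵒᵖ L]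
    [DivisionRing K'] [StarRing K'] [AddCommGroup L'] [Module K'ᵐᵒᵖ L']
    (Ξ : PseudoQuadraticSpace K L) (Ξ' : PseudoQuadraticSpace K' L')
    (hΞ : Ξ.IsProper) (hΞ' : Ξ'.IsProper) (γ : Ξ.T → Ξ'.T) :
    (PseudoQuadraticSpace.IsJordanIso γ ↔
      PseudoQuadraticSpace.CaseI γ ∨ PseudoQuadraticSpace.CaseII γ ∨
      (PseudoQuadraticSpace.CaseIII γ ∨ PseudoQuadraticSpace.CaseIIIInv γ) ∨
      PseudoQuadraticSpace.CaseIV γ) ∧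
    (PseudoQuadraticSpace.CaseII γ →
      ∀ fr : PseudoQuadraticSpace.Frame Ξ', PseudoQuadraticSpace.InducedViaFrame fr γ) ∧
    (PseudoQuadraticSpace.CaseIII γ →
      ∀ (a : L) (e : K), a ≠ 0 → Ξ.IsPerp a e →
        PseudoQuadraticSpace.SplitFormula γ a e) := by
  refine ⟨⟨fun h => h.cases hΞ hΞ', ?_⟩, fun h fr => ?_, fun h a e ha he => ?_⟩
  · rintro (⟨Φ, h⟩ | h | (h | ⟨δ, h₁, h₂, h⟩) | h)
    · exact PseudoQuadraticSpace.isJordanIso_of_inducedBy hΞ' Φ h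
    · exact h.isJordanIso hΞ hΞ'
    · exact h.isJordanIso hΞ hΞ'
    · exact PseudoQuadraticSpace.IsJordanIso.of_inverse h₁ h₂ (h.isJordanIso hΞ' hΞ)
    · exact h.isJordanIso hΞ'
  · have hJ := h.isJordanIso hΞ hΞ'
    obtain ⟨h₁, h₂, -, h2, hg, -⟩ := h
    obtain ⟨hc, hn⟩ := hΞ.isTypeIV_iff.1 h₁
    obtain ⟨hc', hn'⟩ := hΞ'.isTypeIV_iff.1 h₂
    obtain ⟨Q, rfl⟩ := hJ.exists_quadIso hΞ hΞ' hc
      (PseudoQuadraticSpace.exists_ne_of_not_comm Ξ hn)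
    exact (Q.isSwitching_of_not_exists hg).inducedViaFrame Q (Q.isSwitching_symm_of_not_exists hg)
      hn hn' h2 fr
  · have hJ := h.isJordanIso hΞ hΞ'
    obtain ⟨h₁, h₂, -⟩ := h
    obtain ⟨hc, hn⟩ := hΞ.isTypeIV_iff.1 h₁
    obtain ⟨Q, rfl⟩ := hJ.exists_quadIso hΞ hΞ' hc
      (PseudoQuadraticSpace.exists_ne_of_not_comm Ξ hn)
    exact (Q.splitFormula h₂.1 ha he).2.2
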